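/- Let $(V,g)$ be a smooth, oriented and time-oriented $4$-dimensional spacetime of signature $(-,+,+,+)$, and let $S\subset V$ be an oriented, closed (compact without boundary), spacelike, $C^2$ embedded $2$-surface with induced metric $h$ and area form $\eta_S$. Write $u\cdot v=g(u,v)$, let $\nabla$ be the Levi-Civita connection of $g$, $D$ that of $h$, and let $\nabla^\perp$ denote the connection on the normal bundle of $S$ (the normal part of $\nabla$). The mean curvature vector is $\vec H=h^{AB}\vec K_{AB}$, where $\vec K(X,Y)=-(\nabla_XY)^\perp$. The Hodge dual of a normal vector $\vec W$ is $(W^\star)^\alpha=\tfrac12\,\eta^\alpha{}_{\beta\gamma\delta}W^\beta e_A^\gamma e_B^\delta\,\eta_S^{AB}$, where $\eta$ is the volume form of $g$ and $(e_A)$ is a basis of the tangent space of $S$. At each point, let $C^{+}$ (resp. $C^-$) be the set of normal vectors that are future (resp. past) causal, i.e. timelike or null, with $0$ included, and let $A^{\pm}$ be the set of normal vectors whose Hodge dual lies in $C^{\pm}$. Let $\vec\xi$ be a $C^2$ normal vector field on $S$ (for instance the normal velocity, at one instant, of a flow of surfaces through $S$), and put $$I=\int_S \mathrm{tr}_S\big(\vec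 H\cdot\nabla^\perp\nabla^\perp\vec\xi\,\big)\,\eta_S,\qquad \mathrm{tr}_S\big(\nabla^\perp\nabla^\perp\vec\xi\,\big)=h^{AB}\big(\nabla^\perp_{e_A}\nabla^\perp_{e_B}\vec\xi-\nabla^\perp_{D_{e_A}e_B}\vec\xi\,\big).$$ Then the integrand is integrable, and the following hold. (a) If $\vec H=B\,\vec\xi^{\,\star}$ on $S$ for some function $B:S\to\mathbb R$, then $I=0$ provided that either $\vec\xi\cdot\vec\xi=0$ everywhere on $S$, or $B$ is constant on $S$. (b) Assume that $\vec\xi\cdot\vec H=a$ and $\vec\xi\cdot\vec H^{\star}=c$ on $S$ for some constants $a,c\in\mathbb R$. Then $I\ge 0$ provided that one of the following holds everywhere on $S$: (i) $\vec\xi\in C^+$ and $\vec H\in C^-$; (ii) $\vec\xi\in C^-$ and $\vec H\in C^+$; (iii) $\vec\xi,\vec H\in A^+$; (iv) $\vec\xi,\vec H\in A^-$. -/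

import Mathlib

open Bundle Filter MeasureTheory Topology
open scoped Manifold ContDiff

noncomputable section

/-! ### Local frames, Christoffel symbols, orientations on an `n`-manifold

Mathlib identifies `T_x M` with `ℝⁿ` through the preferred chart at `x`, so that the standard basis
of `ℝⁿ` is the coordinate basis of that chart at `x`. -/

section Generic

variable {n : ℕ} {M : Type*} [TopologicalSpace M] [ChartedSpace (EuclideanSpace ℝ (Fin n)) M]

/-- The coordinate basis `∂_1, …, ∂_n` of `T_x M` given by the preferred chart at `x`. -/
def tangentBasis (x : M) : Module.Basis (Fin n) ℝ (TangentSpace (𝓡 n) x) :=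
  (EuclideanSpace.basisFun (Fin n) ℝ).toBasis

/-- The `i`-th coordinate vector field of the preferred chart at `x₀`, a vector field on the domain
of this chart (and `0` outside). -/
def coordField [IsManifold (𝓡 n) 1 M] (x₀ : M) (i : Fin n) (x : M) : TangentSpace (𝓡 n) x :=
  (trivializationAt (EuclideanSpace ℝ (Fin n)) (TangentSpace (𝓡 n) : M → Type _) x₀).symm x
    (EuclideanSpace.basisFun (Fin n) ℝ i)

/-- The matrix `b_{ij} = b(∂_i, ∂_j)` at `x`, in the preferred chart at `x`. -/
def metricMatrix (b : ∀ x : M, TangentSpace (𝓡 n) x → TangentSpace (𝓡 n) x → ℝ) (x : M) :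
    Matrix (Fin n) (Fin n) ℝ :=
  Matrix.of fun i j => b x (tangentBasis x i) (tangentBasis x j)

/-- The matrix `b_{ij}` at `x` in the chart that is preferred at `x₀`. -/
def chartMatrix [IsManifold (𝓡 n) 1 M]
    (b : ∀ x : M, TangentSpace (𝓡 n) x → TangentSpace (𝓡 n) x → ℝ) (x₀ x : M) :
    Matrix (Fin n) (Fin n) ℝ :=
  Matrix.of fun i j => b x (coordField x₀ i x) (coordField x₀ j x)

/-- `∂_k b_{ij}` at `x`, in the preferred chart at `x`. -/
def partialMetric [IsManifold (𝓡 n) 1 M]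
    (b : ∀ x : M, TangentSpace (𝓡 n) x → TangentSpace (𝓡 n) x → ℝ) (x : M) (k i j : Fin n) : ℝ :=
  mfderiv (𝓡 n) 𝓘(ℝ, ℝ) (fun y => chartMatrix b x y i j) x (tangentBasis x k)

/-- The Christoffel symbol `Γ^k_{ij} = ½ b^{kl} (∂_i b_{jl} + ∂_j b_{il} - ∂_l b_{ij})` of the
Levi-Civita connection of the metric `b`, at `x` in the preferred chart at `x`. -/
def christoffel [IsManifold (𝓡 n) 1 M]
    (b : ∀ x : M, TangentSpace (𝓡 n) x → TangentSpace (𝓡 n) x → ℝ) (x : M) (k i j : Fin n) : ℝ :=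
  (1 / 2) * ∑ l, (metricMatrix b x)⁻¹ k l *
    (partialMetric b x i j l + partialMetric b x j i l - partialMetric b x l i j)

variable (n M) in
/-- An orientation of the manifold `M`: an orientation of each tangent space, locally constant with
respect to the charts. -/
structure ManifoldOrientation [IsManifold (𝓡 n) 1 M] where
  /-- the orientation of `T_x M` -/
  toFun : ∀ x : M, Orientation ℝ (TangentSpace (𝓡 n) x) (Fin n)
  locally_const : ∀ x₀ : M, ∀ᶠ x in 𝓝 x₀,
    ∃ hx : x ∈ (trivializationAt (EuclideanSpace ℝ (Fin n))
        (TangentSpace (𝓡 n) : M → Type _) x₀).baseSet,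
      Orientation.map (Fin n) ((trivializationAt (EuclideanSpace ℝ (Fin n))
        (TangentSpace (𝓡 n) : M → Type _) x₀).linearEquivAt ℝ x hx) (toFun x) =
      (toFun x₀ : Orientation ℝ (EuclideanSpace ℝ (Fin n)) (Fin n))

open Classical in
/-- The volume form of the metric `b` on the oriented manifold `M`, at `x`: it takes the value
`√|det b|` on positively oriented coordinate bases. -/
def volForm [IsManifold (𝓡 n) 1 M] (o : ManifoldOrientation n M)
    (b : ∀ x : M, TangentSpace (𝓡 n) x → TangentSpace (𝓡 n) x → ℝ) (x : M) :
    (TangentSpace (𝓡 n) x) [⋀^Fin n]→ₗ[ℝ] ℝ :=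
  ((if o.toFun x = (tangentBasis x).orientation then (1 : ℝ) else -1) *
    √|(metricMatrix b x).det|) • (tangentBasis x).det

/-- The part of the Riemannian measure of `b` on the domain of the preferred chart at `x₀`:
`√(det b_{ij}) dx¹ ⋯ dxⁿ` in coordinates. -/
def chartVolume [IsManifold (𝓡 n) 1 M] [MeasurableSpace M]
    (b : ∀ x : M, TangentSpace (𝓡 n) x → TangentSpace (𝓡 n) x → ℝ) (x₀ : M) : Measure M :=
  ((volume.restrict (extChartAt (𝓡 n) x₀).target).withDensity fun y =>
    ENNReal.ofReal √((chartMatrix b x₀ ((extChartAt (𝓡 n) x₀).symm y)).det)).map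
    (extChartAt (𝓡 n) x₀).symm

/-- The Riemannian measure of `b`: the least measure that dominates its restrictions to all the
chart domains (on a second countable manifold, the unique measure with these restrictions). -/
def riemannianVolume [IsManifold (𝓡 n) 1 M] [MeasurableSpace M]
    (b : ∀ x : M, TangentSpace (𝓡 n) x → TangentSpace (𝓡 n) x → ℝ) : Measure M :=
  ⨆ x₀ : M, chartVolume b x₀

end Generic

/-! ### Spacetimes -/

section Spacetime

variable (V : Type*) [TopologicalSpace V] [ChartedSpace (EuclideanSpace ℝ (Fin 4)) V]
  [IsManifold (𝓡 4) ∞ V]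

/-- A smooth metric of signature `(-,+,+,+)` on the 4-manifold `V`. -/
structure LorentzMetric where
  /-- the scalar product on `T_x V` -/
  inner : ∀ x : V, TangentSpace (𝓡 4) x →L[ℝ] TangentSpace (𝓡 4) x →L[ℝ] ℝ
  symm : ∀ (x : V) (v w : TangentSpace (𝓡 4) x), inner x v w = inner x w v
  signature : ∀ x : V, ∃ e : Module.Basis (Fin 4) ℝ (TangentSpace (𝓡 4) x),
    ∀ i j, inner x (e i) (e j) = if i = j then (if i = 0 then -1 else 1) else 0
  contMDiff : ContMDiff (𝓡 4)
    ((𝓡 4).prod 𝓘(ℝ, EuclideanSpace ℝ (Fin 4) →L[ℝ] EuclideanSpace ℝ (Fin 4) →L[ℝ] ℝ)) ∞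
    (fun x => TotalSpace.mk' (EuclideanSpace ℝ (Fin 4) →L[ℝ] EuclideanSpace ℝ (Fin 4) →L[ℝ] ℝ)
      (E := fun x : V => TangentSpace (𝓡 4) x →L[ℝ] TangentSpace (𝓡 4) x →L[ℝ] ℝ) x (inner x))

variable {V}

/-- The metric as a real valued function of two tangent vectors. -/
def LorentzMetric.form (g : LorentzMetric V) (x : V) (v w : TangentSpace (𝓡 4) x) : ℝ :=
  g.inner x v w

/-- A time orientation of `(V, g)`, given by a continuous timelike vector field, which is declared
to point to the future. -/
structure TimeOrientation (g : LorentzMetric V) where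
  /-- the future timelike vector field -/
  field : ∀ x : V, TangentSpace (𝓡 4) x
  continuous_field : Continuous fun x => (⟨x, field x⟩ : TangentBundle (𝓡 4) V)
  timelike : ∀ x, g.form x (field x) (field x) < 0

/-- Future causal vectors (timelike or null, the vector `0` included). -/
def IsFutureCausal {g : LorentzMetric V} (τ : TimeOrientation g) (x : V)
    (w : TangentSpace (𝓡 4) x) : Prop :=
  g.form x w w ≤ 0 ∧ g.form x w (τ.field x) ≤ 0

/-- Past causal vectors (timelike or null, the vector `0` included). -/
def IsPastCausal {g : LorentzMetric V} (τ : TimeOrientation g) (x : V)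
    (w : TangentSpace (𝓡 4) x) : Prop :=
  g.form x w w ≤ 0 ∧ 0 ≤ g.form x w (τ.field x)

end Spacetime

/-! ### Spacelike surfaces in a spacetime -/

section Surface

variable {V : Type*} [TopologicalSpace V] [ChartedSpace (EuclideanSpace ℝ (Fin 4)) V]
  [IsManifold (𝓡 4) ∞ V]
  {S : Type*} [TopologicalSpace S] [ChartedSpace (EuclideanSpace ℝ (Fin 2)) S]

/-- The metric `h` induced on `S` by `ι : S → V`. -/
def inducedMetric (g : LorentzMetric V) (ι : S → V) (p : S) (v w : TangentSpace (𝓡 2) p) : ℝ :=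
  g.form (ι p) (mfderiv (𝓡 2) (𝓡 4) ι p v) (mfderiv (𝓡 2) (𝓡 4) ι p w)

/-- `ι` is a `C²` embedding of the surface `S` into `V` whose induced metric is positive definite
(in particular it is an immersion). -/
structure IsSpacelikeEmbedding (g : LorentzMetric V) (ι : S → V) : Prop where
  contMDiff : ContMDiff (𝓡 2) (𝓡 4) 2 ι
  isEmbedding : IsEmbedding ι
  spacelike : ∀ (p : S) (v : TangentSpace (𝓡 2) p), v ≠ 0 → 0 < inducedMetric g ι p v v

/-- The vector `w ∈ T_{ι p} V` is normal to the surface. -/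
def IsNormalVector (g : LorentzMetric V) (ι : S → V) (p : S) (w : TangentSpace (𝓡 4) (ι p)) :
    Prop :=
  ∀ v : TangentSpace (𝓡 2) p, g.form (ι p) w (mfderiv (𝓡 2) (𝓡 4) ι p v) = 0

/-- The inverse `h^{AB}` of the induced metric at `p`, in the preferred chart at `p`. -/
def invInduced (g : LorentzMetric V) (ι : S → V) (p : S) : Matrix (Fin 2) (Fin 2) ℝ :=
  (metricMatrix (inducedMetric g ι) p)⁻¹

/-- The tangent vectors `e_A = dι(∂_A)` to the surface at `ι p`, in the preferred chart at `p`. -/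
def tangentVec (ι : S → V) (p : S) (A : Fin 2) : TangentSpace (𝓡 4) (ι p) :=
  mfderiv (𝓡 2) (𝓡 4) ι p (tangentBasis p A)

/-- The normal part `w^⊥ = w - h^{AB} (w · e_A) e_B` of `w ∈ T_{ι p} V`. -/
def normalPart (g : LorentzMetric V) (ι : S → V) (p : S) (w : TangentSpace (𝓡 4) (ι p)) :
    TangentSpace (𝓡 4) (ι p) :=
  w - ∑ A, ∑ B, (invInduced g ι p A B * g.form (ι p) w (tangentVec ι p A)) • tangentVec ι p B

/-- The coordinate derivative `v(X^μ)` of a vector field `X` of `V` along `ι`, in the direction of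
`v ∈ T_p S`, the components `X^μ` being taken in the coordinates of `V` preferred at `ι p`. -/
def coordDeriv (ι : S → V) (X : ∀ q : S, TangentSpace (𝓡 4) (ι q)) (p : S)
    (v : TangentSpace (𝓡 2) p) : TangentSpace (𝓡 4) (ι p) :=
  mfderiv (𝓡 2) 𝓘(ℝ, EuclideanSpace ℝ (Fin 4))
    (fun q => (trivializationAt (EuclideanSpace ℝ (Fin 4))
      (TangentSpace (𝓡 4) : V → Type _) (ι p) ⟨ι q, X q⟩).2) p v

/-- The Levi-Civita covariant derivative `∇_v X` of a vector field `X` of `V` along `ι`, in the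
direction of `v ∈ T_p S`: in the coordinates of `V` preferred at `ι p` it is
`v(X^μ) + Γ^μ_{νρ} dι(v)^ν X^ρ`. -/
def covDeriv (g : LorentzMetric V) (ι : S → V) (X : ∀ q : S, TangentSpace (𝓡 4) (ι q)) (p : S)
    (v : TangentSpace (𝓡 2) p) : TangentSpace (𝓡 4) (ι p) :=
  coordDeriv ι X p v +
  ∑ μ, (∑ ν, ∑ ρ, christoffel g.form (ι p) μ ν ρ *
    (tangentBasis (ι p)).repr (mfderiv (𝓡 2) (𝓡 4) ι p v) ν *
    (tangentBasis (ι p)).repr (X p) ρ) • tangentBasis (ι p) μ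

/-- The normal connection `∇^⊥_v ξ = (∇_v ξ)^⊥`. -/
def normalDeriv (g : LorentzMetric V) (ι : S → V) (ξ : ∀ q : S, TangentSpace (𝓡 4) (ι q)) (p : S)
    (v : TangentSpace (𝓡 2) p) : TangentSpace (𝓡 4) (ι p) :=
  normalPart g ι p (covDeriv g ι ξ p v)

variable [IsManifold (𝓡 2) 2 S]

/-- The second fundamental tensor `K(e_A, e_B) = -(∇_{e_A} e_B)^⊥` at `p`, in the preferred chart
at `p`. -/
def secondFundamental (g : LorentzMetric V) (ι : S → V) (p : S) (A B : Fin 2) :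
    TangentSpace (𝓡 4) (ι p) :=
  -normalPart g ι p
    (covDeriv g ι (fun q => mfderiv (𝓡 2) (𝓡 4) ι q (coordField p B q)) p (tangentBasis p A))

/-- The mean curvature vector `H = h^{AB} K_{AB}`. -/
def meanCurvature (g : LorentzMetric V) (ι : S → V) (p : S) : TangentSpace (𝓡 4) (ι p) :=
  ∑ A, ∑ B, invInduced g ι p A B • secondFundamental g ι p A B

/-- The trace `tr_S(∇^⊥ ∇^⊥ ξ) = h^{AB} (∇^⊥_{e_A} ∇^⊥_{e_B} ξ - ∇^⊥_{D_{e_A} e_B} ξ)`, where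
`D_{e_A} e_B = γ^C_{AB} e_C` is the Levi-Civita connection of the induced metric. -/
def normalLaplacian (g : LorentzMetric V) (ι : S → V) (ξ : ∀ q : S, TangentSpace (𝓡 4) (ι q))
    (p : S) : TangentSpace (𝓡 4) (ι p) :=
  ∑ A, ∑ B, invInduced g ι p A B •
    (normalDeriv g ι (fun q => normalDeriv g ι ξ q (coordField p B q)) p (tangentBasis p A) -
      normalDeriv g ι ξ p (∑ C, christoffel (inducedMetric g ι) p C A B • tangentBasis p C))

/-- The Hodge dual
`(W^⋆)^μ = ½ η^μ_{νγδ} W^ν e_A^γ e_B^δ η_S^{AB}` of a normal vector `W`, with `η` the volume form of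
`(V, g)` and `η_S` the area form of `S`, whose indices are raised with `h^{AB}`. -/
def normalDual (g : LorentzMetric V) (oV : ManifoldOrientation 4 V) (ι : S → V)
    (oS : ManifoldOrientation 2 S) (p : S) (W : TangentSpace (𝓡 4) (ι p)) :
    TangentSpace (𝓡 4) (ι p) :=
  ∑ μ, (∑ ν, (metricMatrix g.form (ι p))⁻¹ μ ν *
    ((1 / 2) * ∑ A, ∑ B,
      volForm oV g.form (ι p) ![tangentBasis (ι p) ν, W, tangentVec ι p A, tangentVec ι p B] *
      ∑ C, ∑ D, invInduced g ι p A C * invInduced g ι p B D *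
        volForm oS (inducedMetric g ι) p ![tangentBasis p C, tangentBasis p D])) •
    tangentBasis (ι p) μ

/-- The integrand `tr_S(H · ∇^⊥ ∇^⊥ ξ)` of `I`. -/
def traceIntegrand (g : LorentzMetric V) (ι : S → V) (ξ : ∀ q : S, TangentSpace (𝓡 4) (ι q))
    (p : S) : ℝ :=
  g.form (ι p) (meanCurvature g ι p) (normalLaplacian g ι ξ p)

end Surface

end

/-!
The integrand only involves the normal bundle, a bundle of Lorentzian planes, and everything rests
on the algebra of the Hodge dual `⋆` on these planes: it is antisymmetric, `⋆⋆ = 1`, and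
`(X^⋆ · Y) (X^⋆ · Z) = (X · Y) (X · Z) - (X · X) (Y · Z)` (`form_normalDual_mul`). Its eigenspaces
for the eigenvalues `∓1` are the two null lines of the plane. Since `⋆` is parallel for `∇^⊥`
(`normalDeriv_normalDual`), so are these lines.

For a `C¹` normal field `T` the Leibniz rule gives
`T · Δξ = div (T · ∇^⊥ ξ) - tr (∇^⊥ T · ∇^⊥ ξ)` (`form_normalLaplacian`), and the integral of the
divergence of a `C¹` field of linear forms over a closed surface vanishes (`integral_surfaceDiv`).
The embedding is only `C²`, hence `H` is a priori only continuous, and the formula cannot be used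
with `T = H`. For the same reason the continuity of the integrand is read off from its products with
a local `C¹` timelike normal field and the dual of this field (`continuous_traceIntegrand`).

When `H = B ξ^⋆`, take `T = ξ^⋆`: the trace of `(∇^⊥ ξ)^⋆ · ∇^⊥ ξ` vanishes by antisymmetry, so that
`H · Δξ = B div (ξ^⋆ · ∇^⊥ ξ)`. If `B` is constant the integral is zero; if `ξ` is null, then
`ξ · ∇^⊥ ξ = 0` forces `ξ^⋆ · ∇^⊥ ξ = 0` and the integrand is zero.

When `ξ · H = a` and `ξ · H^⋆ = c` are constant, split `2 H = K₊ + K₋` into its null parts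
`K = H - ε H^⋆`, `ε = ±1` (`nullPart`). Then `K · ξ = α` with `α = a - ε c` constant, and the causal
assumptions amount to `|c| ≤ a`, that is `α ≥ 0` for both signs (`form_mul_nonneg_of_causal`).
If `α > 0`, then `K`, being the vector of a parallel line field normalised by `K · ξ = α`, is
`C¹`, and `∇^⊥ K` is proportional to `K`; with the linear form `w = K · ∇^⊥ ξ` this gives
`K · Δξ = div w + α⁻¹ |w|²` (`form_normalLaplacian_of_eigen`), whose integral is not negative.
If `α = 0`, then `ξ` lies in the null line of `K` near each point where `K ≠ 0`; this line being
parallel, `K · Δξ = 0` (`form_normalLaplacian_eq_zero`).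

Covariant derivatives, traces and divergences are defined in the chart preferred at each point, so
that the choice of the chart changes from point to point. They are differentiated and integrated
after being transferred to one fixed chart (`form_christoffel`, `surfaceTrace_eq_chart`,
`surfaceDiv_eq_chartFlux`).
-/

set_option synthInstance.maxHeartbeats 400000
set_option maxHeartbeats 1000000

noncomputable section

/-! ### Tangent vectors in a fixed chart -/

section ChartComponents

variable {n : ℕ} {M : Type*} [TopologicalSpace M] [ChartedSpace (EuclideanSpace ℝ (Fin n)) M]

lemma tangentBasis_apply (y : M) (i : Fin n) :
    tangentBasis y i = EuclideanSpace.basisFun (Fin n) ℝ i :=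
  congrFun (EuclideanSpace.basisFun (Fin n) ℝ).coe_toBasis i

/-- The components in the chart at `x₀` of a tangent vector at `y`. -/
def chartMap [IsManifold (𝓡 n) 1 M] (x₀ y : M) :
    TangentSpace (𝓡 n) y →L[ℝ] EuclideanSpace ℝ (Fin n) :=
  let A : EuclideanSpace ℝ (Fin n) →L[ℝ] EuclideanSpace ℝ (Fin n) := tangentCoordChange (𝓡 n) y x₀ y
  A

/-- The tangent vector at `y` with given components in the chart at `x₀`. -/
def chartInv [IsManifold (𝓡 n) 1 M] (x₀ y : M) :
    EuclideanSpace ℝ (Fin n) →L[ℝ] TangentSpace (𝓡 n) y :=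
  let A : EuclideanSpace ℝ (Fin n) →L[ℝ] EuclideanSpace ℝ (Fin n) := tangentCoordChange (𝓡 n) x₀ y y
  A

variable [IsManifold (𝓡 n) 1 M] {x₀ x₁ y : M}

lemma chartMap_self (y : M) (v : TangentSpace (𝓡 n) y) : chartMap y y v = v :=
  tangentCoordChange_self (E := EuclideanSpace ℝ (Fin n)) (mem_extChartAt_source y)

lemma chartInv_self (y : M) (v : EuclideanSpace ℝ (Fin n)) : chartInv y y v = v :=
  tangentCoordChange_self (E := EuclideanSpace ℝ (Fin n)) (mem_extChartAt_source y)

lemma chartInv_chartMap (hy : y ∈ (extChartAt (𝓡 n) x₀).source) (v : TangentSpace (𝓡 n) y) :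
    chartInv x₀ y (chartMap x₀ y v) = v := by
  refine (tangentCoordChange_comp (I := 𝓡 n) (v := v)
    ⟨⟨mem_extChartAt_source y, hy⟩, mem_extChartAt_source y⟩).trans ?_
  exact tangentCoordChange_self (mem_extChartAt_source y)

lemma chartMap_chartInv (hy : y ∈ (extChartAt (𝓡 n) x₀).source) (v : EuclideanSpace ℝ (Fin n)) :
    chartMap x₀ y (chartInv x₀ y v) = v := by
  refine (tangentCoordChange_comp (I := 𝓡 n) (v := v)
    ⟨⟨hy, mem_extChartAt_source y⟩, hy⟩).trans ?_
  exact tangentCoordChange_self hy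

lemma chartInv_tangentCoordChange (h₀ : y ∈ (extChartAt (𝓡 n) x₀).source)
    (h₁ : y ∈ (extChartAt (𝓡 n) x₁).source) (v : EuclideanSpace ℝ (Fin n)) :
    chartInv x₀ y (tangentCoordChange (𝓡 n) x₁ x₀ y v) = chartInv x₁ y v :=
  tangentCoordChange_comp (I := 𝓡 n) (v := v) ⟨⟨h₁, h₀⟩, mem_extChartAt_source y⟩

lemma tangentCoordChange_chartMap (h₀ : y ∈ (extChartAt (𝓡 n) x₀).source)
    (h₁ : y ∈ (extChartAt (𝓡 n) x₁).source) (v : TangentSpace (𝓡 n) y) :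
    tangentCoordChange (𝓡 n) x₁ x₀ y (chartMap x₁ y v) = chartMap x₀ y v :=
  tangentCoordChange_comp (I := 𝓡 n) (v := v) ⟨⟨mem_extChartAt_source y, h₁⟩, h₀⟩

lemma coordField_eq (hy : y ∈ (extChartAt (𝓡 n) x₀).source) (i : Fin n) :
    coordField x₀ i y = chartInv x₀ y (EuclideanSpace.basisFun (Fin n) ℝ i) := by
  have hb : y ∈ (chartAt (EuclideanSpace ℝ (Fin n)) x₀).source := by simpa using hy
  rw [chartInv, tangentCoordChange, ← TangentBundle.symmL_trivializationAt_eq_core hb]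
  rw [Trivialization.symmL_apply]
  · rfl
  · exact hb

lemma coordField_self (y : M) (i : Fin n) : coordField y i y = tangentBasis y i := by
  rw [coordField_eq (mem_extChartAt_source y), chartInv_self, tangentBasis_apply]

/-- A tangent vector at `y` is the combination of the coordinate vectors of the chart at `x₀` whose
coefficients are its components in that chart. -/
lemma eq_sum_coordField (hy : y ∈ (extChartAt (𝓡 n) x₀).source) (v : TangentSpace (𝓡 n) y) :
    v = ∑ i, chartMap x₀ y v i • coordField x₀ i y := by
  simp_rw [coordField_eq hy]
  conv_lhs => rw [← chartInv_chartMap hy v]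
  conv_lhs => rw [← OrthonormalBasis.sum_repr (EuclideanSpace.basisFun (Fin n) ℝ) (chartMap x₀ y v),
    map_sum]
  simp

/-- The field of bilinear forms `β`, written in the chart at `x₀`. -/
def chartForm (β : ∀ x : M, TangentSpace (𝓡 n) x →L[ℝ] TangentSpace (𝓡 n) x →L[ℝ] ℝ) (x₀ : M)
    (z : EuclideanSpace ℝ (Fin n)) :
    EuclideanSpace ℝ (Fin n) →L[ℝ] EuclideanSpace ℝ (Fin n) →L[ℝ] ℝ :=
  (show EuclideanSpace ℝ (Fin n) →L[ℝ] EuclideanSpace ℝ (Fin n) →L[ℝ] ℝ from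
    β ((extChartAt (𝓡 n) x₀).symm z)).bilinearComp
    (tangentCoordChange (𝓡 n) x₀ ((extChartAt (𝓡 n) x₀).symm z) ((extChartAt (𝓡 n) x₀).symm z))
    (tangentCoordChange (𝓡 n) x₀ ((extChartAt (𝓡 n) x₀).symm z) ((extChartAt (𝓡 n) x₀).symm z))

lemma chartForm_eq (β : ∀ x : M, TangentSpace (𝓡 n) x →L[ℝ] TangentSpace (𝓡 n) x →L[ℝ] ℝ) (x₀ : M)
    (z u v : EuclideanSpace ℝ (Fin n)) :
    chartForm β x₀ z u v = β ((extChartAt (𝓡 n) x₀).symm z)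
      (chartInv x₀ ((extChartAt (𝓡 n) x₀).symm z) u)
      (chartInv x₀ ((extChartAt (𝓡 n) x₀).symm z) v) := rfl

variable (β : ∀ x : M, TangentSpace (𝓡 n) x →L[ℝ] TangentSpace (𝓡 n) x →L[ℝ] ℝ)

lemma chartForm_apply (hy : y ∈ (extChartAt (𝓡 n) x₀).source) (u v : EuclideanSpace ℝ (Fin n)) :
    chartForm β x₀ (extChartAt (𝓡 n) x₀ y) u v = β y (chartInv x₀ y u) (chartInv x₀ y v) := by
  have h : (extChartAt (𝓡 n) x₀).symm (extChartAt (𝓡 n) x₀ y) = y := (extChartAt _ x₀).left_inv hy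
  rw [chartForm_eq, h]

lemma chartForm_chartMap (hy : y ∈ (extChartAt (𝓡 n) x₀).source) (u v : TangentSpace (𝓡 n) y) :
    chartForm β x₀ (extChartAt (𝓡 n) x₀ y) (chartMap x₀ y u) (chartMap x₀ y v) = β y u v := by
  rw [chartForm_apply β hy, chartInv_chartMap hy, chartInv_chartMap hy]

lemma chartMatrix_eq (hy : y ∈ (extChartAt (𝓡 n) x₀).source) (i j : Fin n) :
    chartMatrix (fun x v w => β x v w) x₀ y i j = chartForm β x₀ (extChartAt (𝓡 n) x₀ y)
      (EuclideanSpace.basisFun (Fin n) ℝ i) (EuclideanSpace.basisFun (Fin n) ℝ j) := by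
  rw [chartForm_apply β hy, chartMatrix, Matrix.of_apply, coordField_eq hy, coordField_eq hy]

lemma chartMap_tangentBasis (y : M) (i : Fin n) :
    chartMap y y (tangentBasis y i) = EuclideanSpace.basisFun (Fin n) ℝ i := by
  rw [chartMap_self, tangentBasis_apply]

lemma metricMatrix_eq_chartMatrix
    (b : ∀ x : M, TangentSpace (𝓡 n) x → TangentSpace (𝓡 n) x → ℝ) (x : M) :
    metricMatrix b x = chartMatrix b x x := by
  ext i j
  simp [metricMatrix, chartMatrix, coordField_self]

lemma chartForm_eventuallyEq (h₀ : y ∈ (extChartAt (𝓡 n) x₀).source)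
    (h₁ : y ∈ (extChartAt (𝓡 n) x₁).source) :
    chartForm β x₁ =ᶠ[𝓝 (extChartAt (𝓡 n) x₁ y)] fun z =>
      (chartForm β x₀ (extChartAt (𝓡 n) x₀ ((extChartAt (𝓡 n) x₁).symm z))).bilinearComp
        (tangentCoordChange (𝓡 n) x₁ x₀ ((extChartAt (𝓡 n) x₁).symm z))
        (tangentCoordChange (𝓡 n) x₁ x₀ ((extChartAt (𝓡 n) x₁).symm z)) := by
  have hc : ContinuousAt (extChartAt (𝓡 n) x₁).symm (extChartAt (𝓡 n) x₁ y) :=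
    continuousAt_extChartAt_symm' h₁
  have e : (extChartAt (𝓡 n) x₁).symm (extChartAt (𝓡 n) x₁ y) = y := (extChartAt _ x₁).left_inv h₁
  have h0 := hc.preimage_mem_nhds (by rw [e]; exact extChartAt_source_mem_nhds' h₀)
  have h1 := hc.preimage_mem_nhds (by rw [e]; exact extChartAt_source_mem_nhds' h₁)
  filter_upwards [h0, h1] with z hz0 hz1
  ext u v
  simp only [ContinuousLinearMap.bilinearComp_apply]
  rw [chartForm_apply β hz0, chartInv_tangentCoordChange hz0 hz1,
    chartInv_tangentCoordChange hz0 hz1, chartForm_eq]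

lemma chartTransition_hasFDerivAt (h₀ : y ∈ (extChartAt (𝓡 n) x₀).source)
    (h₁ : y ∈ (extChartAt (𝓡 n) x₁).source) :
    HasFDerivAt (extChartAt (𝓡 n) x₀ ∘ (extChartAt (𝓡 n) x₁).symm)
      (tangentCoordChange (𝓡 n) x₁ x₀ y) (extChartAt (𝓡 n) x₁ y) := by
  have := hasFDerivWithinAt_tangentCoordChange (I := 𝓡 n) (x := x₁) (y := x₀) ⟨h₁, h₀⟩
  simpa using this

end ChartComponents

/-! ### Derivatives of functions in a fixed chart -/

section Derivatives

variable {n : ℕ} {M : Type*} [TopologicalSpace M] [ChartedSpace (EuclideanSpace ℝ (Fin n)) M]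
  {F : Type*} [NormedAddCommGroup F] [NormedSpace ℝ F] {x₀ y : M} {f : M → F}

lemma HasFDerivAt.hasMFDerivAt_of_chart {L : EuclideanSpace ℝ (Fin n) →L[ℝ] F}
    (h : HasFDerivAt (fun z => f ((extChartAt (𝓡 n) y).symm z)) L (extChartAt (𝓡 n) y y)) :
    HasMFDerivAt (𝓡 n) 𝓘(ℝ, F) f y L := by
  refine ⟨?_, h.hasFDerivWithinAt (s := Set.range (𝓡 n))⟩
  have h1 := ContinuousAt.comp (f := extChartAt (𝓡 n) y) (x := y) h.continuousAt
    (continuousAt_extChartAt (I := 𝓡 n) y)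
  refine h1.congr ?_
  filter_upwards [extChartAt_source_mem_nhds (I := 𝓡 n) y] with z hz
  exact congrArg f ((extChartAt (𝓡 n) y).left_inv hz)

/-- The derivative of the vector valued function `f` at `y`, as a linear map on `T_y M`. -/
def vderiv (f : M → F) (y : M) : TangentSpace (𝓡 n) y →L[ℝ] F :=
  let L : TangentSpace (𝓡 n) y →L[ℝ] F := mfderiv (𝓡 n) 𝓘(ℝ, F) f y
  L

lemma vderiv_eq_mfderiv (v : TangentSpace (𝓡 n) y) :
    vderiv f y v = mfderiv (𝓡 n) 𝓘(ℝ, F) f y v := rfl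

lemma Filter.EventuallyEq.vderiv_eq {f₁ : M → F} (h : f₁ =ᶠ[𝓝 y] f) :
    vderiv (n := n) f₁ y = vderiv f y :=
  h.mfderiv_eq

variable [IsManifold (𝓡 n) 1 M]

lemma HasFDerivAt.vderiv_apply {L : EuclideanSpace ℝ (Fin n) →L[ℝ] F}
    (h : HasFDerivAt (fun z => f ((extChartAt (𝓡 n) y).symm z)) L (extChartAt (𝓡 n) y y))
    (v : TangentSpace (𝓡 n) y) : vderiv f y v = L (chartMap y y v) := by
  rw [vderiv_eq_mfderiv, h.hasMFDerivAt_of_chart.mfderiv, chartMap_self]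
  rfl

/-- The derivative of a function on `M`, computed in any chart. -/
lemma MDifferentiableAt.hasFDerivAt_chart
    (h : MDifferentiableAt (𝓡 n) 𝓘(ℝ, F) f y)
    (hy : y ∈ (extChartAt (𝓡 n) x₀).source) :
    HasFDerivAt (fun z => f ((extChartAt (𝓡 n) x₀).symm z))
      ((vderiv f y).comp (chartInv x₀ y)) (extChartAt (𝓡 n) x₀ y) := by
  have e : (extChartAt (𝓡 n) x₀).symm (extChartAt (𝓡 n) x₀ y) = y := (extChartAt _ x₀).left_inv hy
  have h1 := h.hasMFDerivAt.2
  have h2 : Set.range (𝓡 n) = Set.univ := by simp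
  rw [h2] at h1
  have h3 := h1.hasFDerivAt Filter.univ_mem
  have h4 := chartTransition_hasFDerivAt (x₀ := y) (x₁ := x₀) (mem_extChartAt_source y) hy
  let L : EuclideanSpace ℝ (Fin n) →L[ℝ] F := mfderiv (𝓡 n) 𝓘(ℝ, F) f y
  have h5 : HasFDerivAt (fun z => f ((extChartAt (𝓡 n) y).symm z)) L
      ((extChartAt (𝓡 n) y ∘ (extChartAt (𝓡 n) x₀).symm) (extChartAt (𝓡 n) x₀ y)) := by
    rw [Function.comp_apply, e]; exact h3
  refine (HasFDerivAt.comp _ h5 h4).congr_of_eventuallyEq ?_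
  have hc : ContinuousAt (extChartAt (𝓡 n) x₀).symm (extChartAt (𝓡 n) x₀ y) :=
    continuousAt_extChartAt_symm' hy
  filter_upwards [hc.preimage_mem_nhds (by rw [e]; exact extChartAt_source_mem_nhds (I := 𝓡 n) y)]
    with z hz
  exact congrArg f ((extChartAt (𝓡 n) y).left_inv hz).symm

lemma MDifferentiableAt.fderiv_chart
    (h : MDifferentiableAt (𝓡 n) 𝓘(ℝ, F) f y) (hy : y ∈ (extChartAt (𝓡 n) x₀).source)
    (v : TangentSpace (𝓡 n) y) :
    fderiv ℝ (fun z => f ((extChartAt (𝓡 n) x₀).symm z)) (extChartAt (𝓡 n) x₀ y)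
      (chartMap x₀ y v) = vderiv f y v := by
  rw [(h.hasFDerivAt_chart hy).fderiv, ContinuousLinearMap.comp_apply, chartInv_chartMap hy]

end Derivatives

/-! ### Second derivatives of chart transitions -/

section SecondOrder

variable {n : ℕ} {M : Type*} [TopologicalSpace M] [ChartedSpace (EuclideanSpace ℝ (Fin n)) M]
  [IsManifold (𝓡 n) 2 M] {x₀ x₁ y : M}

lemma chartTransition_contDiffAt (h₀ : y ∈ (extChartAt (𝓡 n) x₀).source)
    (h₁ : y ∈ (extChartAt (𝓡 n) x₁).source) :
    ContDiffAt ℝ 2 (extChartAt (𝓡 n) x₀ ∘ (extChartAt (𝓡 n) x₁).symm)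
      (extChartAt (𝓡 n) x₁ y) := by
  have h' : extChartAt (𝓡 n) x₁ y ∈
      ((extChartAt (𝓡 n) x₁).symm ≫ (extChartAt (𝓡 n) x₀)).source := by
    rw [PartialEquiv.trans_source'', PartialEquiv.symm_symm, PartialEquiv.symm_target]
    exact Set.mem_image_of_mem _ ⟨h₁, h₀⟩
  simpa [contDiffWithinAt_univ] using
    contDiffWithinAt_ext_coord_change (I := 𝓡 n) (n := 2) x₀ x₁ h'

variable (x₀ x₁ y) in
/-- The second derivative of the change of coordinates from the chart at `x₁` to the chart at
`x₀`, at the point `y`. -/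
def chartHessian : EuclideanSpace ℝ (Fin n) →L[ℝ] EuclideanSpace ℝ (Fin n) →L[ℝ]
    EuclideanSpace ℝ (Fin n) :=
  fderiv ℝ (fderiv ℝ (extChartAt (𝓡 n) x₀ ∘ (extChartAt (𝓡 n) x₁).symm)) (extChartAt (𝓡 n) x₁ y)

lemma chartHessian_symm (h₀ : y ∈ (extChartAt (𝓡 n) x₀).source)
    (h₁ : y ∈ (extChartAt (𝓡 n) x₁).source) (u v : EuclideanSpace ℝ (Fin n)) :
    chartHessian x₀ x₁ y u v = chartHessian x₀ x₁ y v u :=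
  ((chartTransition_contDiffAt h₀ h₁).isSymmSndFDerivAt (by simp)).eq u v

lemma tangentCoordChange_hasFDerivAt (h₀ : y ∈ (extChartAt (𝓡 n) x₀).source)
    (h₁ : y ∈ (extChartAt (𝓡 n) x₁).source) :
    HasFDerivAt (fun z => tangentCoordChange (𝓡 n) x₁ x₀ ((extChartAt (𝓡 n) x₁).symm z))
      (chartHessian x₀ x₁ y) (extChartAt (𝓡 n) x₁ y) := by
  have hd : DifferentiableAt ℝ (fderiv ℝ (extChartAt (𝓡 n) x₀ ∘ (extChartAt (𝓡 n) x₁).symm))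
      (extChartAt (𝓡 n) x₁ y) :=
    ((chartTransition_contDiffAt h₀ h₁).fderiv_right (m := 1) (by norm_num)).differentiableAt
      (by simp)
  refine hd.hasFDerivAt.congr_of_eventuallyEq ?_
  have hc : ContinuousAt (extChartAt (𝓡 n) x₁).symm (extChartAt (𝓡 n) x₁ y) :=
    continuousAt_extChartAt_symm' h₁
  have e : (extChartAt (𝓡 n) x₁).symm (extChartAt (𝓡 n) x₁ y) = y := (extChartAt _ x₁).left_inv h₁
  have h0 := hc.preimage_mem_nhds (by rw [e]; exact extChartAt_source_mem_nhds' h₀)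
  have h1 := hc.preimage_mem_nhds (by rw [e]; exact extChartAt_source_mem_nhds' h₁)
  filter_upwards [h0, h1, extChartAt_target_mem_nhds' (I := 𝓡 n)
    ((extChartAt (𝓡 n) x₁).map_source h₁)] with z hz0 hz1 hz
  have := (chartTransition_hasFDerivAt hz0 hz1).fderiv
  rw [(extChartAt _ x₁).right_inv hz] at this
  exact this.symm

end SecondOrder

/-! ### The Koszul expression -/

section Koszul

variable {E : Type*} [NormedAddCommGroup E] [NormedSpace ℝ E]

/-- The Christoffel symbol of the first kind, as a trilinear expression in the derivative `G'` of
the metric: `½ (∂_u g(v, w) + ∂_v g(u, w) - ∂_w g(u, v))`. -/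
def koszul (G' : E →L[ℝ] E →L[ℝ] E →L[ℝ] ℝ) (u v w : E) : ℝ :=
  (1 / 2) * (G' u v w + G' v u w - G' w u v)

variable {F : Type*} [NormedAddCommGroup F] [NormedSpace ℝ F]

lemma HasFDerivAt.bilinearComp_self {G : E → F →L[ℝ] F →L[ℝ] ℝ} {A : E → E →L[ℝ] F}
    {G' : E →L[ℝ] F →L[ℝ] F →L[ℝ] ℝ} {A' : E →L[ℝ] E →L[ℝ] F} {z : E}
    (hG : HasFDerivAt G G' z) (hA : HasFDerivAt A A' z) :
    ∃ D : E →L[ℝ] E →L[ℝ] E →L[ℝ] ℝ,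
      HasFDerivAt (fun z => (G z).bilinearComp (A z) (A z)) D z ∧
      ∀ w u v, D w u v = G' w (A z u) (A z v) + G z (A' w u) (A z v) + G z (A z u) (A' w v) := by
  have key : (fun z => (G z).bilinearComp (A z) (A z)) = fun z =>
      ((ContinuousLinearMap.compL ℝ E F ℝ).flip (A z)).comp ((G z).comp (A z)) := by
    funext z; ext u v; simp
  have h1 := HasFDerivAt.comp (G := (F →L[ℝ] ℝ) →L[ℝ] E →L[ℝ] ℝ) (F := E →L[ℝ] F) z
    ((ContinuousLinearMap.compL ℝ E F ℝ).flip).hasFDerivAt hA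
  have h2 := h1.clm_comp (hG.clm_comp hA)
  rw [key]
  refine ⟨_, h2, ?_⟩
  intro w u v
  simp
  ring

end Koszul

/-! ### Christoffel symbols under a change of chart -/

section ChristoffelChange

variable {n : ℕ} {M : Type*} [TopologicalSpace M] [ChartedSpace (EuclideanSpace ℝ (Fin n)) M]
  [IsManifold (𝓡 n) 2 M] {x₀ x₁ y : M}
  (β : ∀ x : M, TangentSpace (𝓡 n) x →L[ℝ] TangentSpace (𝓡 n) x →L[ℝ] ℝ)

/-- The derivative, in the chart at `x₀`, of the components of the metric `β`, at the point `y`. -/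
def chartFormDeriv (x₀ y : M) : EuclideanSpace ℝ (Fin n) →L[ℝ] EuclideanSpace ℝ (Fin n) →L[ℝ]
    EuclideanSpace ℝ (Fin n) →L[ℝ] ℝ :=
  fderiv ℝ (chartForm β x₀) (extChartAt (𝓡 n) x₀ y)

/-- The transformation law of the Christoffel symbols of the first kind. -/
lemma koszul_chartFormDeriv (hsymm : ∀ x v w, β x v w = β x w v)
    (h₀ : y ∈ (extChartAt (𝓡 n) x₀).source) (h₁ : y ∈ (extChartAt (𝓡 n) x₁).source)
    (hd : DifferentiableAt ℝ (chartForm β x₀) (extChartAt (𝓡 n) x₀ y))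
    (u v w : EuclideanSpace ℝ (Fin n)) :
    koszul (chartFormDeriv β x₁ y) u v w =
      koszul (chartFormDeriv β x₀ y) (tangentCoordChange (𝓡 n) x₁ x₀ y u)
        (tangentCoordChange (𝓡 n) x₁ x₀ y v) (tangentCoordChange (𝓡 n) x₁ x₀ y w) +
      chartForm β x₀ (extChartAt (𝓡 n) x₀ y) (chartHessian x₀ x₁ y u v)
        (tangentCoordChange (𝓡 n) x₁ x₀ y w) := by
  have e : (extChartAt (𝓡 n) x₁).symm (extChartAt (𝓡 n) x₁ y) = y := (extChartAt _ x₁).left_inv h₁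
  have hG : HasFDerivAt (fun z => chartForm β x₀ (extChartAt (𝓡 n) x₀
      ((extChartAt (𝓡 n) x₁).symm z)))
      ((chartFormDeriv β x₀ y).comp (tangentCoordChange (𝓡 n) x₁ x₀ y))
      (extChartAt (𝓡 n) x₁ y) := by
    have hd' : HasFDerivAt (chartForm β x₀) (chartFormDeriv β x₀ y)
        ((extChartAt (𝓡 n) x₀ ∘ (extChartAt (𝓡 n) x₁).symm) (extChartAt (𝓡 n) x₁ y)) := by
      rw [Function.comp_apply, e]; exact hd.hasFDerivAt
    exact HasFDerivAt.comp (G := EuclideanSpace ℝ (Fin n) →L[ℝ] EuclideanSpace ℝ (Fin n) →L[ℝ] ℝ) _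
      hd' (chartTransition_hasFDerivAt h₀ h₁)
  obtain ⟨D, hD, hDv⟩ := hG.bilinearComp_self (tangentCoordChange_hasFDerivAt h₀ h₁)
  have hD' : chartFormDeriv β x₁ y = D :=
    (hD.congr_of_eventuallyEq (chartForm_eventuallyEq β h₀ h₁)).fderiv
  have hs : ∀ a b, chartForm β x₀ (extChartAt (𝓡 n) x₀ y) a b =
      chartForm β x₀ (extChartAt (𝓡 n) x₀ y) b a := fun a b => by
    rw [chartForm_apply β h₀, chartForm_apply β h₀, hsymm]
  simp only [koszul, hD', hDv, e, ContinuousLinearMap.comp_apply]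
  rw [chartHessian_symm h₀ h₁ v u, chartHessian_symm h₀ h₁ w u, chartHessian_symm h₀ h₁ w v,
    hs (tangentCoordChange (𝓡 n) x₁ x₀ y u) (chartHessian x₀ x₁ y v w),
    hs (tangentCoordChange (𝓡 n) x₁ x₀ y v) (chartHessian x₀ x₁ y u w)]
  ring

lemma partialMetric_eq (x : M)
    (hd : DifferentiableAt ℝ (chartForm β x) (extChartAt (𝓡 n) x x)) (k i j : Fin n) :
    partialMetric (fun x v w => β x v w) x k i j =
      chartFormDeriv β x x (EuclideanSpace.basisFun (Fin n) ℝ k)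
        (EuclideanSpace.basisFun (Fin n) ℝ i) (EuclideanSpace.basisFun (Fin n) ℝ j) := by
  have hev : (fun z => chartMatrix (fun x v w => β x v w) x ((extChartAt (𝓡 n) x).symm z) i j)
      =ᶠ[𝓝 (extChartAt (𝓡 n) x x)] fun z => chartForm β x z
        (EuclideanSpace.basisFun (Fin n) ℝ i) (EuclideanSpace.basisFun (Fin n) ℝ j) := by
    filter_upwards [extChartAt_target_mem_nhds (I := 𝓡 n) x] with z hz
    rw [chartMatrix_eq β ((extChartAt (𝓡 n) x).map_target hz), (extChartAt _ x).right_inv hz]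
  have h1 : HasFDerivAt (fun z => chartForm β x z
        (EuclideanSpace.basisFun (Fin n) ℝ i) (EuclideanSpace.basisFun (Fin n) ℝ j)) _
        (extChartAt (𝓡 n) x x) :=
    ((hd.hasFDerivAt.clm_apply (hasFDerivAt_const (EuclideanSpace.basisFun (Fin n) ℝ i) _)).clm_apply
      (hasFDerivAt_const (EuclideanSpace.basisFun (Fin n) ℝ j) _))
  have h3 := HasFDerivAt.hasMFDerivAt_of_chart (f := fun y => chartMatrix (fun x v w => β x v w) x y i j)
    (h1.congr_of_eventuallyEq hev)
  rw [partialMetric, h3.mfderiv]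
  simp only [tangentBasis_apply, chartFormDeriv]
  change ((_ + _ : EuclideanSpace ℝ (Fin n) →L[ℝ] ℝ)) _ = _
  rw [add_apply, ContinuousLinearMap.comp_zero, ContinuousLinearMap.comp_zero,
    zero_add, zero_apply, zero_add]
  rfl

end ChristoffelChange

/-! ### Gram matrices -/

section Gram

variable {n : ℕ} {W : Type*} [AddCommGroup W] [Module ℝ W]

/-- The trace of the bilinear form `T` with respect to the scalar product `h`, computed in a
basis. It does not depend on the basis. -/
lemma sum_gram_inv_mul (h T : W →ₗ[ℝ] W →ₗ[ℝ] ℝ) (b c : Module.Basis (Fin n) ℝ W) :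
    ∑ i, ∑ j, (Matrix.of fun i j => h (c i) (c j))⁻¹ i j * T (c i) (c j) =
      ∑ i, ∑ j, (Matrix.of fun i j => h (b i) (b j))⁻¹ i j * T (b i) (b j) := by
  have key : ∀ (B : W →ₗ[ℝ] W →ₗ[ℝ] ℝ) (b : Module.Basis (Fin n) ℝ W),
      Matrix.of (fun i j => B (b i) (b j)) = LinearMap.BilinForm.toMatrix b B := by
    intro B b; ext i j; simp [LinearMap.BilinForm.toMatrix_apply]
  have tr : ∀ X Y : Matrix (Fin n) (Fin n) ℝ,
      ∑ i, ∑ j, X i j * Y i j = (X * Y.transpose).trace := by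
    intro X Y; simp [Matrix.trace, Matrix.mul_apply]
  have e : ∀ (B : W →ₗ[ℝ] W →ₗ[ℝ] ℝ) (b : Module.Basis (Fin n) ℝ W),
      ∑ i, ∑ j, (Matrix.of fun i j => h (b i) (b j))⁻¹ i j * B (b i) (b j) =
      ((LinearMap.BilinForm.toMatrix b h)⁻¹ *
        (LinearMap.BilinForm.toMatrix b B).transpose).trace := by
    intro B b; rw [← tr, key]; simp [LinearMap.BilinForm.toMatrix_apply]
  rw [e, e]
  have h1 := LinearMap.BilinForm.toMatrix_mul_basis_toMatrix b c h
  have h2 := LinearMap.BilinForm.toMatrix_mul_basis_toMatrix b c T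
  have hP : IsUnit (b.toMatrix c).det := by
    have := b.toMatrix_mul_toMatrix_flip c
    have h3 := congrArg Matrix.det this
    rw [Matrix.det_mul, Matrix.det_one] at h3
    exact IsUnit.of_mul_eq_one _ h3
  have hPt : IsUnit (b.toMatrix c).transpose.det := by rwa [Matrix.det_transpose]
  rw [← h1, ← h2, Matrix.mul_inv_rev, Matrix.mul_inv_rev, Matrix.transpose_mul,
    Matrix.transpose_mul, Matrix.transpose_transpose]
  rw [Matrix.trace_mul_comm]
  simp only [Matrix.mul_assoc]
  rw [Matrix.mul_nonsing_inv_cancel_left _ _ hP, Matrix.trace_mul_comm]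
  simp only [Matrix.mul_assoc]
  rw [Matrix.trace_mul_comm]
  simp only [Matrix.mul_assoc]
  rw [Matrix.nonsing_inv_mul_cancel_left _ _ hPt]

lemma det_gram (h : W →ₗ[ℝ] W →ₗ[ℝ] ℝ) (b : Module.Basis (Fin n) ℝ W) (v : Fin n → W) :
    (Matrix.of fun i j => h (v i) (v j)).det =
      (b.det v) ^ 2 * (Matrix.of fun i j => h (b i) (b j)).det := by
  have e : Matrix.of (fun i j => h (v i) (v j)) =
      (b.toMatrix v).transpose * (Matrix.of fun i j => h (b i) (b j)) * b.toMatrix v := by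
    ext i j
    have hv : ∀ i, v i = ∑ k, b.toMatrix v k i • b k := fun i => (b.sum_toMatrix_smul_self v i).symm
    simp only [Matrix.of_apply, Matrix.mul_apply, Matrix.transpose_apply]
    conv_lhs => rw [hv i, hv j]
    simp only [map_sum, map_smul, LinearMap.sum_apply, LinearMap.smul_apply, smul_eq_mul,
      Finset.mul_sum, Finset.sum_mul]
    refine Finset.sum_congr rfl fun k _ => Finset.sum_congr rfl fun l _ => ?_
    ring
  rw [e, Matrix.det_mul, Matrix.det_mul, Matrix.det_transpose, Module.Basis.det_apply]
  ring

end Gram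

/-! ### Smoothness of determinants and inverse matrices -/

section MatrixInverse

variable {n : ℕ} {H E M : Type*} [NormedAddCommGroup E] [NormedSpace ℝ E] [TopologicalSpace H]
  {I : ModelWithCorners ℝ E H} [TopologicalSpace M] [ChartedSpace H M] {k : WithTop ℕ∞} {x : M}

lemma ContMDiffAt.matrix_det {m : ℕ} {A : M → Matrix (Fin m) (Fin m) ℝ}
    (hA : ∀ i j, ContMDiffAt I 𝓘(ℝ, ℝ) k (fun y => A y i j) x) :
    ContMDiffAt I 𝓘(ℝ, ℝ) k (fun y => (A y).det) x := by
  simp only [Matrix.det_apply']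
  refine ContMDiffAt.sum fun σ _ => ?_
  refine contMDiffAt_const.mul (ContMDiffAt.prod fun i _ => hA _ _)

lemma ContMDiffAt.matrix_inv {A : M → Matrix (Fin n) (Fin n) ℝ}
    (hA : ∀ i j, ContMDiffAt I 𝓘(ℝ, ℝ) k (fun y => A y i j) x) (hd : (A x).det ≠ 0) (i j : Fin n) :
    ContMDiffAt I 𝓘(ℝ, ℝ) k (fun y => (A y)⁻¹ i j) x := by
  have e : (fun y => (A y)⁻¹ i j) = fun y => ((A y).det)⁻¹ * (A y).adjugate i j := by
    funext y; rw [Matrix.inv_def]; simp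
  rw [e]
  refine ((ContMDiffAt.matrix_det hA).inv₀ hd).mul ?_
  simp only [Matrix.adjugate_apply]
  refine ContMDiffAt.matrix_det fun i' j' => ?_
  by_cases h : i' = j
  · subst h; simpa using contMDiffAt_const
  · simpa [Matrix.updateRow_ne h] using hA i' j'

end MatrixInverse

/-! ### Linearity of the Koszul expression -/

section KoszulSums

variable {E : Type*} [NormedAddCommGroup E] [NormedSpace ℝ E]
  (G' : E →L[ℝ] E →L[ℝ] E →L[ℝ] ℝ) {ι : Type*} (s : Finset ι) (a : ι → ℝ) (e : ι → E)

lemma koszul_sum_left (v w : E) :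
    koszul G' (∑ i ∈ s, a i • e i) v w = ∑ i ∈ s, a i * koszul G' (e i) v w := by
  simp only [koszul, map_sum, map_smul, sum_apply, smul_apply, smul_eq_mul]
  rw [← Finset.sum_add_distrib, ← Finset.sum_sub_distrib, Finset.mul_sum]
  exact Finset.sum_congr rfl fun i _ => by ring

lemma koszul_sum_mid (u w : E) :
    koszul G' u (∑ i ∈ s, a i • e i) w = ∑ i ∈ s, a i * koszul G' u (e i) w := by
  simp only [koszul, map_sum, map_smul, sum_apply, smul_apply, smul_eq_mul]
  rw [← Finset.sum_add_distrib, ← Finset.sum_sub_distrib, Finset.mul_sum]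
  exact Finset.sum_congr rfl fun i _ => by ring

lemma koszul_sum_right (u v : E) :
    koszul G' u v (∑ i ∈ s, a i • e i) = ∑ i ∈ s, a i * koszul G' u v (e i) := by
  simp only [koszul, map_sum, map_smul, sum_apply, smul_apply, smul_eq_mul]
  rw [← Finset.sum_add_distrib, ← Finset.sum_sub_distrib, Finset.mul_sum]
  exact Finset.sum_congr rfl fun i _ => by ring

end KoszulSums

/-! ### Coordinate bases and Gram determinants -/

section ChristoffelPairing

variable {n : ℕ} {M : Type*} [TopologicalSpace M] [ChartedSpace (EuclideanSpace ℝ (Fin n)) M]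
  [IsManifold (𝓡 n) 1 M]
  (β : ∀ x : M, TangentSpace (𝓡 n) x →L[ℝ] TangentSpace (𝓡 n) x →L[ℝ] ℝ)

/-- The basis of `T_y M` of coordinate vectors of the chart at `x₀`. -/
def coordBasis (x₀ y : M) (hy : y ∈ (extChartAt (𝓡 n) x₀).source) :
    Module.Basis (Fin n) ℝ (TangentSpace (𝓡 n) y) :=
  (EuclideanSpace.basisFun (Fin n) ℝ).toBasis.map
    { (chartInv x₀ y).toLinearMap with
      invFun := chartMap x₀ y
      left_inv := chartMap_chartInv hy
      right_inv := chartInv_chartMap hy }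

lemma coordBasis_apply {x₀ y : M} (hy : y ∈ (extChartAt (𝓡 n) x₀).source) (i : Fin n) :
    coordBasis x₀ y hy i = coordField x₀ i y := by
  rw [coordField_eq hy, coordBasis, Module.Basis.map_apply, OrthonormalBasis.coe_toBasis]
  rfl

/-- A continuous bilinear form as a bilinear map. -/
def toBilin {x : M} (B : TangentSpace (𝓡 n) x →L[ℝ] TangentSpace (𝓡 n) x →L[ℝ] ℝ) :
    TangentSpace (𝓡 n) x →ₗ[ℝ] TangentSpace (𝓡 n) x →ₗ[ℝ] ℝ :=
  LinearMap.mk₂ ℝ (fun v w => B v w) (by simp) (by simp) (by simp) (by simp)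

omit [IsManifold (𝓡 n) 1 M] in
lemma toBilin_apply {x : M} (B : TangentSpace (𝓡 n) x →L[ℝ] TangentSpace (𝓡 n) x →L[ℝ] ℝ)
    (v w : TangentSpace (𝓡 n) x) : toBilin B v w = B v w := rfl

lemma chartMatrix_eq_gram {x₀ y : M} (hy : y ∈ (extChartAt (𝓡 n) x₀).source) :
    chartMatrix (fun x v w => β x v w) x₀ y =
      Matrix.of fun i j => toBilin (β y) (coordBasis x₀ y hy i) (coordBasis x₀ y hy j) := by
  ext i j
  simp [chartMatrix, coordBasis_apply, toBilin_apply]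

/-- Positivity or negativity of the Gram determinant may be checked in any basis. -/
lemma det_chartMatrix_eq {x₀ y : M} (hy : y ∈ (extChartAt (𝓡 n) x₀).source)
    (e : Module.Basis (Fin n) ℝ (TangentSpace (𝓡 n) y)) :
    ∃ r : ℝ, 0 < r ∧ (chartMatrix (fun x v w => β x v w) x₀ y).det =
      r * (Matrix.of fun i j => β y (e i) (e j)).det := by
  refine ⟨(e.det (coordBasis x₀ y hy)) ^ 2, ?_, ?_⟩
  · have := (e.isUnit_det (coordBasis x₀ y hy)).ne_zero
    positivity
  · rw [chartMatrix_eq_gram β hy, det_gram _ e]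
    rfl

end ChristoffelPairing

/-! ### Regularity in charts -/

section ChartRegularity

variable {n : ℕ} {M : Type*} [TopologicalSpace M] [ChartedSpace (EuclideanSpace ℝ (Fin n)) M]
  {F : Type*} [NormedAddCommGroup F] [NormedSpace ℝ F] {k : WithTop ℕ∞} {x₀ y : M} {f : M → F}

lemma contMDiffAt_iff_contDiffAt_chart [IsManifold (𝓡 n) k M]
    (hy : y ∈ (extChartAt (𝓡 n) x₀).source) :
    ContMDiffAt (𝓡 n) 𝓘(ℝ, F) k f y ↔
      ContDiffAt ℝ k (fun z => f ((extChartAt (𝓡 n) x₀).symm z)) (extChartAt (𝓡 n) x₀ y) := by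
  rw [contMDiffAt_iff_source_of_mem_source (x := x₀) (by simpa using hy)]
  simp only [modelWithCornersSelf_coe, Set.range_id, contMDiffWithinAt_univ]
  rw [contMDiffAt_iff_contDiffAt]
  rfl

lemma contMDiffAt_euclidean {m : ℕ} {f : M → EuclideanSpace ℝ (Fin m)}
    (h : ∀ i, ContMDiffAt (𝓡 n) 𝓘(ℝ, ℝ) k (fun y => f y i) y) :
    ContMDiffAt (𝓡 n) 𝓘(ℝ, EuclideanSpace ℝ (Fin m)) k f y := by
  have e : f = fun y => ∑ i, f y i • EuclideanSpace.basisFun (Fin m) ℝ i := by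
    funext y
    simpa using ((EuclideanSpace.basisFun (Fin m) ℝ).sum_repr (f y)).symm
  rw [e]
  exact ContMDiffAt.sum fun i _ => (h i).smul contMDiffAt_const

lemma ContMDiffAt.euclidean_apply {m : ℕ} {f : M → EuclideanSpace ℝ (Fin m)}
    (h : ContMDiffAt (𝓡 n) 𝓘(ℝ, EuclideanSpace ℝ (Fin m)) k f y) (i : Fin m) :
    ContMDiffAt (𝓡 n) 𝓘(ℝ, ℝ) k (fun y => f y i) y :=
  (EuclideanSpace.proj (𝕜 := ℝ) i : EuclideanSpace ℝ (Fin m) →L[ℝ] ℝ).contMDiff.contMDiffAt.comp y h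

lemma contMDiffAt_coordField [IsManifold (𝓡 n) 1 M]
    [ContMDiffVectorBundle k (EuclideanSpace ℝ (Fin n)) (TangentSpace (𝓡 n) : M → Type _) (𝓡 n)]
    (hy : y ∈ (extChartAt (𝓡 n) x₀).source) (i : Fin n) :
    ContMDiffAt (𝓡 n) (𝓡 n).tangent k
      (fun q => (⟨q, coordField x₀ i q⟩ : TangentBundle (𝓡 n) M)) y := by
  refine ((Bundle.Trivialization.contMDiffAt_iff (IM := 𝓡 n) (IB := 𝓡 n) (n := k)
    (e := trivializationAt (EuclideanSpace ℝ (Fin n)) (TangentSpace (𝓡 n) : M → Type _) x₀)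
    ?_).2 ⟨contMDiffAt_id, ?_⟩)
  · rw [Trivialization.mem_source]; simpa using hy
  · refine (contMDiffAt_const (c := EuclideanSpace.basisFun (Fin n) ℝ i)).congr_of_eventuallyEq ?_
    filter_upwards [extChartAt_source_mem_nhds' hy] with q hq
    change chartMap x₀ q (coordField x₀ i q) = _
    rw [coordField_eq hq, chartMap_chartInv hq]

/-- The derivative of a `C^{k+1}` function in the direction of a `C^k` vector field is `C^k`. -/
lemma ContMDiffAt.mfderiv_vectorField [IsManifold (𝓡 n) 1 M] {j : WithTop ℕ∞}
    [IsManifold (𝓡 n) j M] [IsManifold (𝓡 n) k M]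
    [ContMDiffVectorBundle k (EuclideanSpace ℝ (Fin n)) (TangentSpace (𝓡 n) : M → Type _) (𝓡 n)]
    (hkj : k + 1 ≤ j) (hj : j ≠ ∞) (hf : ContMDiffAt (𝓡 n) 𝓘(ℝ, F) j f y)
    {Y : ∀ q : M, TangentSpace (𝓡 n) q}
    (hY : ContMDiffAt (𝓡 n) (𝓡 n).tangent k (fun q => (⟨q, Y q⟩ : TangentBundle (𝓡 n) M)) y) :
    ContMDiffAt (𝓡 n) 𝓘(ℝ, F) k (fun q => vderiv f q (Y q)) y := by
  have hy := mem_extChartAt_source (I := 𝓡 n) y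
  have h1 : (1 : WithTop ℕ∞) ≤ j := le_trans (by simp) hkj
  have hj0 : j ≠ 0 := by rintro rfl; simp at h1
  have hd : ∀ᶠ q in 𝓝 y, MDifferentiableAt (𝓡 n) 𝓘(ℝ, F) f q :=
    ((contMDiffAt_iff_contMDiffAt_nhds hj).1 hf).mono fun q hq => hq.mdifferentiableAt hj0
  have hfc := (contMDiffAt_iff_contDiffAt_chart hy).1 hf
  have h2 := (hfc.fderiv_right hkj).contMDiffAt.comp y
    ((contMDiffAt_extChartAt (I := 𝓡 n) (n := k) (x := y)))
  have h3 := ((Bundle.Trivialization.contMDiffAt_iff (IM := 𝓡 n) (IB := 𝓡 n) (n := k)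
    (e := trivializationAt (EuclideanSpace ℝ (Fin n)) (TangentSpace (𝓡 n) : M → Type _) y)
    (by rw [Trivialization.mem_source]; simp)).1 hY).2
  refine (h2.clm_apply h3).congr_of_eventuallyEq ?_
  filter_upwards [hd, extChartAt_source_mem_nhds (I := 𝓡 n) y] with q hq hq'
  exact (hq.fderiv_chart hq' (Y q)).symm

end ChartRegularity

/-! ### Vector fields along a map -/

section Sections

variable {m n : ℕ} {N : Type*} [TopologicalSpace N] [ChartedSpace (EuclideanSpace ℝ (Fin m)) N]
  {M : Type*} [TopologicalSpace M] [ChartedSpace (EuclideanSpace ℝ (Fin n)) M]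
  [IsManifold (𝓡 n) 1 M] {k : WithTop ℕ∞} {f : N → M} {p : N}

variable (m) in
/-- The vector field `X` of `M` along the map `f` is of class `C^k` at `p`. -/
def ContMDiffAlong (f : N → M) (k : WithTop ℕ∞) (X : ∀ q : N, TangentSpace (𝓡 n) (f q))
    (p : N) : Prop :=
  ContMDiffAt (𝓡 m) (𝓡 n).tangent k (fun q => (⟨f q, X q⟩ : TangentBundle (𝓡 n) M)) p

lemma contMDiffAlong_iff
    [ContMDiffVectorBundle k (EuclideanSpace ℝ (Fin n)) (TangentSpace (𝓡 n) : M → Type _) (𝓡 n)]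
    {X : ∀ q : N, TangentSpace (𝓡 n) (f q)} {x₀ : M}
    (hf : ContMDiffAt (𝓡 m) (𝓡 n) k f p) (hp : f p ∈ (extChartAt (𝓡 n) x₀).source) :
    ContMDiffAlong m f k X p ↔ ContMDiffAt (𝓡 m) 𝓘(ℝ, EuclideanSpace ℝ (Fin n)) k
      (fun q => chartMap x₀ (f q) (X q)) p := by
  refine (Bundle.Trivialization.contMDiffAt_iff (IM := 𝓡 m) (IB := 𝓡 n) (n := k)
    (e := trivializationAt (EuclideanSpace ℝ (Fin n)) (TangentSpace (𝓡 n) : M → Type _) x₀)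
    (by rw [Trivialization.mem_source]; simpa using hp)).trans ?_
  exact ⟨fun h => h.2, fun h => ⟨hf, h⟩⟩

lemma chartMap_mfderiv {x₀ : M} (hf : MDifferentiableAt (𝓡 m) (𝓡 n) f p)
    (hp : f p ∈ (extChartAt (𝓡 n) x₀).source) (v : TangentSpace (𝓡 m) p) :
    chartMap x₀ (f p) (mfderiv (𝓡 m) (𝓡 n) f p v) =
      vderiv (fun q => extChartAt (𝓡 n) x₀ (f q)) p v := by
  have hp' : f p ∈ (chartAt (EuclideanSpace ℝ (Fin n)) x₀).source := by simpa using hp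
  have h1 : MDifferentiableAt (𝓡 n) 𝓘(ℝ, EuclideanSpace ℝ (Fin n)) (extChartAt (𝓡 n) x₀) (f p) :=
    mdifferentiableAt_extChartAt hp'
  have h2 := mfderiv_comp p h1 hf
  have h3 : (fun q => extChartAt (𝓡 n) x₀ (f q)) = extChartAt (𝓡 n) x₀ ∘ f := rfl
  rw [vderiv_eq_mfderiv, h3, h2, ← TangentBundle.continuousLinearMapAt_trivializationAt hp',
    TangentBundle.continuousLinearMapAt_trivializationAt_eq_core hp']
  rfl

/-- The components of the bilinear forms `β` are of class `C^k` in all charts. -/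
def ContMDiffForm (k : WithTop ℕ∞)
    (β : ∀ x : M, TangentSpace (𝓡 n) x →L[ℝ] TangentSpace (𝓡 n) x →L[ℝ] ℝ) : Prop :=
  ∀ x₀ y : M, y ∈ (extChartAt (𝓡 n) x₀).source → ∀ i j,
    ContMDiffAt (𝓡 n) 𝓘(ℝ, ℝ) k (fun y => chartMatrix (fun x v w => β x v w) x₀ y i j) y

variable {β : ∀ x : M, TangentSpace (𝓡 n) x →L[ℝ] TangentSpace (𝓡 n) x →L[ℝ] ℝ}

lemma form_eq_sum {x₀ y : M} (hy : y ∈ (extChartAt (𝓡 n) x₀).source) (v w : TangentSpace (𝓡 n) y) :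
    β y v w = ∑ i, ∑ j, chartMap x₀ y v i * chartMap x₀ y w j *
      chartMatrix (fun x v w => β x v w) x₀ y i j := by
  conv_lhs => rw [eq_sum_coordField hy v, eq_sum_coordField hy w]
  simp only [map_sum, map_smul, sum_apply, smul_apply, smul_eq_mul, Finset.mul_sum]
  refine Finset.sum_comm.trans ?_
  refine Finset.sum_congr rfl fun i _ => Finset.sum_congr rfl fun j _ => ?_
  rw [chartMatrix, Matrix.of_apply]; ring

lemma ContMDiffForm.apply
    [ContMDiffVectorBundle k (EuclideanSpace ℝ (Fin n)) (TangentSpace (𝓡 n) : M → Type _) (𝓡 n)]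
    (hβ : ContMDiffForm k β) {X Y : ∀ q : N, TangentSpace (𝓡 n) (f q)}
    (hf : ContMDiffAt (𝓡 m) (𝓡 n) k f p)
    (hX : ContMDiffAlong m f k X p) (hY : ContMDiffAlong m f k Y p) :
    ContMDiffAt (𝓡 m) 𝓘(ℝ, ℝ) k (fun q => β (f q) (X q) (Y q)) p := by
  have hp := mem_extChartAt_source (I := 𝓡 n) (f p)
  have hX' := (contMDiffAlong_iff hf hp).1 hX
  have hY' := (contMDiffAlong_iff hf hp).1 hY
  have : ContMDiffAt (𝓡 m) 𝓘(ℝ, ℝ) k (fun q => ∑ i, ∑ j, chartMap (f p) (f q) (X q) i *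
      chartMap (f p) (f q) (Y q) j * chartMatrix (fun x v w => β x v w) (f p) (f q) i j) p :=
    ContMDiffAt.sum fun i _ => ContMDiffAt.sum fun j _ =>
      ((hX'.euclidean_apply i).mul (hY'.euclidean_apply j)).mul ((hβ _ _ hp i j).comp p hf)
  refine this.congr_of_eventuallyEq ?_
  filter_upwards [hf.continuousAt.preimage_mem_nhds (extChartAt_source_mem_nhds (I := 𝓡 n) (f p))]
    with q hq
  exact form_eq_sum hq _ _

/-- A vector is recovered from its scalar products with the coordinate fields. -/
lemma chartMap_eq_sum_inv {x₀ y : M} (hy : y ∈ (extChartAt (𝓡 n) x₀).source)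
    (hd : (chartMatrix (fun x v w => β x v w) x₀ y).det ≠ 0) (v : TangentSpace (𝓡 n) y) (j : Fin n) :
    chartMap x₀ y v j = ∑ l, β y v (coordField x₀ l y) *
      (chartMatrix (fun x v w => β x v w) x₀ y)⁻¹ l j := by
  set A := chartMatrix (fun x v w => β x v w) x₀ y with hA
  have h1 : ∀ l, β y v (coordField x₀ l y) = ∑ i, chartMap x₀ y v i * A i l := by
    intro l
    conv_lhs => rw [eq_sum_coordField hy v]
    simp only [map_sum, map_smul, sum_apply, smul_apply, smul_eq_mul]
    rfl
  simp_rw [h1, Finset.sum_mul]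
  rw [Finset.sum_comm]
  have h2 : ∀ i, ∑ l, chartMap x₀ y v i * A i l * A⁻¹ l j =
      chartMap x₀ y v i * (1 : Matrix (Fin n) (Fin n) ℝ) i j := by
    intro i
    rw [← Matrix.mul_nonsing_inv A (isUnit_iff_ne_zero.2 hd), Matrix.mul_apply, Finset.mul_sum]
    exact Finset.sum_congr rfl fun l _ => by ring
  simp_rw [h2]
  simp [Matrix.one_apply]

/-- A vector field along `f` is `C^k` as soon as its scalar products with coordinate fields are. -/
lemma contMDiffAlong_of_pairing
    [ContMDiffVectorBundle k (EuclideanSpace ℝ (Fin n)) (TangentSpace (𝓡 n) : M → Type _) (𝓡 n)]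
    (hβ : ContMDiffForm k β) {X : ∀ q : N, TangentSpace (𝓡 n) (f q)}
    (hd : ∀ x₀ y, y ∈ (extChartAt (𝓡 n) x₀).source →
      (chartMatrix (fun x v w => β x v w) x₀ y).det ≠ 0)
    (hf : ContMDiffAt (𝓡 m) (𝓡 n) k f p)
    (hX : ∀ l, ContMDiffAt (𝓡 m) 𝓘(ℝ, ℝ) k (fun q => β (f q) (X q) (coordField (f p) l (f q))) p) :
    ContMDiffAlong m f k X p := by
  have hp := mem_extChartAt_source (I := 𝓡 n) (f p)
  rw [contMDiffAlong_iff hf hp]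
  refine contMDiffAt_euclidean fun j => ?_
  have : ContMDiffAt (𝓡 m) 𝓘(ℝ, ℝ) k (fun q => ∑ l, β (f q) (X q) (coordField (f p) l (f q)) *
      (chartMatrix (fun x v w => β x v w) (f p) (f q))⁻¹ l j) p := by
    refine ContMDiffAt.sum fun l _ => (hX l).mul ?_
    exact ContMDiffAt.matrix_inv (fun i j => (hβ _ _ hp i j).comp p hf) (hd _ _ hp) l j
  refine this.congr_of_eventuallyEq ?_
  filter_upwards [hf.continuousAt.preimage_mem_nhds (extChartAt_source_mem_nhds (I := 𝓡 n) (f p))]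
    with q hq
  exact chartMap_eq_sum_inv hq (hd _ _ hq) _ _

lemma ContMDiffForm.contDiffAt_chartForm [IsManifold (𝓡 n) k M] (hβ : ContMDiffForm k β) {x₀ y : M}
    (hy : y ∈ (extChartAt (𝓡 n) x₀).source) :
    ContDiffAt ℝ k (chartForm β x₀) (extChartAt (𝓡 n) x₀ y) := by
  have h1 : ContDiffAt ℝ k (fun z => ∑ i, ∑ j,
      chartMatrix (fun x v w => β x v w) x₀ ((extChartAt (𝓡 n) x₀).symm z) i j •
      (EuclideanSpace.proj (𝕜 := ℝ) i : EuclideanSpace ℝ (Fin n) →L[ℝ] ℝ).smulRight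
        (EuclideanSpace.proj (𝕜 := ℝ) j : EuclideanSpace ℝ (Fin n) →L[ℝ] ℝ))
      (extChartAt (𝓡 n) x₀ y) :=
    ContDiffAt.sum fun i _ => ContDiffAt.sum fun j _ =>
      ((contMDiffAt_iff_contDiffAt_chart hy).1 (hβ x₀ y hy i j)).continuousLinearMap_comp
        ((1 : ℝ →L[ℝ] ℝ).smulRight _)
  refine h1.congr_of_eventuallyEq ?_
  filter_upwards [extChartAt_target_mem_nhds' (I := 𝓡 n) ((extChartAt (𝓡 n) x₀).map_source hy)]
    with z hz
  have hz' := (extChartAt (𝓡 n) x₀).map_target hz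
  ext u v
  rw [chartForm_eq, form_eq_sum hz', chartMap_chartInv hz', chartMap_chartInv hz']
  simp only [sum_apply, smul_apply, ContinuousLinearMap.smulRight_apply, smul_eq_mul]
  refine Finset.sum_congr rfl fun i _ => Finset.sum_congr rfl fun j _ => ?_
  change _ = _ * (u i * v j)
  ring

/-- The defining property of the Christoffel symbols: they are obtained from those of the first
kind by raising an index. -/
lemma form_christoffel [IsManifold (𝓡 n) 2 M]
    (hsymm : ∀ x v w, β x v w = β x w v) {x : M}
    (hd : (metricMatrix (fun x v w => β x v w) x).det ≠ 0)
    (hdiff : DifferentiableAt ℝ (chartForm β x) (extChartAt (𝓡 n) x x)) (i j : Fin n)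
    (w : TangentSpace (𝓡 n) x) :
    β x (∑ k, christoffel (fun x v w => β x v w) x k i j • tangentBasis x k) w =
      koszul (chartFormDeriv β x x) (EuclideanSpace.basisFun (Fin n) ℝ i)
        (EuclideanSpace.basisFun (Fin n) ℝ j) (chartMap x x w) := by
  set ε := EuclideanSpace.basisFun (Fin n) ℝ with hε
  set A := metricMatrix (fun x v w => β x v w) x with hA
  have key : ∀ l, β x (∑ k, christoffel (fun x v w => β x v w) x k i j • tangentBasis x k)
      (tangentBasis x l) =
      koszul (chartFormDeriv β x x) (ε i) (ε j) (ε l) := by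
    intro l
    have h1 : ∀ k, christoffel (fun x v w => β x v w) x k i j = ∑ l', A⁻¹ k l' *
        koszul (chartFormDeriv β x x) (ε i) (ε j) (ε l') := by
      intro k
      rw [christoffel, Finset.mul_sum]
      refine Finset.sum_congr rfl fun l' _ => ?_
      rw [partialMetric_eq β x hdiff, partialMetric_eq β x hdiff, partialMetric_eq β x hdiff]
      simp only [koszul]
      ring
    have h2 : ∀ k, β x (tangentBasis x k) (tangentBasis x l) = A l k := by
      intro k; rw [hsymm, hA]; rfl
    simp only [map_sum, map_smul, sum_apply, smul_apply, smul_eq_mul, h1, h2, Finset.sum_mul]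
    rw [Finset.sum_comm]
    have h3 : ∀ l', ∑ k, A⁻¹ k l' * koszul (chartFormDeriv β x x) (ε i) (ε j) (ε l') * A l k =
        (1 : Matrix (Fin n) (Fin n) ℝ) l l' * koszul (chartFormDeriv β x x) (ε i) (ε j) (ε l') := by
      intro l'
      rw [← Matrix.mul_nonsing_inv A (isUnit_iff_ne_zero.2 hd), Matrix.mul_apply, Finset.sum_mul]
      exact Finset.sum_congr rfl fun k _ => by ring
    simp_rw [h3]
    simp [Matrix.one_apply]
  have hw : w = ∑ l, (tangentBasis x).repr w l • tangentBasis x l :=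
    ((tangentBasis x).sum_repr w).symm
  have hc : chartMap x x w = ∑ l, (tangentBasis x).repr w l • ε l := by
    conv_lhs => rw [hw]
    simp only [map_sum, map_smul, chartMap_tangentBasis, hε]
  rw [hc, koszul_sum_right]
  conv_lhs => rw [hw, map_sum]
  refine Finset.sum_congr rfl fun l _ => ?_
  rw [map_smul, key, smul_eq_mul]

end Sections

/-! ### Lorentzian metrics -/

section LorentzBasics

variable {V : Type*} [TopologicalSpace V] [ChartedSpace (EuclideanSpace ℝ (Fin 4)) V]
  [IsManifold (𝓡 4) ∞ V] (g : LorentzMetric V)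

lemma LorentzMetric.contMDiffForm (k : WithTop ℕ∞) (hk : k ≤ ∞) : ContMDiffForm k g.inner := by
  intro x₀ y hy i j
  have h1 := (contMDiffAt_coordField (k := ∞) hy i)
  have h2 := (contMDiffAt_coordField (k := ∞) hy j)
  have h3 := g.contMDiff.contMDiffAt (x := y)
  have : ContMDiffAt (𝓡 4) ((𝓡 4).prod 𝓘(ℝ)) ∞
      (fun q => TotalSpace.mk' ℝ (E := Bundle.Trivial V ℝ) q
        (g.inner q (coordField x₀ i q) (coordField x₀ j q))) y :=
    h3.clm_bundle_apply₂ (F₁ := EuclideanSpace ℝ (Fin 4)) (F₂ := EuclideanSpace ℝ (Fin 4)) h1 h2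
  exact ((contMDiffAt_totalSpace.1 this).2).of_le hk

lemma LorentzMetric.inner_eq_form (x : V) (v w : TangentSpace (𝓡 4) x) :
    g.inner x v w = g.form x v w := rfl

lemma LorentzMetric.det_chartMatrix_neg {x₀ y : V} (hy : y ∈ (extChartAt (𝓡 4) x₀).source) :
    (chartMatrix g.form x₀ y).det < 0 := by
  obtain ⟨e, he⟩ := g.signature y
  obtain ⟨r, hr, h⟩ := det_chartMatrix_eq g.inner hy e
  have h1 : (Matrix.of fun i j => g.inner y (e i) (e j)) =
      Matrix.diagonal (fun i : Fin 4 => if i = 0 then (-1 : ℝ) else 1) := by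
    ext i j; rw [Matrix.of_apply, he, Matrix.diagonal_apply]
  have h2 : (Matrix.of fun i j => g.inner y (e i) (e j)).det = -1 := by
    rw [h1, Matrix.det_diagonal]; simp
  rw [h2] at h
  change (chartMatrix (fun x v w => g.inner x v w) x₀ y).det < 0
  rw [h]; linarith

lemma LorentzMetric.det_metricMatrix_neg (x : V) : (metricMatrix g.form x).det < 0 := by
  rw [metricMatrix_eq_chartMatrix]
  exact g.det_chartMatrix_neg (mem_extChartAt_source x)

/-- The metric is nondegenerate. -/
lemma LorentzMetric.eq_of_form_eq {x : V} {v w : TangentSpace (𝓡 4) x}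
    (h : ∀ z, g.form x v z = g.form x w z) : v = w := by
  have hx := mem_extChartAt_source (I := 𝓡 4) x
  have hd : (chartMatrix (fun x v w => g.inner x v w) x x).det ≠ 0 := (g.det_chartMatrix_neg hx).ne
  have h1 : chartMap x x v = chartMap x x w := by
    ext j
    rw [chartMap_eq_sum_inv (β := g.inner) hx hd v, chartMap_eq_sum_inv (β := g.inner) hx hd w]
    exact Finset.sum_congr rfl fun l _ => by rw [g.inner_eq_form, g.inner_eq_form, h]
  rwa [chartMap_self, chartMap_self] at h1

lemma LorentzMetric.form_symm (x : V) (v w : TangentSpace (𝓡 4) x) :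
    g.form x v w = g.form x w v := g.symm x v w

lemma LorentzMetric.form_add_left (x : V) (u v w : TangentSpace (𝓡 4) x) :
    g.form x (u + v) w = g.form x u w + g.form x v w := by simp [LorentzMetric.form]

lemma LorentzMetric.form_add_right (x : V) (u v w : TangentSpace (𝓡 4) x) :
    g.form x w (u + v) = g.form x w u + g.form x w v := by simp [LorentzMetric.form]

lemma LorentzMetric.form_sub_left (x : V) (u v w : TangentSpace (𝓡 4) x) :
    g.form x (u - v) w = g.form x u w - g.form x v w := by simp [LorentzMetric.form]

lemma LorentzMetric.form_sub_right (x : V) (u v w : TangentSpace (𝓡 4) x) :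
    g.form x w (u - v) = g.form x w u - g.form x w v := by simp [LorentzMetric.form]

lemma LorentzMetric.form_neg_left (x : V) (v w : TangentSpace (𝓡 4) x) :
    g.form x (-v) w = -g.form x v w := by simp [LorentzMetric.form]

lemma LorentzMetric.form_neg_right (x : V) (v w : TangentSpace (𝓡 4) x) :
    g.form x w (-v) = -g.form x w v := by simp [LorentzMetric.form]

lemma LorentzMetric.form_smul_left (x : V) (a : ℝ) (v w : TangentSpace (𝓡 4) x) :
    g.form x (a • v) w = a * g.form x v w := by simp [LorentzMetric.form]

lemma LorentzMetric.form_smul_right (x : V) (a : ℝ) (v w : TangentSpace (𝓡 4) x) :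
    g.form x w (a • v) = a * g.form x w v := by simp [LorentzMetric.form]

lemma LorentzMetric.form_sum_left {ι : Type*} (s : Finset ι) (x : V)
    (v : ι → TangentSpace (𝓡 4) x) (w : TangentSpace (𝓡 4) x) :
    g.form x (∑ i ∈ s, v i) w = ∑ i ∈ s, g.form x (v i) w := by simp [LorentzMetric.form]

lemma LorentzMetric.form_sum_right {ι : Type*} (s : Finset ι) (x : V)
    (v : ι → TangentSpace (𝓡 4) x) (w : TangentSpace (𝓡 4) x) :
    g.form x w (∑ i ∈ s, v i) = ∑ i ∈ s, g.form x w (v i) := by simp [LorentzMetric.form]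

lemma LorentzMetric.form_zero_left (x : V) (w : TangentSpace (𝓡 4) x) :
    g.form x 0 w = 0 := by simp [LorentzMetric.form]

lemma LorentzMetric.differentiableAt_chartForm {x₀ y : V}
    (hy : y ∈ (extChartAt (𝓡 4) x₀).source) :
    DifferentiableAt ℝ (chartForm g.inner x₀) (extChartAt (𝓡 4) x₀ y) :=
  ((g.contMDiffForm 1 (by simp)).contDiffAt_chartForm hy).differentiableAt (by simp)

lemma LorentzMetric.chartFormDeriv_symm {x₀ y : V}
    (hy : y ∈ (extChartAt (𝓡 4) x₀).source) (u v w : EuclideanSpace ℝ (Fin 4)) :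
    chartFormDeriv g.inner x₀ y u v w = chartFormDeriv g.inner x₀ y u w v := by
  have h1 := (g.differentiableAt_chartForm hy).hasFDerivAt
  have h2 : ∀ v w : EuclideanSpace ℝ (Fin 4), HasFDerivAt (fun z => chartForm g.inner x₀ z v w) _
      (extChartAt (𝓡 4) x₀ y) := fun v w =>
    (h1.clm_apply (hasFDerivAt_const v _)).clm_apply (hasFDerivAt_const w _)
  have h3 : (fun z => chartForm g.inner x₀ z v w) = fun z => chartForm g.inner x₀ z w v := by
    funext z; rw [chartForm_eq, chartForm_eq, g.symm]
  have h4 := h2 v w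
  rw [h3] at h4
  have h5 := congrArg (fun L => L u) (h4.unique (h2 w v))
  simp only [ContinuousLinearMap.comp_zero, zero_add] at h5
  exact h5

end LorentzBasics

/-! ### The covariant derivative along a map -/

section CovariantDerivative

variable {V : Type*} [TopologicalSpace V] [ChartedSpace (EuclideanSpace ℝ (Fin 4)) V]
  [IsManifold (𝓡 4) ∞ V] (g : LorentzMetric V)
  {S : Type*} [TopologicalSpace S] [ChartedSpace (EuclideanSpace ℝ (Fin 2)) S]
  [IsManifold (𝓡 2) 2 S] {ι : S → V} {p : S}

omit [IsManifold (𝓡 2) 2 S] in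
lemma ContMDiffAlong.mdifferentiableAt_chartMap {X : ∀ q : S, TangentSpace (𝓡 4) (ι q)} {x₀ : V}
    (hι : ContMDiffAt (𝓡 2) (𝓡 4) 1 ι p) (hp : ι p ∈ (extChartAt (𝓡 4) x₀).source)
    (hX : ContMDiffAlong 2 ι 1 X p) :
    MDifferentiableAt (𝓡 2) 𝓘(ℝ, EuclideanSpace ℝ (Fin 4)) (fun q => chartMap x₀ (ι q) (X q)) p :=
  ((contMDiffAlong_iff hι hp).1 hX).mdifferentiableAt (by simp)

/-- The Christoffel part of the covariant derivative, paired with a vector. -/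
lemma form_christoffel_sum (x : V) (u v w : TangentSpace (𝓡 4) x) :
    g.form x (∑ μ, (∑ ν, ∑ ρ, christoffel g.form x μ ν ρ * (tangentBasis x).repr u ν *
      (tangentBasis x).repr v ρ) • tangentBasis x μ) w =
      koszul (chartFormDeriv g.inner x x) (chartMap x x u) (chartMap x x v) (chartMap x x w) := by
  set ε := EuclideanSpace.basisFun (Fin 4) ℝ with hε
  have hc : ∀ u, chartMap x x u = ∑ ν, (tangentBasis x).repr u ν • ε ν := by
    intro u
    conv_lhs => rw [← (tangentBasis x).sum_repr u]
    simp only [map_sum, map_smul, chartMap_tangentBasis, hε]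
  have h2 : ∀ ν ρ, koszul (chartFormDeriv g.inner x x) (ε ν) (ε ρ) (chartMap x x w) =
      ∑ μ, christoffel g.form x μ ν ρ * g.form x (tangentBasis x μ) w := by
    intro ν ρ
    rw [hε, ← form_christoffel g.symm (g.det_metricMatrix_neg x).ne
      (g.differentiableAt_chartForm (mem_extChartAt_source x))]
    simp only [map_sum, map_smul, sum_apply, smul_apply, smul_eq_mul]
    rfl
  rw [hc u, hc v, koszul_sum_left]
  simp_rw [koszul_sum_mid, h2, g.form_sum_left, g.form_smul_left, Finset.sum_mul, Finset.mul_sum]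
  rw [Finset.sum_comm]
  refine Finset.sum_congr rfl fun ν _ => ?_
  rw [Finset.sum_comm]
  refine Finset.sum_congr rfl fun ρ _ => Finset.sum_congr rfl fun μ _ => ?_
  ring

omit [IsManifold (𝓡 2) 2 S] in
lemma coordDeriv_eq (X : ∀ q : S, TangentSpace (𝓡 4) (ι q)) (v : TangentSpace (𝓡 2) p) :
    coordDeriv ι X p v = chartInv (ι p) (ι p) (vderiv (fun q => chartMap (ι p) (ι q) (X q)) p v) :=
  (chartInv_self _ _).symm

/-- The directional derivative of the components of a field along `ι` under a change of chart of the
target: the tensorial term is corrected by the second derivative of the transition map. -/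
lemma vderiv_chartMap_change {x₀ x₁ : V} (hι : ContMDiffAt (𝓡 2) (𝓡 4) 1 ι p)
    (h₀ : ι p ∈ (extChartAt (𝓡 4) x₀).source) (h₁ : ι p ∈ (extChartAt (𝓡 4) x₁).source)
    {X : ∀ q : S, TangentSpace (𝓡 4) (ι q)} (hX : ContMDiffAlong 2 ι 1 X p)
    (v : TangentSpace (𝓡 2) p) :
    vderiv (fun q => chartMap x₀ (ι q) (X q)) p v =
      tangentCoordChange (𝓡 4) x₁ x₀ (ι p) (vderiv (fun q => chartMap x₁ (ι q) (X q)) p v) +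
      chartHessian x₀ x₁ (ι p) (chartMap x₁ (ι p) (mfderiv (𝓡 2) (𝓡 4) ι p v))
        (chartMap x₁ (ι p) (X p)) := by
  have hp := mem_extChartAt_source (I := 𝓡 2) p
  have hd : MDifferentiableAt (𝓡 2) (𝓡 4) ι p := hι.mdifferentiableAt (by simp)
  have a1 := (hX.mdifferentiableAt_chartMap hι h₁).hasFDerivAt_chart hp
  have a2 : MDifferentiableAt (𝓡 2) 𝓘(ℝ, EuclideanSpace ℝ (Fin 4))
      (fun q => extChartAt (𝓡 4) x₁ (ι q)) p :=
    MDifferentiableAt.comp p (mdifferentiableAt_extChartAt (by simpa using h₁)) hd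
  have a3 := a2.hasFDerivAt_chart hp
  have e : (extChartAt (𝓡 2) p).symm (extChartAt (𝓡 2) p p) = p := (extChartAt _ p).left_inv hp
  have a4 : HasFDerivAt (fun z => tangentCoordChange (𝓡 4) x₁ x₀ ((extChartAt (𝓡 4) x₁).symm z))
      (chartHessian x₀ x₁ (ι p)) ((fun z => extChartAt (𝓡 4) x₁ (ι ((extChartAt (𝓡 2) p).symm z)))
        (extChartAt (𝓡 2) p p)) := by
    simp only [e]; exact tangentCoordChange_hasFDerivAt h₀ h₁
  have a5 := (HasFDerivAt.comp (extChartAt (𝓡 2) p p) a4 a3).clm_apply a1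
  have a6 : (fun z => chartMap x₀ (ι ((extChartAt (𝓡 2) p).symm z)) (X ((extChartAt (𝓡 2) p).symm z)))
      =ᶠ[𝓝 (extChartAt (𝓡 2) p p)] fun z => ((fun z => tangentCoordChange (𝓡 4) x₁ x₀
        ((extChartAt (𝓡 4) x₁).symm z)) ∘ fun z => extChartAt (𝓡 4) x₁ (ι ((extChartAt (𝓡 2) p).symm z)))
        z (chartMap x₁ (ι ((extChartAt (𝓡 2) p).symm z)) (X ((extChartAt (𝓡 2) p).symm z))) := by
    have hc : ContinuousAt (fun z => ι ((extChartAt (𝓡 2) p).symm z)) (extChartAt (𝓡 2) p p) :=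
      ContinuousAt.comp (by rw [e]; exact hι.continuousAt) (continuousAt_extChartAt_symm p)
    have n0 := hc.preimage_mem_nhds (by rw [e]; exact extChartAt_source_mem_nhds' h₀)
    have n1 := hc.preimage_mem_nhds (by rw [e]; exact extChartAt_source_mem_nhds' h₁)
    filter_upwards [n0, n1] with z hz0 hz1
    simp only [Function.comp_apply]
    rw [(extChartAt (𝓡 4) x₁).left_inv hz1]
    exact (tangentCoordChange_chartMap hz0 hz1 _).symm
  rw [HasFDerivAt.vderiv_apply (f := fun q => chartMap x₀ (ι q) (X q))
    (a5.congr_of_eventuallyEq a6), chartMap_mfderiv hd h₁]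
  have eX := congrArg (fun q => chartMap x₁ (ι q) (X q)) e
  beta_reduce at eX
  simp only [Function.comp_apply, eX, e, (extChartAt (𝓡 4) x₁).left_inv h₁, add_apply,
    ContinuousLinearMap.comp_apply, ContinuousLinearMap.flip_apply, chartInv_chartMap hp]

/-- The covariant derivative may be computed in any chart of the spacetime. -/
lemma form_covDeriv {x₀ : V} (hι : ContMDiffAt (𝓡 2) (𝓡 4) 1 ι p)
    (h₀ : ι p ∈ (extChartAt (𝓡 4) x₀).source)
    {X : ∀ q : S, TangentSpace (𝓡 4) (ι q)} (hX : ContMDiffAlong 2 ι 1 X p)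
    (v : TangentSpace (𝓡 2) p) (Z : TangentSpace (𝓡 4) (ι p)) :
    g.form (ι p) (covDeriv g ι X p v) Z =
      chartForm g.inner x₀ (extChartAt (𝓡 4) x₀ (ι p))
        (vderiv (fun q => chartMap x₀ (ι q) (X q)) p v) (chartMap x₀ (ι p) Z) +
      koszul (chartFormDeriv g.inner x₀ (ι p)) (chartMap x₀ (ι p) (mfderiv (𝓡 2) (𝓡 4) ι p v))
        (chartMap x₀ (ι p) (X p)) (chartMap x₀ (ι p) Z) := by
  have h₁ := mem_extChartAt_source (I := 𝓡 4) (ι p)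
  rw [covDeriv, g.form_add_left, form_christoffel_sum, coordDeriv_eq,
    koszul_chartFormDeriv g.inner g.symm h₀ h₁
    (g.differentiableAt_chartForm h₀), vderiv_chartMap_change hι h₀ h₁ hX]
  rw [tangentCoordChange_chartMap h₀ h₁, tangentCoordChange_chartMap h₀ h₁,
    tangentCoordChange_chartMap h₀ h₁, map_add, add_apply, chartForm_apply _ h₀,
    chartForm_apply _ h₀, chartInv_tangentCoordChange h₀ h₁, chartInv_chartMap h₀, g.inner_eq_form, g.inner_eq_form]
  ring

/-- Compatibility of the Levi-Civita connection with the metric. -/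
lemma vderiv_form (hι : ContMDiffAt (𝓡 2) (𝓡 4) 1 ι p) {X Y : ∀ q : S, TangentSpace (𝓡 4) (ι q)}
    (hX : ContMDiffAlong 2 ι 1 X p) (hY : ContMDiffAlong 2 ι 1 Y p) (v : TangentSpace (𝓡 2) p) :
    vderiv (fun q => g.form (ι q) (X q) (Y q)) p v =
      g.form (ι p) (covDeriv g ι X p v) (Y p) + g.form (ι p) (X p) (covDeriv g ι Y p v) := by
  have h₁ := mem_extChartAt_source (I := 𝓡 4) (ι p)
  have hp := mem_extChartAt_source (I := 𝓡 2) p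
  have hd : MDifferentiableAt (𝓡 2) (𝓡 4) ι p := hι.mdifferentiableAt (by simp)
  have e : (extChartAt (𝓡 2) p).symm (extChartAt (𝓡 2) p p) = p := (extChartAt _ p).left_inv hp
  have a1 := (hX.mdifferentiableAt_chartMap hι h₁).hasFDerivAt_chart hp
  have a2 := (hY.mdifferentiableAt_chartMap hι h₁).hasFDerivAt_chart hp
  have a3 := (MDifferentiableAt.comp p (mdifferentiableAt_extChartAt (I := 𝓡 4) (x := ι p)
    (by simp)) hd).hasFDerivAt_chart hp
  have a4 : HasFDerivAt (chartForm g.inner (ι p)) (chartFormDeriv g.inner (ι p) (ι p))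
      ((fun z => extChartAt (𝓡 4) (ι p) (ι ((extChartAt (𝓡 2) p).symm z)))
        (extChartAt (𝓡 2) p p)) := by
    simp only [e]; exact (g.differentiableAt_chartForm h₁).hasFDerivAt
  have a5 := ((HasFDerivAt.comp (G := EuclideanSpace ℝ (Fin 4) →L[ℝ] EuclideanSpace ℝ (Fin 4) →L[ℝ] ℝ)
    (extChartAt (𝓡 2) p p) a4 a3).clm_apply a1).clm_apply a2
  have a6 : (fun z => g.form (ι ((extChartAt (𝓡 2) p).symm z)) (X ((extChartAt (𝓡 2) p).symm z))
      (Y ((extChartAt (𝓡 2) p).symm z))) =ᶠ[𝓝 (extChartAt (𝓡 2) p p)] fun z =>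
      (chartForm g.inner (ι p) ∘ fun z => extChartAt (𝓡 4) (ι p) (ι ((extChartAt (𝓡 2) p).symm z))) z
        (chartMap (ι p) (ι ((extChartAt (𝓡 2) p).symm z)) (X ((extChartAt (𝓡 2) p).symm z)))
        (chartMap (ι p) (ι ((extChartAt (𝓡 2) p).symm z)) (Y ((extChartAt (𝓡 2) p).symm z))) := by
    have hc : ContinuousAt (fun z => ι ((extChartAt (𝓡 2) p).symm z)) (extChartAt (𝓡 2) p p) :=
      ContinuousAt.comp (by rw [e]; exact hι.continuousAt) (continuousAt_extChartAt_symm p)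
    have n1 := hc.preimage_mem_nhds (by rw [e]; exact extChartAt_source_mem_nhds' h₁)
    filter_upwards [n1] with z hz1
    exact (chartForm_chartMap _ hz1 _ _).symm
  rw [HasFDerivAt.vderiv_apply (f := fun q => g.form (ι q) (X q) (Y q))
    (a5.congr_of_eventuallyEq a6), g.form_symm _ (X p), form_covDeriv g hι h₁ hX,
    form_covDeriv g hι h₁ hY, chartMap_mfderiv hd h₁]
  have s1 : ∀ a b, chartForm g.inner (ι p) (extChartAt (𝓡 4) (ι p) (ι p)) a b =
      chartForm g.inner (ι p) (extChartAt (𝓡 4) (ι p) (ι p)) b a := fun a b => by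
    rw [chartForm_apply _ h₁, chartForm_apply _ h₁, g.symm]
  have eX := congrArg (fun q => chartMap (ι p) (ι q) (X q)) e
  have eY := congrArg (fun q => chartMap (ι p) (ι q) (Y q)) e
  beta_reduce at eX eY
  simp only [Function.comp_apply, eX, eY, e, add_apply,
    ContinuousLinearMap.comp_apply, ContinuousLinearMap.flip_apply, chartInv_chartMap hp, koszul]
  rw [s1 (chartMap (ι p) (ι p) (X p)), g.chartFormDeriv_symm h₁ (chartMap (ι p) (ι p) (X p)) _
    (chartMap (ι p) (ι p) (Y p)), g.chartFormDeriv_symm h₁ (chartMap (ι p) (ι p) (Y p)) _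
    (chartMap (ι p) (ι p) (X p)), g.chartFormDeriv_symm h₁ _ (chartMap (ι p) (ι p) (Y p))
    (chartMap (ι p) (ι p) (X p))]
  rw [show (⇑(extChartAt (𝓡 4) (ι p)) ∘ ι) = fun q => extChartAt (𝓡 4) (ι p) (ι q) from rfl]
  ring

end CovariantDerivative

/-! ### The tangent and normal spaces of a spacelike surface -/

section SurfacePoint

variable {V : Type*} [TopologicalSpace V] [ChartedSpace (EuclideanSpace ℝ (Fin 4)) V]
  [IsManifold (𝓡 4) ∞ V] (g : LorentzMetric V)
  {S : Type*} [TopologicalSpace S] [ChartedSpace (EuclideanSpace ℝ (Fin 2)) S]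

/-- The induced metric as a field of continuous bilinear forms. -/
def inducedForm (ι : S → V) (p : S) :
    TangentSpace (𝓡 2) p →L[ℝ] TangentSpace (𝓡 2) p →L[ℝ] ℝ :=
  let L : EuclideanSpace ℝ (Fin 2) →L[ℝ] EuclideanSpace ℝ (Fin 4) := mfderiv (𝓡 2) (𝓡 4) ι p
  let B : EuclideanSpace ℝ (Fin 4) →L[ℝ] EuclideanSpace ℝ (Fin 4) →L[ℝ] ℝ := g.inner (ι p)
  let C : EuclideanSpace ℝ (Fin 2) →L[ℝ] EuclideanSpace ℝ (Fin 2) →L[ℝ] ℝ := B.bilinearComp L L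
  C

variable {ι : S → V} {p : S}

lemma inducedForm_symm (p : S) (v w : TangentSpace (𝓡 2) p) :
    inducedForm g ι p v w = inducedForm g ι p w v := g.form_symm _ _ _

lemma inducedForm_tangentBasis (A B : Fin 2) :
    inducedForm g ι p (tangentBasis p A) (tangentBasis p B) =
      metricMatrix (inducedMetric g ι) p A B := rfl

lemma IsSpacelikeEmbedding.det_metricMatrix_pos (hι : IsSpacelikeEmbedding g ι) (p : S) :
    0 < (metricMatrix (inducedMetric g ι) p).det := by
  have hb : ∀ A : Fin 2, tangentBasis p A ≠ 0 := fun A => (tangentBasis p).ne_zero A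
  have h0 : 0 < inducedForm g ι p (tangentBasis p 0) (tangentBasis p 0) := hι.spacelike p _ (hb 0)
  set e := tangentBasis (n := 2) p with he
  set E := inducedForm g ι p (e 0) (e 0) with hE
  set F := inducedForm g ι p (e 0) (e 1) with hF
  set G := inducedForm g ι p (e 1) (e 1) with hG
  have hF' : inducedForm g ι p (e 1) (e 0) = F := inducedForm_symm g p _ _
  have hv : E • e 1 - F • e 0 ≠ 0 := by
    intro h
    have h1 := congrArg (fun v => e.repr v 1) h
    simp at h1
    exact h0.ne' h1
  have h1 : 0 < inducedForm g ι p (E • e 1 - F • e 0) (E • e 1 - F • e 0) := hι.spacelike p _ hv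
  simp only [map_sub, map_smul, sub_apply, smul_apply, smul_eq_mul, hF', ← hE, ← hF, ← hG] at h1
  have h2 : (metricMatrix (inducedMetric g ι) p).det = E * G - F * F := by
    rw [Matrix.det_fin_two, ← inducedForm_tangentBasis, ← inducedForm_tangentBasis,
      ← inducedForm_tangentBasis, ← inducedForm_tangentBasis, ← he, hF']
  rw [h2]
  by_contra hc
  nlinarith [mul_nonneg h0.le (not_lt.1 hc |> sub_nonneg.2)]

lemma invInduced_symm (A B : Fin 2) : invInduced g ι p A B = invInduced g ι p B A := by
  have : (metricMatrix (inducedMetric g ι) p).transpose = metricMatrix (inducedMetric g ι) p := by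
    ext i j; exact inducedForm_symm g p _ _
  have h2 : (invInduced g ι p).transpose = invInduced g ι p := by
    rw [invInduced, Matrix.transpose_nonsing_inv, this]
  exact congrFun (congrFun h2 B) A

/-- Raising an index: the vector `h^{AB} c_A e_B` has scalar products `c_C` with the basis. -/
lemma inducedForm_raise (hι : IsSpacelikeEmbedding g ι) (c : Fin 2 → ℝ) (C : Fin 2) :
    inducedForm g ι p (∑ A, ∑ B, (invInduced g ι p A B * c A) • tangentBasis p B)
      (tangentBasis p C) = c C := by
  simp only [map_sum, map_smul, sum_apply, smul_apply, smul_eq_mul, inducedForm_tangentBasis]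
  have h : ∀ A, ∑ B, invInduced g ι p A B * c A * metricMatrix (inducedMetric g ι) p B C =
      (1 : Matrix (Fin 2) (Fin 2) ℝ) A C * c A := by
    intro A
    rw [← Matrix.nonsing_inv_mul (metricMatrix (inducedMetric g ι) p)
      (isUnit_iff_ne_zero.2 (hι.det_metricMatrix_pos g p).ne'), Matrix.mul_apply, Finset.sum_mul]
    exact Finset.sum_congr rfl fun B _ => by rw [invInduced]; ring
  simp_rw [h]
  simp [Matrix.one_apply]

/-- The trace `h^{AB} b(e_A, e_B)` of a bilinear form on `T_p S`. -/
def surfaceTrace (ι : S → V) (p : S) (b : TangentSpace (𝓡 2) p → TangentSpace (𝓡 2) p → ℝ) : ℝ :=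
  ∑ A, ∑ B, invInduced g ι p A B * b (tangentBasis p A) (tangentBasis p B)

lemma surfaceTrace_sq_nonneg (hι : IsSpacelikeEmbedding g ι) (c : TangentSpace (𝓡 2) p → ℝ) :
    0 ≤ surfaceTrace g ι p fun v w => c v * c w := by
  set v := ∑ A, ∑ B, (invInduced g ι p A B * c (tangentBasis p A)) • tangentBasis p B with hv
  have h1 : inducedForm g ι p v v = surfaceTrace g ι p fun v w => c v * c w := by
    conv_lhs => enter [2]; rw [hv]
    simp only [map_sum, map_smul, smul_eq_mul]
    rw [surfaceTrace]
    refine Finset.sum_congr rfl fun A _ => Finset.sum_congr rfl fun B _ => ?_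
    rw [hv, inducedForm_raise g hι]
    ring
  rw [← h1]
  by_cases h : v = 0
  · rw [h]; simp
  · exact (hι.spacelike p v h).le

lemma surfaceTrace_antisymm {b : TangentSpace (𝓡 2) p → TangentSpace (𝓡 2) p → ℝ}
    (hb : ∀ v w, b v w = -b w v) : surfaceTrace g ι p b = 0 := by
  have h : surfaceTrace g ι p b = -surfaceTrace g ι p b := by
    conv_lhs => rw [surfaceTrace, Finset.sum_comm]
    rw [surfaceTrace, ← Finset.sum_neg_distrib]
    refine Finset.sum_congr rfl fun A _ => ?_
    rw [← Finset.sum_neg_distrib]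
    refine Finset.sum_congr rfl fun B _ => ?_
    rw [invInduced_symm g B A, hb]; ring
  linarith

/-- The trace may be computed in the coordinate frame of any chart. -/
lemma surfaceTrace_eq_chart [IsManifold (𝓡 2) 1 S] {x₀ : S} (hp : p ∈ (extChartAt (𝓡 2) x₀).source)
    (b : TangentSpace (𝓡 2) p →ₗ[ℝ] TangentSpace (𝓡 2) p →ₗ[ℝ] ℝ) :
    surfaceTrace g ι p (fun v w => b v w) =
      ∑ A, ∑ B, (chartMatrix (inducedMetric g ι) x₀ p)⁻¹ A B *
        b (coordField x₀ A p) (coordField x₀ B p) := by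
  have h1 : chartMatrix (inducedMetric g ι) x₀ p = Matrix.of fun i j =>
      toBilin (inducedForm g ι p) (coordBasis x₀ p hp i) (coordBasis x₀ p hp j) :=
    chartMatrix_eq_gram (inducedForm g ι) hp
  have h2 := sum_gram_inv_mul (toBilin (inducedForm g ι p)) b (tangentBasis p) (coordBasis x₀ p hp)
  rw [h1]
  simp only [coordBasis_apply] at h2 ⊢
  rw [h2]
  rfl

lemma det_chartMatrix_inducedMetric_pos [IsManifold (𝓡 2) 1 S] (hι : IsSpacelikeEmbedding g ι)
    {x₀ : S} (hp : p ∈ (extChartAt (𝓡 2) x₀).source) :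
    0 < (chartMatrix (inducedMetric g ι) x₀ p).det := by
  obtain ⟨r, hr, h⟩ := det_chartMatrix_eq (inducedForm g ι) hp (tangentBasis p)
  have h2 := hι.det_metricMatrix_pos g p
  have h3 : (chartMatrix (inducedMetric g ι) x₀ p).det =
    r * (metricMatrix (inducedMetric g ι) p).det := h
  rw [h3]; positivity

/-! #### The normal space -/

lemma IsNormalVector.tangentVec {w : TangentSpace (𝓡 4) (ι p)} (hw : IsNormalVector g ι p w)
    (A : Fin 2) : g.form (ι p) w (tangentVec ι p A) = 0 := hw _

lemma form_normalPart_of_normal {Z : TangentSpace (𝓡 4) (ι p)} (hZ : IsNormalVector g ι p Z)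
    (w : TangentSpace (𝓡 4) (ι p)) : g.form (ι p) (normalPart g ι p w) Z = g.form (ι p) w Z := by
  rw [normalPart, g.form_sub_left, g.form_sum_left]
  simp_rw [g.form_sum_left, g.form_smul_left]
  simp [g.form_symm _ (_root_.tangentVec ι p _) Z, hZ.tangentVec]

lemma IsNormalVector.add {v w : TangentSpace (𝓡 4) (ι p)} (hv : IsNormalVector g ι p v)
    (hw : IsNormalVector g ι p w) : IsNormalVector g ι p (v + w) := fun u => by
  rw [g.form_add_left, hv, hw, add_zero]

lemma IsNormalVector.smul (a : ℝ) {w : TangentSpace (𝓡 4) (ι p)}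
    (hw : IsNormalVector g ι p w) : IsNormalVector g ι p (a • w) := fun u => by
  rw [g.form_smul_left, hw, mul_zero]

lemma IsNormalVector.neg {w : TangentSpace (𝓡 4) (ι p)}
    (hw : IsNormalVector g ι p w) : IsNormalVector g ι p (-w) := fun u => by
  rw [g.form_neg_left, hw, neg_zero]

lemma IsNormalVector.sub {v w : TangentSpace (𝓡 4) (ι p)} (hv : IsNormalVector g ι p v)
    (hw : IsNormalVector g ι p w) : IsNormalVector g ι p (v - w) := fun u => by
  rw [g.form_sub_left, hv, hw, sub_zero]

lemma isNormalVector_zero : IsNormalVector g ι p 0 := fun _ => g.form_zero_left _ _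

lemma IsNormalVector.sum {α : Type*} (s : Finset α) {w : α → TangentSpace (𝓡 4) (ι p)}
    (hw : ∀ i ∈ s, IsNormalVector g ι p (w i)) : IsNormalVector g ι p (∑ i ∈ s, w i) := fun u => by
  rw [g.form_sum_left, Finset.sum_eq_zero fun i hi => hw i hi u]

lemma isNormalVector_of_tangentBasis {w : TangentSpace (𝓡 4) (ι p)}
    (h : ∀ A, g.form (ι p) w (tangentVec ι p A) = 0) : IsNormalVector g ι p w := by
  intro v
  rw [← (tangentBasis p).sum_repr v, map_sum, g.form_sum_right]
  refine Finset.sum_eq_zero fun A _ => ?_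
  rw [map_smul, g.form_smul_right]
  rw [show mfderiv (𝓡 2) (𝓡 4) ι p (tangentBasis p A) = tangentVec ι p A from rfl, h, mul_zero]

/-- The tangential part of a vector, as a tangent vector of the surface. -/
def tangentPart (ι : S → V) (p : S) (w : TangentSpace (𝓡 4) (ι p)) : TangentSpace (𝓡 2) p :=
  ∑ A, ∑ B, (invInduced g ι p A B * g.form (ι p) w (tangentVec ι p A)) • tangentBasis p B

lemma normalPart_add_tangentPart (w : TangentSpace (𝓡 4) (ι p)) :
    normalPart g ι p w + mfderiv (𝓡 2) (𝓡 4) ι p (tangentPart g ι p w) = w := by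
  have : mfderiv (𝓡 2) (𝓡 4) ι p (tangentPart g ι p w) = ∑ A, ∑ B,
      (invInduced g ι p A B * g.form (ι p) w (tangentVec ι p A)) • tangentVec ι p B := by
    rw [tangentPart]
    simp only [map_sum, map_smul]
    rfl
  rw [this, normalPart, sub_add_cancel]

lemma isNormalVector_normalPart (hι : IsSpacelikeEmbedding g ι) (w : TangentSpace (𝓡 4) (ι p)) :
    IsNormalVector g ι p (normalPart g ι p w) := by
  refine isNormalVector_of_tangentBasis g fun C => ?_
  have h1 := normalPart_add_tangentPart g w
  have h2 := inducedForm_raise g hι (p := p) (fun A => g.form (ι p) w (tangentVec ι p A)) C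
  have h3 : g.form (ι p) (mfderiv (𝓡 2) (𝓡 4) ι p (tangentPart g ι p w)) (tangentVec ι p C) =
    g.form (ι p) w (tangentVec ι p C) := h2
  have h4 := congrArg (fun u => g.form (ι p) u (tangentVec ι p C)) h1
  simp only [g.form_add_left] at h4
  linarith

lemma IsNormalVector.form_right {Z : TangentSpace (𝓡 4) (ι p)} (hZ : IsNormalVector g ι p Z)
    (v : TangentSpace (𝓡 2) p) : g.form (ι p) (mfderiv (𝓡 2) (𝓡 4) ι p v) Z = 0 := by
  rw [g.form_symm]; exact hZ v

/-- Normal vectors with the same scalar products with all normal vectors coincide. -/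
lemma IsNormalVector.ext (hι : IsSpacelikeEmbedding g ι) {X Y : TangentSpace (𝓡 4) (ι p)}
    (hX : IsNormalVector g ι p X) (hY : IsNormalVector g ι p Y)
    (h : ∀ Z, IsNormalVector g ι p Z → g.form (ι p) X Z = g.form (ι p) Y Z) : X = Y := by
  refine g.eq_of_form_eq fun z => ?_
  rw [← normalPart_add_tangentPart g z, g.form_add_right, g.form_add_right, hX, hY,
    h _ (isNormalVector_normalPart g hι z)]

lemma normalPart_of_normal (hι : IsSpacelikeEmbedding g ι) {X : TangentSpace (𝓡 4) (ι p)}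
    (hX : IsNormalVector g ι p X) : normalPart g ι p X = X :=
  (isNormalVector_normalPart g hι X).ext g hι hX fun _ hZ => form_normalPart_of_normal g hZ X

lemma form_normalPart_self_le (hι : IsSpacelikeEmbedding g ι) (w : TangentSpace (𝓡 4) (ι p)) :
    g.form (ι p) (normalPart g ι p w) (normalPart g ι p w) ≤ g.form (ι p) w w := by
  have hn := isNormalVector_normalPart g hι w
  conv_rhs => rw [← normalPart_add_tangentPart g w]
  rw [g.form_add_left, g.form_add_right, g.form_add_right, hn, hn.form_right g]
  have : 0 ≤ inducedMetric g ι p (tangentPart g ι p w) (tangentPart g ι p w) := by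
    by_cases h : tangentPart g ι p w = 0
    · have : inducedForm g ι p 0 0 = 0 := by simp
      rw [h]; exact this.ge
    · exact (hι.spacelike p _ h).le
  rw [inducedMetric] at this
  linarith

lemma normalPart_add (v w : TangentSpace (𝓡 4) (ι p)) :
    normalPart g ι p (v + w) = normalPart g ι p v + normalPart g ι p w := by
  simp only [normalPart, g.form_add_left, mul_add, add_smul, Finset.sum_add_distrib]
  abel

lemma normalPart_smul (a : ℝ) (w : TangentSpace (𝓡 4) (ι p)) :
    normalPart g ι p (a • w) = a • normalPart g ι p w := by
  simp only [normalPart, g.form_smul_left, smul_sub, Finset.smul_sum, smul_smul]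
  congr 1
  refine Finset.sum_congr rfl fun A _ => Finset.sum_congr rfl fun B _ => ?_
  congr 1
  ring

lemma eq_zero_of_normal_of_tangent (hι : IsSpacelikeEmbedding g ι) {v : TangentSpace (𝓡 2) p}
    (h : IsNormalVector g ι p (mfderiv (𝓡 2) (𝓡 4) ι p v)) : v = 0 := by
  by_contra hv
  exact (hι.spacelike p v hv).ne' (h v)

end SurfacePoint

/-! ### Volume forms in a fixed chart -/

section VolumeForm

variable {n : ℕ} {M : Type*} [TopologicalSpace M] [ChartedSpace (EuclideanSpace ℝ (Fin n)) M]
  [IsManifold (𝓡 n) 1 M] {x₀ q : M}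

open Classical in
/-- The sign of an orientation at `x`, relative to the coordinate basis of the chart at `x`. -/
def orientationSign (o : ManifoldOrientation n M) (x : M) : ℝ :=
  if o.toFun x = (tangentBasis x).orientation then 1 else -1

lemma orientationSign_sq (o : ManifoldOrientation n M) (x : M) : orientationSign o x ^ 2 = 1 := by
  unfold orientationSign; split_ifs <;> norm_num

lemma volForm_apply (o : ManifoldOrientation n M)
    (b : ∀ x : M, TangentSpace (𝓡 n) x → TangentSpace (𝓡 n) x → ℝ) (v : Fin n → TangentSpace (𝓡 n) q) :
    volForm o b q v = orientationSign o q * √|(metricMatrix b q).det| * (tangentBasis q).det v := by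
  rw [volForm, AlternatingMap.smul_apply, smul_eq_mul]; rfl

lemma volForm_sq (o : ManifoldOrientation n M)
    (b : ∀ x : M, TangentSpace (𝓡 n) x → TangentSpace (𝓡 n) x → ℝ) (v : Fin n → TangentSpace (𝓡 n) q) :
    volForm o b q v ^ 2 = |(metricMatrix b q).det| * (tangentBasis q).det v ^ 2 := by
  rw [volForm_apply, mul_pow, mul_pow, orientationSign_sq, one_mul, Real.sq_sqrt (abs_nonneg _)]

lemma coordBasis_repr (hy : q ∈ (extChartAt (𝓡 n) x₀).source) (v : TangentSpace (𝓡 n) q)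
    (i : Fin n) : (coordBasis x₀ q hy).repr v i = chartMap x₀ q v i := by
  rw [coordBasis, Module.Basis.map_repr]
  rfl

lemma coordBasis_map (hy : q ∈ (extChartAt (𝓡 n) x₀).source)
    (hx : q ∈ (trivializationAt (EuclideanSpace ℝ (Fin n))
        (TangentSpace (𝓡 n) : M → Type _) x₀).baseSet) :
    (coordBasis x₀ q hy).map ((trivializationAt (EuclideanSpace ℝ (Fin n))
        (TangentSpace (𝓡 n) : M → Type _) x₀).linearEquivAt ℝ q hx) =
      (EuclideanSpace.basisFun (Fin n) ℝ).toBasis := by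
  refine Module.Basis.eq_of_apply_eq fun i => ?_
  rw [Module.Basis.map_apply, coordBasis_apply, coordField_eq hy, OrthonormalBasis.coe_toBasis]
  exact chartMap_chartInv hy _

lemma det_chartMatrix_eq_sq
    (β : ∀ x : M, TangentSpace (𝓡 n) x →L[ℝ] TangentSpace (𝓡 n) x →L[ℝ] ℝ)
    (hy : q ∈ (extChartAt (𝓡 n) x₀).source) :
    (chartMatrix (fun x v w => β x v w) x₀ q).det =
      (tangentBasis q).det (coordBasis x₀ q hy) ^ 2 * (metricMatrix (fun x v w => β x v w) q).det := by
  rw [chartMatrix_eq_gram β hy, det_gram _ (tangentBasis q)]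
  rfl

/-- The volume form in a fixed chart, near the centre of the chart. -/
lemma volForm_eventually_eq (o : ManifoldOrientation n M)
    (β : ∀ x : M, TangentSpace (𝓡 n) x →L[ℝ] TangentSpace (𝓡 n) x →L[ℝ] ℝ) (x₀ : M) :
    ∀ᶠ q in 𝓝 x₀, ∀ v : Fin n → TangentSpace (𝓡 n) q,
      volForm o (fun x v w => β x v w) q v = orientationSign o x₀ *
        √|(chartMatrix (fun x v w => β x v w) x₀ q).det| *
        (Matrix.of fun i j => chartMap x₀ q (v j) i).det := by
  classical
  filter_upwards [o.locally_const x₀, extChartAt_source_mem_nhds (I := 𝓡 n) x₀] with q ⟨hx, ho⟩ hy v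
  set c := coordBasis x₀ q hy with hc
  set t := tangentBasis (n := n) q with ht
  have h1 : c.det v = (Matrix.of fun i j => chartMap x₀ q (v j) i).det := by
    rw [Module.Basis.det_apply]
    congr 1
  have h2 : t.det v = t.det c * c.det v := by
    have := congrArg (fun f => f v) (AlternatingMap.eq_smul_basis_det c t.det)
    simpa using this
  have h3 : t.det c ≠ 0 := (t.isUnit_det c).ne_zero
  have hcm : Orientation.map (Fin n) ((trivializationAt (EuclideanSpace ℝ (Fin n))
        (TangentSpace (𝓡 n) : M → Type _) x₀).linearEquivAt ℝ q hx) c.orientation =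
      (EuclideanSpace.basisFun (Fin n) ℝ).toBasis.orientation := by
    rw [← Module.Basis.orientation_map, coordBasis_map hy hx]
  have h4 : o.toFun x₀ = (tangentBasis x₀).orientation ↔ o.toFun q = c.orientation := by
    constructor
    · intro h
      refine (Orientation.map (Fin n) ((trivializationAt (EuclideanSpace ℝ (Fin n))
        (TangentSpace (𝓡 n) : M → Type _) x₀).linearEquivAt ℝ q hx)).injective ?_
      rw [hcm]
      exact ho.trans h
    · intro h
      rw [h] at ho
      exact ho.symm.trans hcm
  have h5 : t.orientation = c.orientation ↔ 0 < t.det c := t.orientation_eq_iff_det_pos c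
  have h6 : orientationSign o q * t.det c = orientationSign o x₀ * |t.det c| := by
    have h0 : orientationSign o x₀ = if o.toFun q = c.orientation then 1 else -1 := by
      by_cases h : o.toFun q = c.orientation
      · rw [if_pos h]; exact if_pos (h4.2 h)
      · rw [if_neg h]; exact if_neg (h ∘ h4.1)
    rw [h0, orientationSign, ← ht]
    rcases lt_or_gt_of_ne h3 with hlt | hgt
    · rw [abs_of_neg hlt]
      have h7 : t.orientation ≠ c.orientation := fun h => absurd (h5.1 h) (not_lt.2 hlt.le)
      by_cases h8 : o.toFun q = t.orientation
      · rw [if_pos h8, if_neg (fun h => h7 (h8.symm.trans h))]; ring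
      · have h9 := (t.orientation_eq_or_eq_neg (o.toFun q)).resolve_left h8
        have h10 := (t.orientation_eq_or_eq_neg c.orientation).resolve_left (Ne.symm h7)
        rw [if_neg h8, if_pos (h9.trans h10.symm)]; ring
    · rw [abs_of_pos hgt]
      rw [h5.2 hgt]
  rw [volForm_apply, h2, ← h1, det_chartMatrix_eq_sq β hy, abs_mul, Real.sqrt_mul (abs_nonneg _),
    abs_pow, Real.sqrt_sq (abs_nonneg _)]
  linear_combination (√|(metricMatrix (fun x v w => β x v w) q).det| * c.det v) * h6

end VolumeForm

/-! ### The Hodge dual of normal vectors -/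

section NormalDual

variable {V : Type*} [TopologicalSpace V] [ChartedSpace (EuclideanSpace ℝ (Fin 4)) V]
  [IsManifold (𝓡 4) ∞ V] (g : LorentzMetric V) (oV : ManifoldOrientation 4 V)
  {S : Type*} [TopologicalSpace S] [ChartedSpace (EuclideanSpace ℝ (Fin 2)) S]
  {ι : S → V} {p : S}

/-- The alternating form `η(Z, W, dι ·, dι ·)` on `T_p S`. -/
def normalAreaForm (ι : S → V) (p : S) (Z W : TangentSpace (𝓡 4) (ι p)) :
    (TangentSpace (𝓡 2) p) [⋀^Fin 2]→ₗ[ℝ] ℝ :=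
  (((volForm oV g.form (ι p)).curryLeft Z).curryLeft W).compLinearMap
    (mfderiv (𝓡 2) (𝓡 4) ι p : TangentSpace (𝓡 2) p →ₗ[ℝ] TangentSpace (𝓡 4) (ι p))

lemma normalAreaForm_apply (Z W : TangentSpace (𝓡 4) (ι p)) (v w : TangentSpace (𝓡 2) p) :
    normalAreaForm g oV ι p Z W ![v, w] = volForm oV g.form (ι p)
      ![Z, W, mfderiv (𝓡 2) (𝓡 4) ι p v, mfderiv (𝓡 2) (𝓡 4) ι p w] := by
  rw [normalAreaForm, AlternatingMap.compLinearMap_apply, AlternatingMap.curryLeft_apply_apply,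
    AlternatingMap.curryLeft_apply_apply]
  congr 1
  ext i
  fin_cases i <;> rfl

lemma normalAreaForm_symm (Z W : TangentSpace (𝓡 4) (ι p)) :
    normalAreaForm g oV ι p Z W ![tangentBasis p 0, tangentBasis p 1] =
      -normalAreaForm g oV ι p W Z ![tangentBasis p 0, tangentBasis p 1] := by
  rw [normalAreaForm_apply, normalAreaForm_apply,
    ← AlternatingMap.map_swap _ _ (show (0 : Fin 4) ≠ 1 by decide)]
  congr 1
  ext i
  fin_cases i <;> rfl

lemma normalAreaForm_tangent (v : TangentSpace (𝓡 2) p) (W : TangentSpace (𝓡 4) (ι p)) :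
    normalAreaForm g oV ι p (mfderiv (𝓡 2) (𝓡 4) ι p v) W ![tangentBasis p 0, tangentBasis p 1] = 0 := by
  have h : ∀ A : Fin 2, volForm oV g.form (ι p) ![mfderiv (𝓡 2) (𝓡 4) ι p (tangentBasis p A), W,
      mfderiv (𝓡 2) (𝓡 4) ι p (tangentBasis p 0), mfderiv (𝓡 2) (𝓡 4) ι p (tangentBasis p 1)] = 0 := by
    intro A
    fin_cases A
    · exact AlternatingMap.map_eq_zero_of_eq _ _ (i := 0) (j := 2) rfl (by decide)
    · exact AlternatingMap.map_eq_zero_of_eq _ _ (i := 0) (j := 3) rfl (by decide)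
  simp_rw [← normalAreaForm_apply] at h
  have h2 : ∀ Z, normalAreaForm g oV ι p Z W ![tangentBasis p 0, tangentBasis p 1] =
      ((volForm oV g.form (ι p)).curryLeft Z)
        ![W, mfderiv (𝓡 2) (𝓡 4) ι p (tangentBasis p 0), mfderiv (𝓡 2) (𝓡 4) ι p (tangentBasis p 1)] := by
    intro Z
    rw [normalAreaForm_apply, AlternatingMap.curryLeft_apply_apply]
  rw [← (tangentBasis p).sum_repr v]
  simp only [Fin.sum_univ_two, map_add, map_smul]
  rw [h2]
  simp only [map_add, map_smul, AlternatingMap.add_apply, AlternatingMap.smul_apply, ← h2, h]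
  simp

lemma form_eq_sum_metricMatrix_inv (c : Fin 4 → ℝ) (x : V) (Z : TangentSpace (𝓡 4) x) :
    g.form x (∑ μ, (∑ ν, (metricMatrix g.form x)⁻¹ μ ν * c ν) • tangentBasis x μ) Z =
      ∑ ν, (tangentBasis x).repr Z ν * c ν := by
  set A := metricMatrix g.form x with hA
  have key : ∀ σ, g.form x (∑ μ, (∑ ν, A⁻¹ μ ν * c ν) • tangentBasis x μ) (tangentBasis x σ) = c σ := by
    intro σ
    rw [g.form_sum_left]
    have : ∀ μ, g.form x ((∑ ν, A⁻¹ μ ν * c ν) • tangentBasis x μ) (tangentBasis x σ) =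
        ∑ ν, A σ μ * A⁻¹ μ ν * c ν := by
      intro μ
      rw [g.form_smul_left, g.form_symm, Finset.sum_mul]
      exact Finset.sum_congr rfl fun ν _ => by rw [hA]; simp only [metricMatrix, Matrix.of_apply]; ring
    simp_rw [this]
    rw [Finset.sum_comm]
    have h2 : ∀ ν, ∑ μ, A σ μ * A⁻¹ μ ν * c ν = (1 : Matrix (Fin 4) (Fin 4) ℝ) σ ν * c ν := by
      intro ν
      rw [← Matrix.mul_nonsing_inv A (isUnit_iff_ne_zero.2 (g.det_metricMatrix_neg x).ne),
        Matrix.mul_apply, Finset.sum_mul]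
    simp_rw [h2]
    simp [Matrix.one_apply]
  conv_lhs => rw [← (tangentBasis x).sum_repr Z]
  rw [g.form_sum_right]
  exact Finset.sum_congr rfl fun σ _ => by rw [g.form_smul_right, key]

variable [IsManifold (𝓡 2) 2 S] (oS : ManifoldOrientation 2 S)

/-- The Hodge dual paired with a vector, in the coordinate basis at the point. -/
lemma form_normalDual_self (W Z : TangentSpace (𝓡 4) (ι p)) :
    g.form (ι p) (normalDual g oV ι oS p W) Z =
      normalAreaForm g oV ι p Z W ![tangentBasis p 0, tangentBasis p 1] *
        volForm oS (inducedMetric g ι) p ![tangentBasis p 0, tangentBasis p 1] *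
        (invInduced g ι p).det := by
  rw [normalDual, form_eq_sum_metricMatrix_inv]
  set s := volForm oS (inducedMetric g ι) p with hs
  set k := invInduced g ι p with hk
  set η := volForm oV g.form (ι p) with hη
  have s0 : s ![tangentBasis p 0, tangentBasis p 0] = 0 :=
    AlternatingMap.map_eq_zero_of_eq _ _ (i := 0) (j := 1) rfl (by decide)
  have s1 : s ![tangentBasis p 1, tangentBasis p 1] = 0 :=
    AlternatingMap.map_eq_zero_of_eq _ _ (i := 0) (j := 1) rfl (by decide)
  have s2 : s ![tangentBasis p 1, tangentBasis p 0] = -s ![tangentBasis p 0, tangentBasis p 1] := by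
    rw [← AlternatingMap.map_swap _ _ (show (0 : Fin 2) ≠ 1 by decide)]
    congr 1; ext i; fin_cases i <;> rfl
  have e0 : ∀ Z A, η ![Z, W, tangentVec ι p A, tangentVec ι p A] = 0 := fun Z A =>
    AlternatingMap.map_eq_zero_of_eq _ _ (i := 2) (j := 3) rfl (by decide)
  have e1 : ∀ Z, η ![Z, W, tangentVec ι p 1, tangentVec ι p 0] =
      -η ![Z, W, tangentVec ι p 0, tangentVec ι p 1] := by
    intro Z
    rw [← AlternatingMap.map_swap _ _ (show (2 : Fin 4) ≠ 3 by decide)]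
    congr 1; ext i; fin_cases i <;> rfl
  have e2 : ∑ ν, (tangentBasis (ι p)).repr Z ν *
      η ![tangentBasis (ι p) ν, W, tangentVec ι p 0, tangentVec ι p 1] =
      η ![Z, W, tangentVec ι p 0, tangentVec ι p 1] := by
    have h2 : ∀ Z, η ![Z, W, tangentVec ι p 0, tangentVec ι p 1] =
        (η.curryLeft Z) ![W, tangentVec ι p 0, tangentVec ι p 1] := by
      intro Z; rw [AlternatingMap.curryLeft_apply_apply]
    conv_rhs => rw [← (tangentBasis (ι p)).sum_repr Z]
    rw [h2]
    simp only [Fin.sum_univ_four, map_add, map_smul, AlternatingMap.add_apply,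
      AlternatingMap.smul_apply, smul_eq_mul, ← h2]
  rw [normalAreaForm_apply]
  rw [show volForm oV g.form (ι p) ![Z, W, mfderiv (𝓡 2) (𝓡 4) ι p (tangentBasis p 0),
    mfderiv (𝓡 2) (𝓡 4) ι p (tangentBasis p 1)] = η ![Z, W, tangentVec ι p 0, tangentVec ι p 1]
    from rfl, ← e2, Finset.sum_mul, Finset.sum_mul]
  refine Finset.sum_congr rfl fun ν _ => ?_
  simp only [Fin.sum_univ_two, s0, s1, s2, e0, e1, Matrix.det_fin_two]
  ring

/-- The Hodge dual paired with a vector, in the coordinate frame of any chart. -/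
lemma form_normalDual {x₀ : S} (hp : p ∈ (extChartAt (𝓡 2) x₀).source)
    (W Z : TangentSpace (𝓡 4) (ι p)) :
    g.form (ι p) (normalDual g oV ι oS p W) Z =
      normalAreaForm g oV ι p Z W ![coordField x₀ 0 p, coordField x₀ 1 p] *
        volForm oS (inducedMetric g ι) p ![coordField x₀ 0 p, coordField x₀ 1 p] *
        ((chartMatrix (inducedMetric g ι) x₀ p).det)⁻¹ := by
  set t := tangentBasis (n := 2) p with ht
  set c := coordBasis x₀ p hp with hc
  have h1 : (chartMatrix (inducedMetric g ι) x₀ p).det = t.det c ^ 2 *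
      (metricMatrix (inducedMetric g ι) p).det := det_chartMatrix_eq_sq (inducedForm g ι) hp
  have h3 : t.det c ≠ 0 := (t.isUnit_det c).ne_zero
  have hb : ∀ b : Module.Basis (Fin 2) ℝ (TangentSpace (𝓡 2) p), ⇑b = ![b 0, b 1] := by
    intro b; ext i; fin_cases i <;> rfl
  have h2 : ∀ f : (TangentSpace (𝓡 2) p) [⋀^Fin 2]→ₗ[ℝ] ℝ,
      f ![coordField x₀ 0 p, coordField x₀ 1 p] = t.det c * f ![t 0, t 1] := by
    intro f
    have := congrArg (fun f => f c) (AlternatingMap.eq_smul_basis_det t f)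
    simp only [AlternatingMap.smul_apply, smul_eq_mul] at this
    rw [← coordBasis_apply hp, ← coordBasis_apply hp, ← hc, ← hb, this, ← hb]; ring
  rw [form_normalDual_self, ← ht, h2, h2, h1, invInduced, Matrix.det_nonsing_inv, Ring.inverse_eq_inv']
  rw [mul_inv]
  field_simp

lemma isNormalVector_normalDual (W : TangentSpace (𝓡 4) (ι p)) :
    IsNormalVector g ι p (normalDual g oV ι oS p W) := by
  intro v
  rw [form_normalDual_self, normalAreaForm_tangent]; ring

/-- The Hodge dual is antisymmetric. -/
lemma form_normalDual_antisymm (X Y : TangentSpace (𝓡 4) (ι p)) :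
    g.form (ι p) (normalDual g oV ι oS p X) Y = -g.form (ι p) X (normalDual g oV ι oS p Y) := by
  rw [g.form_symm _ X, form_normalDual_self, form_normalDual_self, normalAreaForm_symm]; ring

variable (hι : IsSpacelikeEmbedding g ι)
include hι

/-- Up to sign, the square of `η(Z, X, e₀, e₁)` is the Gram determinant of the four vectors, and that
of `η_S(e₀, e₁)` is the Gram determinant of `e₀, e₁`. The first one is the product of the second and
of the Gram determinant of `Z, X`, since `Z` and `X` are normal. -/
lemma form_normalDual_sq {X Z : TangentSpace (𝓡 4) (ι p)} (hX : IsNormalVector g ι p X)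
    (hZ : IsNormalVector g ι p Z) :
    g.form (ι p) (normalDual g oV ι oS p X) Z ^ 2 =
      g.form (ι p) X Z ^ 2 - g.form (ι p) X X * g.form (ι p) Z Z := by
  set t := tangentBasis (n := 2) p with ht
  set v : Fin 4 → TangentSpace (𝓡 4) (ι p) := ![Z, X, tangentVec ι p 0, tangentVec ι p 1] with hv
  have hd := hι.det_metricMatrix_pos g p
  have h1 : normalAreaForm g oV ι p Z X ![t 0, t 1] ^ 2 =
      -(Matrix.of fun i j => g.form (ι p) (v i) (v j)).det := by
    have a1 := det_gram (toBilin (g.inner (ι p))) (tangentBasis (ι p)) v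
    have a2 : (Matrix.of fun i j => g.form (ι p) (v i) (v j)).det = (tangentBasis (ι p)).det v ^ 2 *
      (metricMatrix g.form (ι p)).det := a1
    rw [normalAreaForm_apply]
    change volForm oV g.form (ι p) v ^ 2 = _
    rw [volForm_sq, a2, abs_of_neg (g.det_metricMatrix_neg _)]
    ring
  have h2 : volForm oS (inducedMetric g ι) p ![t 0, t 1] ^ 2 = (metricMatrix (inducedMetric g ι) p).det := by
    have : t.det ![t 0, t 1] = 1 := by
      have hb : ![t 0, t 1] = ⇑t := by ext i; fin_cases i <;> rfl
      rw [hb, t.det_self]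
    rw [volForm_sq, ← ht, this, abs_of_pos hd]; ring
  have h3 : (Matrix.of fun i j => g.form (ι p) (v i) (v j)).det =
      (g.form (ι p) Z Z * g.form (ι p) X X - g.form (ι p) X Z ^ 2) *
        (metricMatrix (inducedMetric g ι) p).det := by
    have z1 : ∀ A, g.form (ι p) Z (tangentVec ι p A) = 0 := fun A => hZ _
    have z2 : ∀ A, g.form (ι p) (tangentVec ι p A) Z = 0 := fun A => hZ.form_right g _
    have z3 : ∀ A, g.form (ι p) X (tangentVec ι p A) = 0 := fun A => hX _
    have z4 : ∀ A, g.form (ι p) (tangentVec ι p A) X = 0 := fun A => hX.form_right g _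
    have z5 : ∀ A B, metricMatrix (inducedMetric g ι) p A B =
      g.form (ι p) (tangentVec ι p A) (tangentVec ι p B) := fun _ _ => rfl
    rw [Matrix.det_succ_row_zero, Matrix.det_fin_two]
    simp only [Fin.sum_univ_four, Matrix.det_fin_three, Matrix.submatrix_apply, Matrix.of_apply, z5]
    simp [hv, Fin.succAbove, z1, z2, z3, z4, g.form_symm _ Z X]
    ring
  rw [form_normalDual_self, mul_pow, mul_pow, h1, h2, h3, invInduced, Matrix.det_nonsing_inv,
    Ring.inverse_eq_inv']
  field_simp
  ring

end NormalDual

/-! ### The Hodge dual as an involution -/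

section DualAlgebra

variable {V : Type*} [TopologicalSpace V] [ChartedSpace (EuclideanSpace ℝ (Fin 4)) V]
  [IsManifold (𝓡 4) ∞ V] (g : LorentzMetric V) (oV : ManifoldOrientation 4 V)
  {S : Type*} [TopologicalSpace S] [ChartedSpace (EuclideanSpace ℝ (Fin 2)) S]
  [IsManifold (𝓡 2) 2 S] (oS : ManifoldOrientation 2 S) {ι : S → V} {p : S}

lemma normalDual_add (X Y : TangentSpace (𝓡 4) (ι p)) :
    normalDual g oV ι oS p (X + Y) = normalDual g oV ι oS p X + normalDual g oV ι oS p Y := by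
  refine g.eq_of_form_eq fun Z => ?_
  rw [g.form_add_left, form_normalDual_antisymm, form_normalDual_antisymm,
    form_normalDual_antisymm, g.form_add_left]; ring

lemma normalDual_smul (a : ℝ) (X : TangentSpace (𝓡 4) (ι p)) :
    normalDual g oV ι oS p (a • X) = a • normalDual g oV ι oS p X := by
  refine g.eq_of_form_eq fun Z => ?_
  rw [g.form_smul_left, form_normalDual_antisymm, form_normalDual_antisymm, g.form_smul_left]; ring

lemma normalDual_sub (X Y : TangentSpace (𝓡 4) (ι p)) :
    normalDual g oV ι oS p (X - Y) = normalDual g oV ι oS p X - normalDual g oV ι oS p Y := by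
  refine g.eq_of_form_eq fun Z => ?_
  rw [g.form_sub_left, form_normalDual_antisymm, form_normalDual_antisymm,
    form_normalDual_antisymm, g.form_sub_left]; ring

variable (hι : IsSpacelikeEmbedding g ι)
include hι

/-- In the two-dimensional normal space, `X` and its dual determine all scalar products. -/
lemma form_normalDual_mul {X Y Z : TangentSpace (𝓡 4) (ι p)} (hX : IsNormalVector g ι p X)
    (hY : IsNormalVector g ι p Y) (hZ : IsNormalVector g ι p Z) :
    g.form (ι p) (normalDual g oV ι oS p X) Y * g.form (ι p) (normalDual g oV ι oS p X) Z =
      g.form (ι p) X Y * g.form (ι p) X Z - g.form (ι p) X X * g.form (ι p) Y Z := by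
  have h1 := form_normalDual_sq g oV oS hι hX hY
  have h2 := form_normalDual_sq g oV oS hι hX hZ
  have h3 := form_normalDual_sq g oV oS hι hX (hY.add g hZ)
  simp only [g.form_add_left, g.form_add_right, g.form_symm _ Z Y] at h3
  linear_combination (1 / 2) * (h3 - h1 - h2)

/-- If `X` is not null, `X` and `X^⋆` form an orthogonal basis of the normal plane with
`X^⋆ · X^⋆ = -X · X`, in which `Z` is expanded here. -/
lemma normal_decomp {X Z : TangentSpace (𝓡 4) (ι p)} (hX : IsNormalVector g ι p X)
    (hZ : IsNormalVector g ι p Z) :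
    g.form (ι p) X X • Z = g.form (ι p) X Z • X - g.form (ι p) (normalDual g oV ι oS p X) Z • normalDual g oV ι oS p X := by
  refine IsNormalVector.ext g hι (hZ.smul g _) ((hX.smul g _).sub g
    ((isNormalVector_normalDual g oV oS X).smul g _)) fun Y hY => ?_
  have := form_normalDual_mul g oV oS hι hX hZ hY
  rw [g.form_sub_left, g.form_smul_left, g.form_smul_left, g.form_smul_left]
  linarith

omit [IsManifold (𝓡 2) 2 S] in
lemma linearIndependent_normal_tangent {X : TangentSpace (𝓡 4) (ι p)}
    (hX : IsNormalVector g ι p X) (h0 : X ≠ 0) :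
    LinearIndependent ℝ (Fin.cons X (fun A => tangentVec ι p A) : Fin 3 → TangentSpace (𝓡 4) (ι p)) := by
  let L : TangentSpace (𝓡 2) p →ₗ[ℝ] TangentSpace (𝓡 4) (ι p) := mfderiv (𝓡 2) (𝓡 4) ι p
  have hL : Function.Injective L := by
    refine (injective_iff_map_eq_zero L).2 fun v hv => ?_
    refine eq_zero_of_normal_of_tangent g hι (v := v) ?_
    have : mfderiv (𝓡 2) (𝓡 4) ι p v = 0 := hv
    rw [this]; exact isNormalVector_zero g
  have h1 : LinearIndependent ℝ (fun A => tangentVec ι p A) :=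
    (tangentBasis (n := 2) p).linearIndependent.map' L (LinearMap.ker_eq_bot.2 hL)
  refine linearIndependent_finCons.2 ⟨h1, fun hm => h0 ?_⟩
  have h2 : X ∈ LinearMap.range L := by
    refine (Submodule.span_le.2 ?_) hm
    rintro _ ⟨A, rfl⟩
    exact ⟨tangentBasis p A, rfl⟩
  obtain ⟨v, hv⟩ := h2
  have hv' : mfderiv (𝓡 2) (𝓡 4) ι p v = X := hv
  rw [← hv'] at hX ⊢
  rw [eq_zero_of_normal_of_tangent g hι hX, map_zero]

/-- A nonzero normal vector `X` and the tangent vectors `e₀, e₁` extend to a basis by some `Z`, and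
`η(Z, X, e₀, e₁) ≠ 0` shows `X^⋆ · Z ≠ 0`. -/
lemma eq_zero_of_normalDual_eq_zero {X : TangentSpace (𝓡 4) (ι p)}
    (hX : IsNormalVector g ι p X) (h : normalDual g oV ι oS p X = 0) : X = 0 := by
  by_contra h0
  have h1 := linearIndependent_normal_tangent g hι hX h0
  have hf : Module.finrank ℝ (TangentSpace (𝓡 4) (ι p)) = 4 := by
    rw [Module.finrank_eq_card_basis (tangentBasis (ι p))]; simp
  obtain ⟨Z, hZ⟩ := exists_linearIndependent_cons_of_lt_finrank h1 (by rw [hf]; norm_num)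
  have hd := hι.det_metricMatrix_pos g p
  have h2 := form_normalDual_self g oV oS X Z
  rw [h, g.form_zero_left] at h2
  have h3 : volForm oS (inducedMetric g ι) p ![tangentBasis p 0, tangentBasis p 1] ≠ 0 := by
    have hb : ![tangentBasis (n := 2) p 0, tangentBasis p 1] = ⇑(tangentBasis p) := by
      ext i; fin_cases i <;> rfl
    intro h
    have h4 := volForm_sq oS (inducedMetric g ι) (q := p) ![tangentBasis p 0, tangentBasis p 1]
    rw [h, hb, Module.Basis.det_self] at h4
    have := abs_pos.2 hd.ne'
    nlinarith
  have h4 : (invInduced g ι p).det ≠ 0 := by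
    rw [invInduced, Matrix.det_nonsing_inv, Ring.inverse_eq_inv']
    exact inv_ne_zero hd.ne'
  have h5 : normalAreaForm g oV ι p Z X ![tangentBasis p 0, tangentBasis p 1] = 0 := by
    by_contra h5
    exact mul_ne_zero (mul_ne_zero h5 h3) h4 h2.symm
  rw [normalAreaForm_apply] at h5
  have h6 := volForm_sq oV g.form (q := ι p) (Fin.cons Z (Fin.cons X (fun A => tangentVec ι p A)))
  have h7 : (Fin.cons Z (Fin.cons X (fun A => tangentVec ι p A)) : Fin 4 → TangentSpace (𝓡 4) (ι p)) =
      ![Z, X, mfderiv (𝓡 2) (𝓡 4) ι p (tangentBasis p 0),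
        mfderiv (𝓡 2) (𝓡 4) ι p (tangentBasis p 1)] := by
    ext i; fin_cases i <;> rfl
  let b := basisOfLinearIndependentOfCardEqFinrank hZ (by rw [hf]; simp)
  have h8 := ((tangentBasis (ι p)).isUnit_det b).ne_zero
  rw [coe_basisOfLinearIndependentOfCardEqFinrank] at h8
  rw [h7, h5, ← h7] at h6
  have h9 := abs_pos.2 (g.det_metricMatrix_neg (ι p)).ne
  have h10 : (0 : ℝ) < |(metricMatrix g.form (ι p)).det| * (tangentBasis (ι p)).det
    (Fin.cons Z (Fin.cons X (fun A => tangentVec ι p A))) ^ 2 := by positivity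
  rw [← h6] at h10
  norm_num at h10

lemma form_normalDual_self_self {X : TangentSpace (𝓡 4) (ι p)} (hX : IsNormalVector g ι p X) :
    g.form (ι p) (normalDual g oV ι oS p X) (normalDual g oV ι oS p X) = -g.form (ι p) X X := by
  by_cases h : normalDual g oV ι oS p X = 0
  · rw [h, eq_zero_of_normalDual_eq_zero g oV oS hι hX h, g.form_zero_left, neg_zero]
  · have hJ := isNormalVector_normalDual g oV oS X
    have h1 := normal_decomp g oV oS hι hX hJ
    have h2 : g.form (ι p) X (normalDual g oV ι oS p X) = 0 := by
      have := form_normalDual_antisymm g oV oS X X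
      rw [g.form_symm] at this; linarith
    rw [h2, zero_smul, zero_sub, ← neg_smul] at h1
    have h3 : g.form (ι p) X X = -g.form (ι p) (normalDual g oV ι oS p X) (normalDual g oV ι oS p X) :=
      smul_left_injective ℝ h h1
    linarith

lemma form_normalDual_normalDual {X Y : TangentSpace (𝓡 4) (ι p)} (hX : IsNormalVector g ι p X)
    (hY : IsNormalVector g ι p Y) :
    g.form (ι p) (normalDual g oV ι oS p X) (normalDual g oV ι oS p Y) = -g.form (ι p) X Y := by
  have h1 := form_normalDual_self_self g oV oS hι hX
  have h2 := form_normalDual_self_self g oV oS hι hY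
  have h3 := form_normalDual_self_self g oV oS hι (hX.add g hY)
  rw [normalDual_add] at h3
  simp only [g.form_add_left, g.form_add_right, g.form_symm _ Y X,
    g.form_symm _ (normalDual g oV ι oS p Y) (normalDual g oV ι oS p X)] at h3
  linarith

/-- The Hodge dual is an involution of the normal space. -/
lemma normalDual_normalDual {X : TangentSpace (𝓡 4) (ι p)} (hX : IsNormalVector g ι p X) :
    normalDual g oV ι oS p (normalDual g oV ι oS p X) = X := by
  refine IsNormalVector.ext g hι (isNormalVector_normalDual g oV oS _) hX fun Z hZ => ?_
  rw [form_normalDual_antisymm, form_normalDual_normalDual g oV oS hι hX hZ, neg_neg]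

end DualAlgebra

/-! ### Regularity of traces and normal parts -/

section NormalRegularity

variable {V : Type*} [TopologicalSpace V] [ChartedSpace (EuclideanSpace ℝ (Fin 4)) V]
  [IsManifold (𝓡 4) ∞ V] (g : LorentzMetric V)
  {S : Type*} [TopologicalSpace S] [ChartedSpace (EuclideanSpace ℝ (Fin 2)) S]
  {ι : S → V} {p : S}

/-- The metric as a bilinear map. -/
def LorentzMetric.bilin (x : V) : TangentSpace (𝓡 4) x →ₗ[ℝ] TangentSpace (𝓡 4) x →ₗ[ℝ] ℝ :=
  toBilin (g.inner x)

/-- The differential of `ι` as a linear map. -/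
def differential (ι : S → V) (p : S) : TangentSpace (𝓡 2) p →ₗ[ℝ] TangentSpace (𝓡 4) (ι p) :=
  (mfderiv (𝓡 2) (𝓡 4) ι p).toLinearMap

lemma covDeriv_add (X : ∀ q : S, TangentSpace (𝓡 4) (ι q)) (v w : TangentSpace (𝓡 2) p) :
    covDeriv g ι X p (v + w) = covDeriv g ι X p v + covDeriv g ι X p w := by
  have h : coordDeriv ι X p (v + w) = coordDeriv ι X p v + coordDeriv ι X p w := map_add _ _ _
  rw [covDeriv, covDeriv, covDeriv, h]
  have h2 : ∀ a b c d e : TangentSpace (𝓡 4) (ι p), e = c + d → a + b + e = a + c + (b + d) := by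
    rintro a b c d e rfl; abel
  apply h2
  rw [← Finset.sum_add_distrib]
  refine Finset.sum_congr rfl fun μ _ => ?_
  rw [← add_smul]
  congr 1
  simp only [map_add, Finsupp.add_apply, mul_add, add_mul, Finset.sum_add_distrib]

lemma covDeriv_smul (X : ∀ q : S, TangentSpace (𝓡 4) (ι q)) (a : ℝ) (v : TangentSpace (𝓡 2) p) :
    covDeriv g ι X p (a • v) = a • covDeriv g ι X p v := by
  have h : coordDeriv ι X p (a • v) = a • coordDeriv ι X p v := map_smul _ _ _
  rw [covDeriv, covDeriv, h, smul_add, Finset.smul_sum]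
  congr 1
  refine Finset.sum_congr rfl fun μ _ => ?_
  rw [smul_smul]
  congr 1
  simp only [map_smul, Finsupp.smul_apply, smul_eq_mul, Finset.mul_sum]
  exact Finset.sum_congr rfl fun ν _ => Finset.sum_congr rfl fun ρ _ => by ring

/-- The covariant derivative `v ↦ ∇_v X` as a linear map. -/
def covDerivLin (ι : S → V) (X : ∀ q : S, TangentSpace (𝓡 4) (ι q)) (p : S) :
    TangentSpace (𝓡 2) p →ₗ[ℝ] TangentSpace (𝓡 4) (ι p) where
  toFun := covDeriv g ι X p
  map_add' := covDeriv_add g X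
  map_smul' := covDeriv_smul g X

/-- The normal derivative `v ↦ ∇^⊥_v X` as a linear map. -/
def normalDerivLin (ι : S → V) (X : ∀ q : S, TangentSpace (𝓡 4) (ι q)) (p : S) :
    TangentSpace (𝓡 2) p →ₗ[ℝ] TangentSpace (𝓡 4) (ι p) where
  toFun := normalDeriv g ι X p
  map_add' v w := by rw [normalDeriv, covDeriv_add, normalPart_add]; rfl
  map_smul' a v := by rw [normalDeriv, covDeriv_smul, normalPart_smul]; rfl

lemma form_normalPart (w Z : TangentSpace (𝓡 4) (ι p)) :
    g.form (ι p) (normalPart g ι p w) Z = g.form (ι p) w Z - surfaceTrace g ι p fun v v' =>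
      (g.bilin (ι p) w ∘ₗ differential ι p) v * (g.bilin (ι p) Z ∘ₗ differential ι p) v' := by
  rw [normalPart, g.form_sub_left, g.form_sum_left, surfaceTrace]
  congr 1
  refine Finset.sum_congr rfl fun A _ => ?_
  rw [g.form_sum_left]
  refine Finset.sum_congr rfl fun B _ => ?_
  rw [g.form_smul_left, g.form_symm _ (tangentVec ι p B) Z, mul_assoc]
  rfl

variable [IsManifold (𝓡 2) 2 S]

lemma contMDiffAlong_mfderiv_coordField (hι : ContMDiff (𝓡 2) (𝓡 4) 2 ι) {x₀ : S}
    (hp : p ∈ (extChartAt (𝓡 2) x₀).source) (A : Fin 2) :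
    ContMDiffAlong 2 ι 1 (fun q => mfderiv (𝓡 2) (𝓡 4) ι q (coordField x₀ A q)) p := by
  have h4 := mem_extChartAt_source (I := 𝓡 4) (ι p)
  have h1 : ContMDiff (𝓡 2) (𝓡 4) 1 ι := hι.of_le (by norm_num)
  rw [contMDiffAlong_iff h1.contMDiffAt h4]
  have h2 : ContMDiffAt (𝓡 2) 𝓘(ℝ, EuclideanSpace ℝ (Fin 4)) 2
      (fun q => extChartAt (𝓡 4) (ι p) (ι q)) p :=
    (contMDiffAt_extChartAt (I := 𝓡 4) (n := 2) (x := ι p)).comp p hι.contMDiffAt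
  have h3 := h2.mfderiv_vectorField (k := 1) (j := 2) (by norm_num) (by simp)
    (contMDiffAt_coordField hp A)
  refine h3.congr_of_eventuallyEq ?_
  filter_upwards [h1.continuous.continuousAt.preimage_mem_nhds (extChartAt_source_mem_nhds (I := 𝓡 4) (ι p))]
    with q hq
  exact chartMap_mfderiv (h1.contMDiffAt.mdifferentiableAt (by simp)) hq _

lemma contMDiffForm_inducedForm (hι : ContMDiff (𝓡 2) (𝓡 4) 2 ι) :
    ContMDiffForm 1 (inducedForm g ι) := by
  intro x₀ y hy i j
  exact (g.contMDiffForm 1 (by simp)).apply (hι.of_le (by norm_num)).contMDiffAt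
    (contMDiffAlong_mfderiv_coordField hι hy i) (contMDiffAlong_mfderiv_coordField hι hy j)

/-- The trace of a `C^k` field of bilinear forms is `C^k`. -/
lemma contMDiffAt_surfaceTrace (hι : IsSpacelikeEmbedding g ι) {k : WithTop ℕ∞} (hk : k ≤ 1)
    {x₀ : S} (hp : p ∈ (extChartAt (𝓡 2) x₀).source)
    (b : ∀ q : S, TangentSpace (𝓡 2) q →ₗ[ℝ] TangentSpace (𝓡 2) q →ₗ[ℝ] ℝ)
    (hb : ∀ A B, ContMDiffAt (𝓡 2) 𝓘(ℝ, ℝ) k (fun q => b q (coordField x₀ A q) (coordField x₀ B q)) p) :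
    ContMDiffAt (𝓡 2) 𝓘(ℝ, ℝ) k (fun q => surfaceTrace g ι q fun v w => b q v w) p := by
  have h1 : ContMDiffAt (𝓡 2) 𝓘(ℝ, ℝ) k (fun q => ∑ A, ∑ B,
      (chartMatrix (inducedMetric g ι) x₀ q)⁻¹ A B *
        b q (coordField x₀ A q) (coordField x₀ B q)) p :=
    ContMDiffAt.sum fun A _ => ContMDiffAt.sum fun B _ => ContMDiffAt.mul
      (ContMDiffAt.matrix_inv
      (fun i j => (contMDiffForm_inducedForm g hι.contMDiff x₀ p hp i j).of_le hk)
      (det_chartMatrix_inducedMetric_pos g hι hp).ne' A B) (hb A B)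
  refine h1.congr_of_eventuallyEq ?_
  filter_upwards [extChartAt_source_mem_nhds' (I := 𝓡 2) hp] with q hq
  exact surfaceTrace_eq_chart g hq (b q)

lemma ContMDiffAlong.normalPart (hι : IsSpacelikeEmbedding g ι) {k : WithTop ℕ∞} (hk : k ≤ 1)
    [ContMDiffVectorBundle k (EuclideanSpace ℝ (Fin 4)) (TangentSpace (𝓡 4) : V → Type _) (𝓡 4)]
    {X : ∀ q : S, TangentSpace (𝓡 4) (ι q)} (hX : ContMDiffAlong 2 ι k X p) :
    ContMDiffAlong 2 ι k (fun q => normalPart g ι q (X q)) p := by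
  have hk' : k ≤ 2 := hk.trans (by norm_num)
  have hk'' : k ≤ ∞ := hk.trans (by simp)
  have h1 : ContMDiffAt (𝓡 2) (𝓡 4) k ι p := hι.contMDiff.contMDiffAt.of_le hk'
  have hg := g.contMDiffForm k hk''
  refine contMDiffAlong_of_pairing hg
    (fun x₀ y hy => (g.det_chartMatrix_neg hy).ne) h1 fun l => ?_
  have hp := mem_extChartAt_source (I := 𝓡 2) p
  have h4 : ContMDiffAlong 2 ι k (fun q => coordField (ι p) l (ι q)) p :=
    (contMDiffAt_coordField (mem_extChartAt_source (I := 𝓡 4) (ι p)) l).comp p h1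
  have h5 : ∀ A, ContMDiffAlong 2 ι k
      (fun q => mfderiv (𝓡 2) (𝓡 4) ι q (coordField p A q)) p :=
    fun A => (contMDiffAlong_mfderiv_coordField hι.contMDiff hp A).of_le hk
  have h6 := contMDiffAt_surfaceTrace g hι hk hp
    (fun q => (LinearMap.mul ℝ ℝ).compl₁₂ (g.bilin (ι q) (X q) ∘ₗ differential ι q)
      (g.bilin (ι q) (coordField (ι p) l (ι q)) ∘ₗ differential ι q))
    (fun A B => (hg.apply h1 hX (h5 A)).mul (hg.apply h1 h4 (h5 B)))
  refine ((hg.apply h1 hX h4).sub h6).congr_of_eventuallyEq ?_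
  filter_upwards with q
  exact form_normalPart g _ _

lemma ContMDiffAlong.covDeriv {k j : WithTop ℕ∞} (hkj : k + 1 ≤ j) (hj : j ≠ ∞)
    [ContMDiffVectorBundle k (EuclideanSpace ℝ (Fin 4)) (TangentSpace (𝓡 4) : V → Type _) (𝓡 4)]
    [ContMDiffVectorBundle j (EuclideanSpace ℝ (Fin 4)) (TangentSpace (𝓡 4) : V → Type _) (𝓡 4)]
    [ContMDiffVectorBundle k (EuclideanSpace ℝ (Fin 2)) (TangentSpace (𝓡 2) : S → Type _) (𝓡 2)]
    [IsManifold (𝓡 2) j S] [IsManifold (𝓡 2) k S] [IsManifold (𝓡 4) j V] [IsManifold (𝓡 4) k V]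
    (hk : k + 1 ≤ ∞) (hι : ContMDiffAt (𝓡 2) (𝓡 4) j ι p) {X : ∀ q : S, TangentSpace (𝓡 4) (ι q)}
    (hX : ContMDiffAlong 2 ι j X p) {Y : ∀ q : S, TangentSpace (𝓡 2) q}
    (hY : ContMDiffAt (𝓡 2) (𝓡 2).tangent k (fun q => (⟨q, Y q⟩ : TangentBundle (𝓡 2) S)) p) :
    ContMDiffAlong 2 ι k (fun q => covDeriv g ι X q (Y q)) p := by
  have h1j : (1 : WithTop ℕ∞) ≤ j := le_trans (by simp) hkj
  have hkj' : k ≤ j := le_trans (by simp) hkj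
  have hιk := hι.of_le hkj'
  have h4 := mem_extChartAt_source (I := 𝓡 4) (ι p)
  refine contMDiffAlong_of_pairing (g.contMDiffForm k (le_trans (by simp) hk))
    (fun x₀ y hy => (g.det_chartMatrix_neg hy).ne) hιk fun l => ?_
  set ε := EuclideanSpace.basisFun (Fin 4) ℝ with hε
  have a1 : ContMDiffAt (𝓡 2) 𝓘(ℝ, EuclideanSpace ℝ (Fin 4)) j
      (fun q => extChartAt (𝓡 4) (ι p) (ι q)) p :=
    (contMDiffAt_extChartAt (I := 𝓡 4) (n := j) (x := ι p)).comp p hι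
  have a2 := (contMDiffAlong_iff hι h4).1 hX
  have b1 := a1.mfderiv_vectorField (k := k) hkj hj hY
  have b2 := a2.mfderiv_vectorField (k := k) hkj hj hY
  have cG : ContDiffAt ℝ (k + 1) (chartForm g.inner (ι p)) (extChartAt (𝓡 4) (ι p) (ι p)) :=
    ((g.contMDiffForm ∞ le_rfl).contDiffAt_chartForm h4).of_le hk
  have c1 := (cG.of_le (m := k) (by simp)).contMDiffAt.comp p (a1.of_le hkj')
  have c2 := (cG.fderiv_right (m := k) le_rfl).contMDiffAt.comp p (a1.of_le hkj')
  have a2k := a2.of_le hkj'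
  have d1 := (c1.clm_apply b2).clm_apply (contMDiffAt_const (c := ε l))
  have e1 := ((c2.clm_apply b1).clm_apply a2k).clm_apply (contMDiffAt_const (c := ε l))
  have e2 := ((c2.clm_apply a2k).clm_apply b1).clm_apply (contMDiffAt_const (c := ε l))
  have e3 := ((c2.clm_apply (contMDiffAt_const (c := ε l))).clm_apply b1).clm_apply a2k
  have e4 := (contMDiffAt_const (c := (1 / 2 : ℝ))).mul ((e1.add e2).sub e3)
  refine (d1.add e4).congr_of_eventuallyEq ?_
  have n1 := (contMDiffAt_iff_contMDiffAt_nhds (by simp)).1 (hι.of_le h1j)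
  have n2 := (contMDiffAt_iff_contMDiffAt_nhds (by simp)).1 (ContMDiffAt.of_le hX h1j)
  filter_upwards [hι.continuousAt.preimage_mem_nhds (extChartAt_source_mem_nhds (I := 𝓡 4) (ι p)),
    n1, n2] with q hq h1q h2q
  rw [g.inner_eq_form, form_covDeriv g h1q hq h2q, coordField_eq hq, chartMap_chartInv hq,
    chartMap_mfderiv (h1q.mdifferentiableAt (by simp)) hq]
  rfl

end NormalRegularity

/-! ### Regularity of the Hodge dual -/

section DualRegularity

variable {V : Type*} [TopologicalSpace V] [ChartedSpace (EuclideanSpace ℝ (Fin 4)) V]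
  [IsManifold (𝓡 4) ∞ V] (g : LorentzMetric V) (oV : ManifoldOrientation 4 V)
  {S : Type*} [TopologicalSpace S] [ChartedSpace (EuclideanSpace ℝ (Fin 2)) S] {ι : S → V} {p : S}

lemma IsSpacelikeEmbedding.contMDiffAt_one (hι : IsSpacelikeEmbedding g ι) (p : S) :
    ContMDiffAt (𝓡 2) (𝓡 4) 1 ι p := hι.contMDiff.contMDiffAt.of_le (by norm_num)

variable [IsManifold (𝓡 2) 2 S] (oS : ManifoldOrientation 2 S) (hι : IsSpacelikeEmbedding g ι)
include hι

/-- The scalar product of the Hodge dual of a `C^k` field with a `C^k` field is `C^k`. -/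
lemma contMDiffAt_form_normalDual {k : WithTop ℕ∞} (hk : k ≤ 1)
    [ContMDiffVectorBundle k (EuclideanSpace ℝ (Fin 4)) (TangentSpace (𝓡 4) : V → Type _) (𝓡 4)]
    {W Z : ∀ q : S, TangentSpace (𝓡 4) (ι q)} (hW : ContMDiffAlong 2 ι k W p)
    (hZ : ContMDiffAlong 2 ι k Z p) :
    ContMDiffAt (𝓡 2) 𝓘(ℝ, ℝ) k (fun q => g.form (ι q) (normalDual g oV ι oS q (W q)) (Z q)) p := by
  have h1 : ContMDiffAt (𝓡 2) (𝓡 4) k ι p := (hι.contMDiffAt_one g p).of_le hk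
  have hp := mem_extChartAt_source (I := 𝓡 2) p
  have h4 := mem_extChartAt_source (I := 𝓡 4) (ι p)
  set T : Fin 4 → ∀ q : S, TangentSpace (𝓡 4) (ι q) := fun j q =>
    ![Z q, W q, mfderiv (𝓡 2) (𝓡 4) ι q (coordField p 0 q),
      mfderiv (𝓡 2) (𝓡 4) ι q (coordField p 1 q)] j with hT
  have hT1 : ∀ j, ContMDiffAlong 2 ι k (T j) p := by
    intro j
    fin_cases j
    · exact hZ
    · exact hW
    · exact (contMDiffAlong_mfderiv_coordField hι.contMDiff hp 0).of_le hk
    · exact (contMDiffAlong_mfderiv_coordField hι.contMDiff hp 1).of_le hk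
  have a1 : ContMDiffAt (𝓡 2) 𝓘(ℝ, ℝ) k
      (fun q => (Matrix.of fun i j => chartMap (ι p) (ι q) (T j q) i).det) p :=
    ContMDiffAt.matrix_det fun i j => ((contMDiffAlong_iff h1 h4).1 (hT1 j)).euclidean_apply i
  have a2 : ContMDiffAt (𝓡 2) 𝓘(ℝ, ℝ) k (fun q => √(-(chartMatrix g.form (ι p) (ι q)).det)) p := by
    have := (ContMDiffAt.matrix_det fun i j =>
      (g.contMDiffForm k (hk.trans (by simp)) _ _ h4 i j).comp p h1).neg
    exact (Real.contDiffAt_sqrt (neg_pos.2 (g.det_chartMatrix_neg h4)).ne').contMDiffAt.comp p this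
  have a3 : ContMDiffAt (𝓡 2) 𝓘(ℝ, ℝ) k (fun q => (chartMatrix (inducedMetric g ι) p q).det) p :=
    (ContMDiffAt.matrix_det fun i j => (contMDiffForm_inducedForm g hι.contMDiff p p hp i j)).of_le hk
  have d3 := det_chartMatrix_inducedMetric_pos g hι hp
  have a4 : ContMDiffAt (𝓡 2) 𝓘(ℝ, ℝ) k (fun q => √(chartMatrix (inducedMetric g ι) p q).det) p :=
    (Real.contDiffAt_sqrt d3.ne').contMDiffAt.comp p a3
  refine ((((contMDiffAt_const (c := orientationSign oV (ι p))).mul a2).mul a1).mul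
    ((contMDiffAt_const (c := orientationSign oS p)).mul a4) |>.mul
      (a3.inv₀ d3.ne')).congr_of_eventuallyEq ?_
  filter_upwards [h1.continuousAt.preimage_mem_nhds (extChartAt_source_mem_nhds (I := 𝓡 4) (ι p)),
    extChartAt_source_mem_nhds (I := 𝓡 2) p, h1.continuousAt.eventually
      (volForm_eventually_eq oV g.inner (ι p)), volForm_eventually_eq oS (inducedForm g ι) p]
    with q h4q hq hV hS
  have b1 : volForm oV g.form (ι q) (fun j => T j q) = orientationSign oV (ι p) *
      √(-(chartMatrix g.form (ι p) (ι q)).det) *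
      (Matrix.of fun i j => chartMap (ι p) (ι q) (T j q) i).det := by
    rw [← abs_of_neg (g.det_chartMatrix_neg h4q)]
    exact hV _
  have b2 : volForm oS (inducedMetric g ι) q ![coordField p 0 q, coordField p 1 q] =
      orientationSign oS p * √(chartMatrix (inducedMetric g ι) p q).det := by
    have c1 : (Matrix.of fun i j : Fin 2 => chartMap p q
        ((![coordField p 0 q, coordField p 1 q] : Fin 2 → TangentSpace (𝓡 2) q) j) i) = 1 := by
      have c2 : ∀ j, (![coordField p 0 q, coordField p 1 q] : Fin 2 → TangentSpace (𝓡 2) q) j =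
          coordField p j q := by intro j; fin_cases j <;> rfl
      ext i j
      rw [Matrix.of_apply, c2, coordField_eq hq, chartMap_chartInv hq]
      simp [Matrix.one_apply]
    have c3 := hS ![coordField p 0 q, coordField p 1 q]
    rw [c1, Matrix.det_one, mul_one] at c3
    rw [← abs_of_pos (det_chartMatrix_inducedMetric_pos g hι hq)]
    exact c3
  rw [form_normalDual g oV oS hq, normalAreaForm_apply, b2]
  exact congrArg (fun t => t * (orientationSign oS p *
    √(chartMatrix (inducedMetric g ι) p q).det) * ((chartMatrix (inducedMetric g ι) p q).det)⁻¹) b1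

lemma ContMDiffAlong.normalDual {k : WithTop ℕ∞} (hk : k ≤ 1)
    [ContMDiffVectorBundle k (EuclideanSpace ℝ (Fin 4)) (TangentSpace (𝓡 4) : V → Type _) (𝓡 4)]
    {W : ∀ q : S, TangentSpace (𝓡 4) (ι q)} (hW : ContMDiffAlong 2 ι k W p) :
    ContMDiffAlong 2 ι k (fun q => normalDual g oV ι oS q (W q)) p := by
  have h1 : ContMDiffAt (𝓡 2) (𝓡 4) k ι p := (hι.contMDiffAt_one g p).of_le hk
  refine contMDiffAlong_of_pairing (g.contMDiffForm k (hk.trans (by simp)))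
    (fun x₀ y hy => (g.det_chartMatrix_neg hy).ne) h1 fun l => ?_
  exact contMDiffAt_form_normalDual g oV oS hι hk hW
    ((contMDiffAt_coordField (mem_extChartAt_source (I := 𝓡 4) (ι p)) l).comp p h1)

/-- Every normal vector extends to a `C^1` normal vector field. -/
lemma exists_normal_extension {w : TangentSpace (𝓡 4) (ι p)} (hw : IsNormalVector g ι p w) :
    ∃ T : ∀ q : S, TangentSpace (𝓡 4) (ι q), ContMDiffAlong 2 ι 1 T p ∧
      (∀ q, IsNormalVector g ι q (T q)) ∧ T p = w := by
  refine ⟨fun q => normalPart g ι q (chartInv (ι p) (ι q) (chartMap (ι p) (ι p) w)), ?_,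
    fun q => isNormalVector_normalPart g hι _, ?_⟩
  · refine ContMDiffAlong.normalPart g hι le_rfl ?_
    have h4 := mem_extChartAt_source (I := 𝓡 4) (ι p)
    have h1 := hι.contMDiffAt_one g p
    rw [contMDiffAlong_iff h1 h4]
    refine (contMDiffAt_const (c := chartMap (ι p) (ι p) w)).congr_of_eventuallyEq ?_
    filter_upwards [h1.continuousAt.preimage_mem_nhds (extChartAt_source_mem_nhds (I := 𝓡 4) (ι p))]
      with q hq
    exact chartMap_chartInv hq _
  · beta_reduce
    rw [chartInv_chartMap (mem_extChartAt_source _), normalPart_of_normal g hι hw]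

omit [IsManifold (𝓡 2) 2 S] in
lemma exists_timelike_normal (p : S) : ∃ w : TangentSpace (𝓡 4) (ι p), IsNormalVector g ι p w ∧
    g.form (ι p) w w < 0 := by
  obtain ⟨e, he⟩ := g.signature (ι p)
  refine ⟨normalPart g ι p (e 0), isNormalVector_normalPart g hι _,
    (form_normalPart_self_le g hι _).trans_lt ?_⟩
  have : g.form (ι p) (e 0) (e 0) = -1 := (he 0 0).trans (by simp)
  rw [this]; norm_num

end DualRegularity

/-! ### The Hodge dual is parallel -/

section ParallelDual

variable {V : Type*} [TopologicalSpace V] [ChartedSpace (EuclideanSpace ℝ (Fin 4)) V]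
  [IsManifold (𝓡 4) ∞ V] (g : LorentzMetric V) (oV : ManifoldOrientation 4 V)
  {S : Type*} [TopologicalSpace S] [ChartedSpace (EuclideanSpace ℝ (Fin 2)) S]
  {ι : S → V} {p : S}

lemma vderiv_neg {n : ℕ} {M : Type*} [TopologicalSpace M]
    [ChartedSpace (EuclideanSpace ℝ (Fin n)) M] {f : M → ℝ} {y : M} (v : TangentSpace (𝓡 n) y) :
    vderiv (fun q => -f q) y v = -vderiv f y v := by
  rw [vderiv_eq_mfderiv, vderiv_eq_mfderiv]
  have h : (fun q => -f q) = -f := rfl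
  rw [h, mfderiv_neg]
  rfl

lemma vderiv_const {n : ℕ} {M : Type*} [TopologicalSpace M]
    [ChartedSpace (EuclideanSpace ℝ (Fin n)) M] (c : ℝ) {y : M} (v : TangentSpace (𝓡 n) y) :
    vderiv (fun _ => c) y v = 0 := by
  rw [vderiv_eq_mfderiv, mfderiv_const]
  rfl

lemma covDeriv_congr {X Y : ∀ q : S, TangentSpace (𝓡 4) (ι q)} (h : ∀ᶠ q in 𝓝 p, X q = Y q)
    (v : TangentSpace (𝓡 2) p) : covDeriv g ι X p v = covDeriv g ι Y p v := by
  have h1 : vderiv (n := 2) (fun q => chartMap (ι p) (ι q) (X q)) p =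
      vderiv (fun q => chartMap (ι p) (ι q) (Y q)) p :=
    Filter.EventuallyEq.vderiv_eq (h.mono fun q hq => congrArg (chartMap (ι p) (ι q)) hq)
  rw [covDeriv, covDeriv, coordDeriv_eq, coordDeriv_eq, h1, h.self_of_nhds]

lemma normalDeriv_congr {X Y : ∀ q : S, TangentSpace (𝓡 4) (ι q)} (h : ∀ᶠ q in 𝓝 p, X q = Y q)
    (v : TangentSpace (𝓡 2) p) : normalDeriv g ι X p v = normalDeriv g ι Y p v := by
  rw [normalDeriv, normalDeriv, covDeriv_congr g h]

variable [IsManifold (𝓡 2) 2 S] (oS : ManifoldOrientation 2 S)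
  (hι : IsSpacelikeEmbedding g ι)
include hι

omit [IsManifold (𝓡 2) 2 S] in
lemma isNormalVector_normalDeriv (X : ∀ q : S, TangentSpace (𝓡 4) (ι q)) (v : TangentSpace (𝓡 2) p) :
    IsNormalVector g ι p (normalDeriv g ι X p v) := isNormalVector_normalPart g hι _

/-- The normal connection is compatible with the metric. -/
lemma vderiv_form_normal {X Y : ∀ q : S, TangentSpace (𝓡 4) (ι q)} (hX : ContMDiffAlong 2 ι 1 X p)
    (hY : ContMDiffAlong 2 ι 1 Y p) (hXn : IsNormalVector g ι p (X p))
    (hYn : IsNormalVector g ι p (Y p)) (v : TangentSpace (𝓡 2) p) :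
    vderiv (fun q => g.form (ι q) (X q) (Y q)) p v =
      g.form (ι p) (normalDeriv g ι X p v) (Y p) + g.form (ι p) (X p) (normalDeriv g ι Y p v) := by
  rw [vderiv_form g (hι.contMDiffAt_one g p) hX hY, normalDeriv, form_normalPart_of_normal g hYn,
    g.form_symm _ (X p) (normalDeriv g ι Y p v), normalDeriv, form_normalPart_of_normal g hXn,
    g.form_symm _ (X p)]

/-- The Hodge dual is parallel for the normal connection. Since it is antisymmetric and an
involution, its covariant derivative is determined by its values on one timelike field, where it
vanishes by antisymmetry. -/
lemma normalDeriv_normalDual {W : ∀ q : S, TangentSpace (𝓡 4) (ι q)} (hW : ContMDiffAlong 2 ι 1 W p)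
    (hWn : ∀ᶠ q in 𝓝 p, IsNormalVector g ι q (W q)) (v : TangentSpace (𝓡 2) p) :
    normalDeriv g ι (fun q => normalDual g oV ι oS q (W q)) p v = normalDual g oV ι oS p (normalDeriv g ι W p v) := by
  -- the defect of parallelism, paired with a normal vector
  set δ : (∀ q : S, TangentSpace (𝓡 4) (ι q)) → TangentSpace (𝓡 4) (ι p) → ℝ := fun X Z =>
    g.form (ι p) (normalDeriv g ι (fun q => normalDual g oV ι oS q (X q)) p v) Z -
      g.form (ι p) (normalDual g oV ι oS p (normalDeriv g ι X p v)) Z with hδ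
  have hJn : ∀ (X : ∀ q : S, TangentSpace (𝓡 4) (ι q)), ∀ᶠ q in 𝓝 p,
      IsNormalVector g ι q (normalDual g oV ι oS q (X q)) := fun X =>
    Filter.Eventually.of_forall fun q => isNormalVector_normalDual g oV oS _
  have anti : ∀ X Y : ∀ q : S, TangentSpace (𝓡 4) (ι q), ContMDiffAlong 2 ι 1 X p →
      ContMDiffAlong 2 ι 1 Y p → (∀ᶠ q in 𝓝 p, IsNormalVector g ι q (X q)) →
      (∀ᶠ q in 𝓝 p, IsNormalVector g ι q (Y q)) → δ X (Y p) = -δ Y (X p) := by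
    intro X Y hX hY hXn hYn
    have a1 := vderiv_form_normal g hι (hX.normalDual g oV oS hι le_rfl) hY
      (hJn X).self_of_nhds hYn.self_of_nhds v
    have a2 := vderiv_form_normal g hι hX (hY.normalDual g oV oS hι le_rfl)
      hXn.self_of_nhds (hJn Y).self_of_nhds v
    have a3 : vderiv (fun q => g.form (ι q) (normalDual g oV ι oS q (X q)) (Y q)) p v =
        -vderiv (fun q => g.form (ι q) (X q) (normalDual g oV ι oS q (Y q))) p v := by
      rw [← vderiv_neg]
      simp_rw [form_normalDual_antisymm]
    simp only [hδ]
    rw [form_normalDual_antisymm, form_normalDual_antisymm, g.form_symm _ (normalDeriv g ι Y p v),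
      g.form_symm _ _ (X p)]
    linarith
  have swap : ∀ X Y : ∀ q : S, TangentSpace (𝓡 4) (ι q),
      (∀ᶠ q in 𝓝 p, IsNormalVector g ι q (X q)) → IsNormalVector g ι p (Y p) →
      δ (fun q => normalDual g oV ι oS q (X q)) (Y p) = δ X (normalDual g oV ι oS p (Y p)) := by
    intro X Y hXn hYn
    have a1 := normalDeriv_congr g (p := p) (X := fun q => normalDual g oV ι oS q (normalDual g oV ι oS q (X q))) (Y := X)
      (hXn.mono fun q hq => normalDual_normalDual g oV oS hι hq) v
    simp only [hδ]
    rw [a1, form_normalDual_antisymm, form_normalDual_normalDual g oV oS hι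
      (isNormalVector_normalDeriv g hι _ _) hYn]
    ring
  obtain ⟨w, hwn, hw⟩ := exists_timelike_normal g hι p
  obtain ⟨T, hT, hTn, hTw⟩ := exists_normal_extension g hι hwn
  rw [← hTw] at hw
  have hTn' : ∀ᶠ q in 𝓝 p, IsNormalVector g ι q (T q) := Filter.Eventually.of_forall hTn
  have hJT := hT.normalDual g oV oS hι le_rfl
  have span : ∀ X : ∀ q : S, TangentSpace (𝓡 4) (ι q), δ X (T p) = 0 → δ X (normalDual g oV ι oS p (T p)) = 0 →
      ∀ Z, IsNormalVector g ι p Z → δ X Z = 0 := by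
    intro X h1 h2 Z hZ
    have h3 : g.form (ι p) (T p) (T p) * δ X Z = g.form (ι p) (T p) Z * δ X (T p) -
        g.form (ι p) (normalDual g oV ι oS p (T p)) Z * δ X (normalDual g oV ι oS p (T p)) := by
      simp only [hδ]
      rw [mul_sub, ← g.form_smul_right, ← g.form_smul_right,
        normal_decomp g oV oS hι (hTn p) hZ]
      simp only [g.form_sub_right, g.form_smul_right]
      ring
    rw [h1, h2, mul_zero, mul_zero, sub_zero] at h3
    exact (mul_eq_zero.1 h3).resolve_left hw.ne
  have hT0 : ∀ Z, IsNormalVector g ι p Z → δ T Z = 0 := by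
    refine span T ?_ ?_
    · linarith [anti T T hT hT hTn' hTn']
    · have h1 := anti T _ hT hJT hTn' (hJn T)
      have h2 := swap T T hTn' (hTn p)
      linarith
  have hW0 : ∀ Z, IsNormalVector g ι p Z → δ W Z = 0 := by
    refine span W ?_ ?_
    · rw [anti W T hW hT hWn hTn', hT0 _ hWn.self_of_nhds, neg_zero]
    · rw [← swap W T hWn (hTn p), anti _ T (hW.normalDual g oV oS hι le_rfl) hT (hJn W) hTn',
        hT0 _ (hJn W).self_of_nhds, neg_zero]
  exact IsNormalVector.ext g hι (isNormalVector_normalDeriv g hι _ _)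
    (isNormalVector_normalDual g oV oS _) fun Z hZ => sub_eq_zero.1 (hW0 Z hZ)

end ParallelDual

/-! ### Mean curvature and normal Laplacian paired with a normal field -/

section Pairings

variable {V : Type*} [TopologicalSpace V] [ChartedSpace (EuclideanSpace ℝ (Fin 4)) V]
  [IsManifold (𝓡 4) ∞ V] (g : LorentzMetric V)
  {S : Type*} [TopologicalSpace S] [ChartedSpace (EuclideanSpace ℝ (Fin 2)) S]
  [IsManifold (𝓡 2) 2 S] {ι : S → V} {p : S}

/-- The divergence `h^{AB} (D_A c)_B` of a field of linear forms `c` on the surface. -/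
def surfaceDiv (ι : S → V) (c : ∀ q : S, TangentSpace (𝓡 2) q →ₗ[ℝ] ℝ) (p : S) : ℝ :=
  ∑ A, ∑ B, invInduced g ι p A B *
    (vderiv (fun q => c q (coordField p B q)) p (tangentBasis p A) -
      c p (∑ C, christoffel (inducedMetric g ι) p C A B • tangentBasis p C))

/-- The linear form `v ↦ T · ∇^⊥_v X`. -/
def normalDerivForm (ι : S → V) (T X : ∀ q : S, TangentSpace (𝓡 4) (ι q)) (p : S) :
    TangentSpace (𝓡 2) p →ₗ[ℝ] ℝ :=
  g.bilin (ι p) (T p) ∘ₗ normalDerivLin g ι X p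

omit [IsManifold (𝓡 2) 2 S] in
lemma normalDerivForm_apply (T X : ∀ q : S, TangentSpace (𝓡 4) (ι q)) (v : TangentSpace (𝓡 2) p) :
    normalDerivForm g ι T X p v = g.form (ι p) (T p) (normalDeriv g ι X p v) := rfl

variable (hι : IsSpacelikeEmbedding g ι)
include hι

lemma contMDiffAlong_normalDeriv {k j : WithTop ℕ∞} (hkj : k + 1 ≤ j) (hj : j ≤ 2) (hk : k ≤ 1)
    [ContMDiffVectorBundle k (EuclideanSpace ℝ (Fin 4)) (TangentSpace (𝓡 4) : V → Type _) (𝓡 4)]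
    [ContMDiffVectorBundle j (EuclideanSpace ℝ (Fin 4)) (TangentSpace (𝓡 4) : V → Type _) (𝓡 4)]
    [ContMDiffVectorBundle k (EuclideanSpace ℝ (Fin 2)) (TangentSpace (𝓡 2) : S → Type _) (𝓡 2)]
    [IsManifold (𝓡 2) j S] [IsManifold (𝓡 2) k S] [IsManifold (𝓡 4) j V] [IsManifold (𝓡 4) k V]
    {X : ∀ q : S, TangentSpace (𝓡 4) (ι q)} {x₀ : S} (hp : p ∈ (extChartAt (𝓡 2) x₀).source)
    (hX : ContMDiffAlong 2 ι j X p) (A : Fin 2) :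
    ContMDiffAlong 2 ι k (fun q => normalDeriv g ι X q (coordField x₀ A q)) p := by
  refine ContMDiffAlong.normalPart g hι hk (ContMDiffAlong.covDeriv g hkj ?_ ?_
    (hι.contMDiff.contMDiffAt.of_le hj) hX (contMDiffAt_coordField hp A))
  · rintro rfl; exact absurd hj (by decide)
  · exact (hkj.trans hj).trans (by decide)

/-- The scalar product of the mean curvature vector with a normal field. -/
lemma form_meanCurvature {T : ∀ q : S, TangentSpace (𝓡 4) (ι q)} (hT : ContMDiffAlong 2 ι 1 T p)
    (hTn : ∀ᶠ q in 𝓝 p, IsNormalVector g ι q (T q)) :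
    g.form (ι p) (T p) (meanCurvature g ι p) = surfaceTrace g ι p fun v w =>
      g.form (ι p) (covDeriv g ι T p v) (mfderiv (𝓡 2) (𝓡 4) ι p w) := by
  have hp := mem_extChartAt_source (I := 𝓡 2) p
  rw [meanCurvature, g.form_sum_right, surfaceTrace]
  refine Finset.sum_congr rfl fun A _ => ?_
  rw [g.form_sum_right]
  refine Finset.sum_congr rfl fun B _ => ?_
  rw [g.form_smul_right, secondFundamental, g.form_neg_right, g.form_symm,
    form_normalPart_of_normal g hTn.self_of_nhds]
  congr 1
  have h1 := vderiv_form g (hι.contMDiffAt_one g p) hT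
    (contMDiffAlong_mfderiv_coordField hι.contMDiff hp B) (tangentBasis p A)
  have h2 : vderiv (n := 2) (fun q => g.form (ι q) (T q) (mfderiv (𝓡 2) (𝓡 4) ι q (coordField p B q))) p =
      vderiv (n := 2) (fun _ => (0 : ℝ)) p :=
    Filter.EventuallyEq.vderiv_eq (hTn.mono fun q hq => hq _)
  rw [h2, vderiv_const, coordField_self, g.form_symm _ (T p)] at h1
  linarith

/-- The scalar product of the normal Laplacian with a normal field, up to a divergence. -/
lemma form_normalLaplacian {T X : ∀ q : S, TangentSpace (𝓡 4) (ι q)} (hT : ContMDiffAlong 2 ι 1 T p)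
    (hTn : IsNormalVector g ι p (T p)) (hX : ContMDiffAlong 2 ι 2 X p) :
    g.form (ι p) (T p) (normalLaplacian g ι X p) = surfaceDiv g ι (normalDerivForm g ι T X) p -
      surfaceTrace g ι p fun v w =>
        g.form (ι p) (normalDeriv g ι T p v) (normalDeriv g ι X p w) := by
  have hp := mem_extChartAt_source (I := 𝓡 2) p
  rw [normalLaplacian, g.form_sum_right, surfaceTrace, surfaceDiv, ← Finset.sum_sub_distrib]
  refine Finset.sum_congr rfl fun A _ => ?_
  rw [g.form_sum_right, ← Finset.sum_sub_distrib]
  refine Finset.sum_congr rfl fun B _ => ?_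
  rw [g.form_smul_right, g.form_sub_right, ← mul_sub]
  congr 1
  have h1 := vderiv_form_normal g hι hT
    (contMDiffAlong_normalDeriv g hι (k := 1) (j := 2) (by norm_num) le_rfl le_rfl hp hX B) hTn
    (isNormalVector_normalDeriv g hι _ _) (tangentBasis p A)
  rw [coordField_self] at h1
  simp only [normalDerivForm_apply]
  linarith

end Pairings

/-! ### The divergence in a fixed chart -/

section DivergenceInCharts

variable {V : Type*} [TopologicalSpace V] [ChartedSpace (EuclideanSpace ℝ (Fin 4)) V]
  [IsManifold (𝓡 4) ∞ V] (g : LorentzMetric V)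
  {S : Type*} [TopologicalSpace S] [ChartedSpace (EuclideanSpace ℝ (Fin 2)) S]
  [IsManifold (𝓡 2) 2 S] {ι : S → V} {x₀ p : S}
  (c : ∀ q : S, TangentSpace (𝓡 2) q →ₗ[ℝ] ℝ)

/-- The field of linear forms `c`, written in the chart at `x₀`. -/
def chartCovector (x₀ : S) (z : EuclideanSpace ℝ (Fin 2)) : EuclideanSpace ℝ (Fin 2) →L[ℝ] ℝ :=
  ∑ B, c ((extChartAt (𝓡 2) x₀).symm z) (coordField x₀ B ((extChartAt (𝓡 2) x₀).symm z)) •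
    (EuclideanSpace.proj (𝕜 := ℝ) B : EuclideanSpace ℝ (Fin 2) →L[ℝ] ℝ)

variable {c}

lemma chartCovector_apply (hp : p ∈ (extChartAt (𝓡 2) x₀).source) (u : EuclideanSpace ℝ (Fin 2)) :
    chartCovector c x₀ (extChartAt (𝓡 2) x₀ p) u = c p (chartInv x₀ p u) := by
  have h : (extChartAt (𝓡 2) x₀).symm (extChartAt (𝓡 2) x₀ p) = p := (extChartAt _ x₀).left_inv hp
  rw [chartCovector, h]
  conv_rhs => rw [eq_sum_coordField hp (chartInv x₀ p u)]
  simp only [map_sum, map_smul, sum_apply, smul_apply, smul_eq_mul, chartMap_chartInv hp]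
  exact Finset.sum_congr rfl fun B _ => mul_comm _ _

lemma chartCovector_basis (z : EuclideanSpace ℝ (Fin 2)) (B : Fin 2) :
    chartCovector c x₀ z (EuclideanSpace.basisFun (Fin 2) ℝ B) =
      c ((extChartAt (𝓡 2) x₀).symm z) (coordField x₀ B ((extChartAt (𝓡 2) x₀).symm z)) := by
  rw [chartCovector]
  fin_cases B <;> simp

lemma contDiffAt_chartCovector (hp : p ∈ (extChartAt (𝓡 2) x₀).source)
    (hc : ∀ B, ContMDiffAt (𝓡 2) 𝓘(ℝ, ℝ) 1 (fun q => c q (coordField x₀ B q)) p) :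
    ContDiffAt ℝ 1 (chartCovector c x₀) (extChartAt (𝓡 2) x₀ p) :=
  ContDiffAt.sum fun B _ =>
    ((contMDiffAt_iff_contDiffAt_chart hp).1 (hc B)).continuousLinearMap_comp
      ((1 : ℝ →L[ℝ] ℝ).smulRight _)

lemma chartCovector_eventuallyEq (hp : p ∈ (extChartAt (𝓡 2) x₀).source) :
    chartCovector c p =ᶠ[𝓝 (extChartAt (𝓡 2) p p)] fun z =>
      (chartCovector c x₀ (extChartAt (𝓡 2) x₀ ((extChartAt (𝓡 2) p).symm z))).comp
        (tangentCoordChange (𝓡 2) p x₀ ((extChartAt (𝓡 2) p).symm z)) := by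
  have h1 := mem_extChartAt_source (I := 𝓡 2) p
  have hc : ContinuousAt (extChartAt (𝓡 2) p).symm (extChartAt (𝓡 2) p p) :=
    continuousAt_extChartAt_symm' h1
  have e : (extChartAt (𝓡 2) p).symm (extChartAt (𝓡 2) p p) = p := (extChartAt _ p).left_inv h1
  have n0 := hc.preimage_mem_nhds (by rw [e]; exact extChartAt_source_mem_nhds' hp)
  have n1 := hc.preimage_mem_nhds (by rw [e]; exact extChartAt_source_mem_nhds' h1)
  filter_upwards [n0, n1, extChartAt_target_mem_nhds (I := 𝓡 2) p] with z hz0 hz1 hz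
  ext u
  have hz' : extChartAt (𝓡 2) p ((extChartAt (𝓡 2) p).symm z) = z := (extChartAt _ p).right_inv hz
  conv_lhs => rw [← hz']
  rw [ContinuousLinearMap.comp_apply, chartCovector_apply hz0, chartCovector_apply hz1,
    chartInv_tangentCoordChange hz0 hz1]

variable (c) in
/-- The flux `√(det h) h^{AB} c_B` of the field of linear forms `c`, in the chart at `x₀`. -/
def chartFlux (ι : S → V) (x₀ : S) (A : Fin 2) (z : EuclideanSpace ℝ (Fin 2)) : ℝ :=
  √(chartMatrix (inducedMetric g ι) x₀ ((extChartAt (𝓡 2) x₀).symm z)).det *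
    ∑ B, (chartMatrix (inducedMetric g ι) x₀ ((extChartAt (𝓡 2) x₀).symm z))⁻¹ A B *
      c ((extChartAt (𝓡 2) x₀).symm z) (coordField x₀ B ((extChartAt (𝓡 2) x₀).symm z))

variable (hι : IsSpacelikeEmbedding g ι)
include hι

lemma differentiableAt_chartForm_inducedForm (hp : p ∈ (extChartAt (𝓡 2) x₀).source) :
    DifferentiableAt ℝ (chartForm (inducedForm g ι) x₀) (extChartAt (𝓡 2) x₀ p) :=
  ((contMDiffForm_inducedForm g hι.contMDiff).contDiffAt_chartForm hp).differentiableAt (by simp)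

/-- The divergence is the trace of a tensor which may be computed in any chart. -/
lemma surfaceDiv_eq_chart (hp : p ∈ (extChartAt (𝓡 2) x₀).source)
    (hc : ∀ B, ContMDiffAt (𝓡 2) 𝓘(ℝ, ℝ) 1 (fun q => c q (coordField x₀ B q)) p) :
    surfaceDiv g ι c p = ∑ A, ∑ B, (chartMatrix (inducedMetric g ι) x₀ p)⁻¹ A B *
      (fderiv ℝ (chartCovector c x₀) (extChartAt (𝓡 2) x₀ p) (EuclideanSpace.basisFun (Fin 2) ℝ A)
          (EuclideanSpace.basisFun (Fin 2) ℝ B) -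
        ∑ D, (∑ C, c p (coordField x₀ C p) * (chartMatrix (inducedMetric g ι) x₀ p)⁻¹ C D) *
          koszul (chartFormDeriv (inducedForm g ι) x₀ p) (EuclideanSpace.basisFun (Fin 2) ℝ A)
            (EuclideanSpace.basisFun (Fin 2) ℝ B) (EuclideanSpace.basisFun (Fin 2) ℝ D)) := by
  set ε := EuclideanSpace.basisFun (Fin 2) ℝ with hε
  have h1 := mem_extChartAt_source (I := 𝓡 2) p
  have e : (extChartAt (𝓡 2) p).symm (extChartAt (𝓡 2) p p) = p := (extChartAt _ p).left_inv h1
  -- the tangent vector that represents the linear form at `p`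
  set W : TangentSpace (𝓡 2) p := ∑ A, ∑ B, (invInduced g ι p A B * c p (tangentBasis p A)) •
    tangentBasis p B with hW
  have hWc : ∀ v, inducedForm g ι p W v = c p v := by
    intro v
    have h2 : (inducedForm g ι p W).toLinearMap = c p := (tangentBasis (n := 2) p).ext fun C => by
      rw [hW]
      exact inducedForm_raise g hι (fun A => c p (tangentBasis p A)) C
    exact congrArg (fun f => f v) h2
  have hWx : chartMap x₀ p W = ∑ D, (∑ C, c p (coordField x₀ C p) *
      (chartMatrix (inducedMetric g ι) x₀ p)⁻¹ C D) • ε D := by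
    conv_lhs => rw [← ε.sum_repr (chartMap x₀ p W)]
    refine Finset.sum_congr rfl fun D _ => ?_
    congr 1
    have := chartMap_eq_sum_inv (β := inducedForm g ι) hp
      (det_chartMatrix_inducedMetric_pos g hι hp).ne' W D
    simp only [hWc] at this
    rw [hε, EuclideanSpace.basisFun_repr]
    exact this
  have hL0 := ((contDiffAt_chartCovector hp hc).differentiableAt (by simp)).hasFDerivAt
  set L' := fderiv ℝ (chartCovector c x₀) (extChartAt (𝓡 2) x₀ p) with hL'
  have hL1 : HasFDerivAt (chartCovector c x₀)
      L' ((extChartAt (𝓡 2) x₀ ∘ (extChartAt (𝓡 2) p).symm) (extChartAt (𝓡 2) p p)) := by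
    rw [Function.comp_apply, e]; exact hL0
  have hL2 := HasFDerivAt.comp (G := EuclideanSpace ℝ (Fin 2) →L[ℝ] ℝ) _ hL1
    (chartTransition_hasFDerivAt hp h1)
  have hL3 := (hL2.clm_comp (tangentCoordChange_hasFDerivAt hp h1)).congr_of_eventuallyEq
    (chartCovector_eventuallyEq (c := c) hp)
  -- the covariant derivative of `c`, as a bilinear form
  let K : TangentSpace (𝓡 2) p →ₗ[ℝ] TangentSpace (𝓡 2) p →ₗ[ℝ] ℝ := LinearMap.mk₂ ℝ
    (fun v w => L' (chartMap x₀ p v) (chartMap x₀ p w) -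
      koszul (chartFormDeriv (inducedForm g ι) x₀ p) (chartMap x₀ p v) (chartMap x₀ p w)
        (chartMap x₀ p W))
    (by intros; simp only [koszul, map_add, add_apply]; ring)
    (by intros; simp only [koszul, map_smul, smul_apply, smul_eq_mul]; ring)
    (by intros; simp only [koszul, map_add, add_apply]; ring)
    (by intros; simp only [koszul, map_smul, smul_apply, smul_eq_mul]; ring)
  have hK : surfaceDiv g ι c p = surfaceTrace g ι p fun v w => K v w := by
    rw [surfaceDiv, surfaceTrace]
    refine Finset.sum_congr rfl fun A _ => Finset.sum_congr rfl fun B _ => ?_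
    congr 1
    have k1 : c p (∑ C, christoffel (inducedMetric g ι) p C A B • tangentBasis p C) =
        koszul (chartFormDeriv (inducedForm g ι) x₀ p) (chartMap x₀ p (tangentBasis p A))
          (chartMap x₀ p (tangentBasis p B)) (chartMap x₀ p W) +
        c p (chartInv x₀ p (chartHessian x₀ p p (ε A) (ε B))) := by
      rw [← hWc, ← hWc, inducedForm_symm]
      have k2 := form_christoffel (β := inducedForm g ι) (inducedForm_symm g)
        (hι.det_metricMatrix_pos g p).ne' (differentiableAt_chartForm_inducedForm g hι h1) A B W
      have k3 := koszul_chartFormDeriv (inducedForm g ι) (inducedForm_symm g) hp h1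
        (differentiableAt_chartForm_inducedForm g hι hp) (ε A) (ε B) (chartMap p p W)
      rw [k3, tangentCoordChange_chartMap hp h1, chartForm_apply _ hp, chartInv_chartMap hp,
        ← chartMap_tangentBasis p A, ← chartMap_tangentBasis p B,
        tangentCoordChange_chartMap hp h1, tangentCoordChange_chartMap hp h1,
        chartMap_tangentBasis, chartMap_tangentBasis] at k2
      rw [inducedForm_symm g p W]
      exact k2
    have k4 : vderiv (fun q => c q (coordField p B q)) p (tangentBasis p A) =
        L' (chartMap x₀ p (tangentBasis p A)) (chartMap x₀ p (tangentBasis p B)) +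
        c p (chartInv x₀ p (chartHessian x₀ p p (ε A) (ε B))) := by
      have m1 := hL3.clm_apply (hasFDerivAt_const (ε B) _)
      simp only [hε, chartCovector_basis] at m1
      rw [HasFDerivAt.vderiv_apply (f := fun q => c q (coordField p B q)) m1]
      simp only [Function.comp_apply, e, add_apply, ContinuousLinearMap.comp_apply,
        ContinuousLinearMap.flip_apply, ContinuousLinearMap.comp_zero, zero_add,
        ContinuousLinearMap.compL_apply]
      rw [← chartMap_tangentBasis p B, tangentCoordChange_chartMap hp h1,
        tangentCoordChange_chartMap hp h1, chartCovector_apply hp, chartMap_tangentBasis]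
      exact add_comm _ _
    rw [k1, k4]
    change _ = L' _ _ - koszul _ _ _ _
    ring
  rw [hK, surfaceTrace_eq_chart g hp K]
  refine Finset.sum_congr rfl fun A _ => Finset.sum_congr rfl fun B _ => ?_
  congr 1
  change L' _ _ - koszul _ _ _ _ = _
  rw [coordField_eq hp, coordField_eq hp, chartMap_chartInv hp, chartMap_chartInv hp, hWx,
    koszul_sum_right]

lemma contDiffAt_chartFlux (hp : p ∈ (extChartAt (𝓡 2) x₀).source)
    (hc : ∀ B, ContMDiffAt (𝓡 2) 𝓘(ℝ, ℝ) 1 (fun q => c q (coordField x₀ B q)) p) (A : Fin 2) :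
    ContDiffAt ℝ 1 (chartFlux g c ι x₀ A) (extChartAt (𝓡 2) x₀ p) := by
  have hm := contMDiffForm_inducedForm g hι.contMDiff x₀ p hp
  have hd := det_chartMatrix_inducedMetric_pos g hι hp
  refine (contMDiffAt_iff_contDiffAt_chart (f := fun q =>
    √(chartMatrix (inducedMetric g ι) x₀ q).det *
    ∑ B, (chartMatrix (inducedMetric g ι) x₀ q)⁻¹ A B * c q (coordField x₀ B q)) hp).1 ?_
  refine ContMDiffAt.mul ?_ (ContMDiffAt.sum fun B _ => (ContMDiffAt.matrix_inv hm hd.ne' A B).mul (hc B))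
  exact (Real.contDiffAt_sqrt hd.ne').contMDiffAt.comp p (ContMDiffAt.matrix_det hm)

omit hι [IsManifold (𝓡 2) 2 S] [TopologicalSpace S] [ChartedSpace (EuclideanSpace ℝ (Fin 2)) S]
  [TopologicalSpace V] [ChartedSpace (EuclideanSpace ℝ (Fin 4)) V] [IsManifold (𝓡 4) ∞ V] in
lemma HasFDerivAt.inv_sqrt_mul {E : Type*} [NormedAddCommGroup E] [NormedSpace ℝ E] {D N : E → ℝ}
    {D' N' : E →L[ℝ] ℝ} {z : E} (hD : HasFDerivAt D D' z) (hN : HasFDerivAt N N' z) (h0 : 0 < D z) :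
    ∃ L : E →L[ℝ] ℝ, HasFDerivAt (fun z => (√(D z))⁻¹ * N z) L z ∧
      ∀ w, L w = (√(D z))⁻¹ * N' w - N z * D' w / (2 * √(D z) ^ 3) := by
  have hr : √(D z) ≠ 0 := (Real.sqrt_pos.2 h0).ne'
  have h1 := (hasDerivAt_inv hr).comp_hasFDerivAt z (hD.sqrt h0.ne')
  refine ⟨_, h1.mul hN, fun w => ?_⟩
  simp only [add_apply, smul_apply, smul_eq_mul, Function.comp_apply]
  field_simp
  ring

/-- The coordinate formula for the divergence. -/
lemma surfaceDiv_eq_chartFlux (hp : p ∈ (extChartAt (𝓡 2) x₀).source)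
    (hc : ∀ B, ContMDiffAt (𝓡 2) 𝓘(ℝ, ℝ) 1 (fun q => c q (coordField x₀ B q)) p) :
    √(chartMatrix (inducedMetric g ι) x₀ p).det * surfaceDiv g ι c p =
      ∑ A, fderiv ℝ (chartFlux g c ι x₀ A) (extChartAt (𝓡 2) x₀ p)
        (EuclideanSpace.basisFun (Fin 2) ℝ A) := by
  set ε := EuclideanSpace.basisFun (Fin 2) ℝ with hε
  have e : (extChartAt (𝓡 2) x₀).symm (extChartAt (𝓡 2) x₀ p) = p := (extChartAt _ x₀).left_inv hp
  set z₀ := extChartAt (𝓡 2) x₀ p with hz₀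
  have hd := det_chartMatrix_inducedMetric_pos g hι hp
  -- the components of the metric and of the form, as functions of the coordinates
  set H : Fin 2 → Fin 2 → EuclideanSpace ℝ (Fin 2) → ℝ := fun i j z =>
    chartForm (inducedForm g ι) x₀ z (ε i) (ε j) with hH
  set u : Fin 2 → EuclideanSpace ℝ (Fin 2) → ℝ := fun B z => chartCovector c x₀ z (ε B) with hu
  set G' := chartFormDeriv (inducedForm g ι) x₀ p with hG'
  set L' := fderiv ℝ (chartCovector c x₀) z₀ with hL'
  have hHs : ∀ z, H 1 0 z = H 0 1 z := fun z => by
    simp only [hH, chartForm_eq]; exact inducedForm_symm g _ _ _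
  have hHd : ∀ i j, HasFDerivAt (H i j) ((G'.flip (ε i)).flip (ε j)) z₀ := by
    intro i j
    have := ((differentiableAt_chartForm_inducedForm g hι hp).hasFDerivAt.clm_apply
      (hasFDerivAt_const (ε i) z₀)).clm_apply (hasFDerivAt_const (ε j) z₀)
    refine this.congr_fderiv ?_
    ext w
    simp only [ContinuousLinearMap.flip_apply, ContinuousLinearMap.comp_zero, zero_add]
    rfl
  have hG's : ∀ w, G' w (ε 1) (ε 0) = G' w (ε 0) (ε 1) := by
    intro w
    have h1 := hHd 1 0
    rw [show H 1 0 = H 0 1 from funext hHs] at h1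
    exact congrArg (fun L => L w) (h1.unique (hHd 0 1))
  have hud : ∀ B, HasFDerivAt (u B) (L'.flip (ε B)) z₀ := by
    intro B
    have := ((contDiffAt_chartCovector hp hc).differentiableAt (by simp)).hasFDerivAt.clm_apply
      (hasFDerivAt_const (ε B) z₀)
    refine this.congr_fderiv ?_
    ext w
    simp only [ContinuousLinearMap.flip_apply, ContinuousLinearMap.comp_zero, zero_add]
    rfl
  have hM : ∀ i j, chartMatrix (inducedMetric g ι) x₀ p i j = H i j z₀ := fun i j =>
    chartMatrix_eq (inducedForm g ι) hp i j
  have hcp : ∀ B, c p (coordField x₀ B p) = u B z₀ := by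
    intro B
    rw [hu]
    simp only [hε, chartCovector_basis]
    rw [e]
  set D : EuclideanSpace ℝ (Fin 2) → ℝ := fun z => H 0 0 z * H 1 1 z - H 0 1 z * H 0 1 z with hD
  have hDp : (chartMatrix (inducedMetric g ι) x₀ p).det = D z₀ := by
    rw [Matrix.det_fin_two, hM, hM, hM, hM, hHs]
  have hD0 : 0 < D z₀ := hDp ▸ hd
  have hDd := ((hHd 0 0).mul (hHd 1 1)).sub ((hHd 0 1).mul (hHd 0 1))
  have hr0 : √(D z₀) ≠ 0 := (Real.sqrt_pos.2 hD0).ne'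
  have hrs : √(D z₀) ^ 2 = D z₀ := Real.sq_sqrt hD0.le
  -- the flux in terms of the components
  have hflux : ∀ A, chartFlux g c ι x₀ A =ᶠ[𝓝 z₀] fun z => (√(D z))⁻¹ *
      ![H 1 1 z * u 0 z - H 0 1 z * u 1 z, H 0 0 z * u 1 z - H 0 1 z * u 0 z] A := by
    intro A
    filter_upwards [extChartAt_target_mem_nhds' (I := 𝓡 2) ((extChartAt (𝓡 2) x₀).map_source hp)]
      with z hz
    have hz' := (extChartAt (𝓡 2) x₀).map_target hz
    have hMz : ∀ i j, chartMatrix (inducedMetric g ι) x₀ ((extChartAt (𝓡 2) x₀).symm z) i j =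
        H i j z := fun i j => by
      rw [hH]; beta_reduce
      conv_rhs => rw [← (extChartAt (𝓡 2) x₀).right_inv hz]
      exact chartMatrix_eq (inducedForm g ι) hz' i j
    have hdz := det_chartMatrix_inducedMetric_pos g hι hz'
    have hDz : (chartMatrix (inducedMetric g ι) x₀ ((extChartAt (𝓡 2) x₀).symm z)).det = D z := by
      rw [Matrix.det_fin_two, hMz, hMz, hMz, hMz, hHs]
    rw [hDz] at hdz
    have hs : √(D z) ≠ 0 := (Real.sqrt_pos.2 hdz).ne'
    have hs2 : √(D z) ^ 2 = D z := Real.sq_sqrt hdz.le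
    rw [chartFlux, hDz, Matrix.inv_def, hDz, Ring.inverse_eq_inv', Matrix.adjugate_fin_two]
    simp only [Fin.sum_univ_two, Matrix.smul_apply, smul_eq_mul, hMz, hHs,
      ← chartCovector_basis (c := c)]
    rw [← hε, ← hs2]
    fin_cases A
    · simp [hu]
      field_simp
      ring
    · simp [hu]
      field_simp
      ring
  obtain ⟨L₀, hL₀, hL₀'⟩ := HasFDerivAt.inv_sqrt_mul hDd
    (((hHd 1 1).mul (hud 0)).sub ((hHd 0 1).mul (hud 1))) hD0
  obtain ⟨L₁, hL₁, hL₁'⟩ := HasFDerivAt.inv_sqrt_mul hDd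
    (((hHd 0 0).mul (hud 1)).sub ((hHd 0 1).mul (hud 0))) hD0
  have hf0 := (hL₀.congr_of_eventuallyEq (hflux 0)).fderiv
  have hf1 := (hL₁.congr_of_eventuallyEq (hflux 1)).fderiv
  have hr2 : √(D z₀) ^ 2 = H 0 0 z₀ * H 1 1 z₀ - H 0 1 z₀ * H 0 1 z₀ := hrs
  rw [surfaceDiv_eq_chart g hι hp hc, Fin.sum_univ_two (f := fun A => fderiv ℝ _ _ _), hf0, hf1,
    Matrix.inv_def, Ring.inverse_eq_inv', Matrix.adjugate_fin_two, hDp, ← hz₀, ← hL', ← hG', ← hε,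
    hL₀', hL₁']
  change √(D z₀) * _ = (√(D z₀))⁻¹ * _ - _ / (2 * √(D z₀) ^ 3) +
    ((√(D z₀))⁻¹ * _ - _ / (2 * √(D z₀) ^ 3))
  obtain ⟨r, hr⟩ : ∃ r, r = √(D z₀) := ⟨_, rfl⟩
  rw [← hr] at hr0 hr2 hrs ⊢
  rw [← hrs]
  simp only [Fin.sum_univ_two, Matrix.smul_apply, smul_eq_mul, hM, hHs, hcp, add_apply, sub_apply,
    smul_apply, ContinuousLinearMap.flip_apply, hG's, koszul, Pi.sub_apply, Pi.mul_apply,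
    Matrix.of_apply, Matrix.cons_val_zero, Matrix.cons_val_one]
  field_simp
  linear_combination (-2 * (u 0 z₀ * G' (ε 0) (ε 1) (ε 1) - u 1 z₀ * G' (ε 0) (ε 0) (ε 1) +
    u 1 z₀ * G' (ε 1) (ε 0) (ε 0) - u 0 z₀ * G' (ε 1) (ε 0) (ε 1))) * hr2

end DivergenceInCharts

/-! ### The Riemannian measure -/

section RiemannianMeasure

variable {n : ℕ} {M : Type*} [TopologicalSpace M] [ChartedSpace (EuclideanSpace ℝ (Fin n)) M]
  [IsManifold (𝓡 n) 1 M]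
  (β : ∀ x : M, TangentSpace (𝓡 n) x →L[ℝ] TangentSpace (𝓡 n) x →L[ℝ] ℝ) {x₀ x₁ y : M}

/-- Gram determinants in two charts differ by the square of the Jacobian of the transition map. -/
lemma det_chartMatrix_change (h₀ : y ∈ (extChartAt (𝓡 n) x₀).source)
    (h₁ : y ∈ (extChartAt (𝓡 n) x₁).source) :
    (chartMatrix (fun x v w => β x v w) x₁ y).det =
      (tangentCoordChange (𝓡 n) x₁ x₀ y).det ^ 2 *
        (chartMatrix (fun x v w => β x v w) x₀ y).det := by
  rw [chartMatrix_eq_gram β h₁, chartMatrix_eq_gram β h₀, det_gram _ (coordBasis x₀ y h₀)]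
  congr 2
  have h2 : (fun i => EuclideanSpace.equiv (Fin n) ℝ (chartMap x₀ y (coordBasis x₁ y h₁ i))) =
      (fun i => EuclideanSpace.equiv (Fin n) ℝ (tangentCoordChange (𝓡 n) x₁ x₀ y
        (EuclideanSpace.basisFun (Fin n) ℝ i))) := by
    funext i
    rw [coordBasis_apply, coordField_eq h₁, ← tangentCoordChange_chartMap h₀ h₁, chartMap_chartInv h₁]
  have h3 := LinearMap.det_toMatrix (EuclideanSpace.basisFun (Fin n) ℝ).toBasis
    (tangentCoordChange (𝓡 n) x₁ x₀ y).toLinearMap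
  rw [ContinuousLinearMap.det, ← h3, Module.Basis.det_apply]
  congr 1
  ext i j
  rw [Module.Basis.toMatrix_apply, coordBasis_repr, LinearMap.toMatrix_apply]
  have := congrFun (congrFun h2 j) i
  simpa using this

variable [MeasurableSpace M] [BorelSpace M]

omit [IsManifold (𝓡 n) 1 M] in
lemma measurableSet_chart_image {A : Set M} (hA : MeasurableSet A) :
    MeasurableSet (extChartAt (𝓡 n) x₀ '' ((extChartAt (𝓡 n) x₀).source ∩ A)) := by
  rw [PartialEquiv.image_source_inter_eq']
  have h : Measurable ((extChartAt (𝓡 n) x₀).target.domRestrict (extChartAt (𝓡 n) x₀).symm) :=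
    (continuousOn_iff_continuous_domRestrict.1 (continuousOn_extChartAt_symm x₀)).measurable
  have h2 := (isOpen_extChartAt_target (I := 𝓡 n) x₀).measurableSet.subtype_image (h hA)
  convert h2 using 1
  ext z
  simp [and_comm]

omit [IsManifold (𝓡 n) 1 M] in
lemma aemeasurable_chart_symm :
    AEMeasurable (extChartAt (𝓡 n) x₀).symm (volume.restrict (extChartAt (𝓡 n) x₀).target) :=
  (continuousOn_extChartAt_symm x₀).aemeasurable (isOpen_extChartAt_target x₀).measurableSet

variable (b : ∀ x : M, TangentSpace (𝓡 n) x → TangentSpace (𝓡 n) x → ℝ)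

lemma chartVolume_apply {A : Set M} (hA : MeasurableSet A) :
    chartVolume b x₀ A = ∫⁻ z in extChartAt (𝓡 n) x₀ '' ((extChartAt (𝓡 n) x₀).source ∩ A),
      ENNReal.ofReal √((chartMatrix b x₀ ((extChartAt (𝓡 n) x₀).symm z)).det) := by
  rw [chartVolume, Measure.map_apply_of_aemeasurable
    (aemeasurable_chart_symm.mono_ac (withDensity_absolutelyContinuous _ _)) hA,
    withDensity_apply', Measure.restrict_restrict' (isOpen_extChartAt_target x₀).measurableSet,
    PartialEquiv.image_source_inter_eq', Set.inter_comm]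

/-- Two charts define the same measure on the intersection of their domains. -/
lemma chartVolume_eq_chartVolume {A : Set M} (hA : MeasurableSet A)
    (h₀ : A ⊆ (extChartAt (𝓡 n) x₀).source) (h₁ : A ⊆ (extChartAt (𝓡 n) x₁).source) :
    chartVolume (fun x v w => β x v w) x₀ A = chartVolume (fun x v w => β x v w) x₁ A := by
  rw [chartVolume_apply _ hA, chartVolume_apply _ hA]
  have hm := measurableSet_chart_image (n := n) (x₀ := x₁) hA
  rw [Set.inter_eq_self_of_subset_right h₀]
  rw [Set.inter_eq_self_of_subset_right h₁] at hm ⊢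
  have himg : extChartAt (𝓡 n) x₀ '' A = (extChartAt (𝓡 n) x₀ ∘ (extChartAt (𝓡 n) x₁).symm) ''
      (extChartAt (𝓡 n) x₁ '' A) := by
    rw [← Set.image_comp]
    refine Set.image_congr fun q hq => ?_
    rw [Function.comp_apply, Function.comp_apply, (extChartAt (𝓡 n) x₁).left_inv (h₁ hq)]
  rw [himg, lintegral_image_eq_lintegral_abs_det_fderiv_mul volume hm
    (f' := fun z => tangentCoordChange (𝓡 n) x₁ x₀ ((extChartAt (𝓡 n) x₁).symm z))]
  · refine setLIntegral_congr_fun hm ?_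
    rintro z ⟨q, hq, rfl⟩
    beta_reduce
    rw [Function.comp_apply, (extChartAt (𝓡 n) x₁).left_inv (h₁ hq),
      (extChartAt (𝓡 n) x₀).left_inv (h₀ hq), det_chartMatrix_change β (h₀ hq) (h₁ hq),
      Real.sqrt_mul (sq_nonneg _), Real.sqrt_sq_eq_abs, ENNReal.ofReal_mul (abs_nonneg _)]
  · rintro z ⟨q, hq, rfl⟩
    rw [(extChartAt (𝓡 n) x₁).left_inv (h₁ hq)]
    exact (chartTransition_hasFDerivAt (h₀ hq) (h₁ hq)).hasFDerivWithinAt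
  · rintro _ ⟨q, hq, rfl⟩ _ ⟨q', hq', rfl⟩ h
    simp only [Function.comp_apply, (extChartAt (𝓡 n) x₁).left_inv (h₁ hq),
      (extChartAt (𝓡 n) x₁).left_inv (h₁ hq')] at h
    rw [(extChartAt (𝓡 n) x₀).injOn (h₀ hq) (h₀ hq') h]

lemma chartVolume_le {A : Set M} (hA : MeasurableSet A)
    (h₁ : A ⊆ (extChartAt (𝓡 n) x₁).source) :
    chartVolume (fun x v w => β x v w) x₀ A ≤ chartVolume (fun x v w => β x v w) x₁ A := by
  have hs := (isOpen_extChartAt_source (I := 𝓡 n) x₀).measurableSet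
  have h : chartVolume (fun x v w => β x v w) x₀ A =
      chartVolume (fun x v w => β x v w) x₀ ((extChartAt (𝓡 n) x₀).source ∩ A) := by
    rw [chartVolume_apply _ hA, chartVolume_apply _ (hs.inter hA), ← Set.inter_assoc, Set.inter_self]
  rw [h, chartVolume_eq_chartVolume β (hs.inter hA) Set.inter_subset_left
    (Set.inter_subset_right.trans h₁)]
  exact measure_mono Set.inter_subset_right

/-- On the domain of a chart the Riemannian measure has density `√(det b_{ij})`. -/
lemma riemannianVolume_restrict [LindelofSpace M] (x₀ : M) :
    (riemannianVolume fun x v w => β x v w).restrict (extChartAt (𝓡 n) x₀).source =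
      chartVolume (fun x v w => β x v w) x₀ := by
  have hs : ∀ x : M, MeasurableSet (extChartAt (𝓡 n) x).source :=
    fun x => (isOpen_extChartAt_source (I := 𝓡 n) x).measurableSet
  obtain ⟨s, hsc, hsu⟩ := countable_cover_nhds (fun x : M => extChartAt_source_mem_nhds (I := 𝓡 n) x)
  have hne : s.Nonempty := by
    rw [Set.nonempty_iff_ne_empty]
    rintro rfl
    simp only [Set.mem_empty_iff_false, Set.iUnion_of_empty, Set.iUnion_empty] at hsu
    exact Set.notMem_empty x₀ (hsu ▸ Set.mem_univ x₀)
  obtain ⟨f, rfl⟩ := hsc.exists_eq_range hne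
  rw [Set.biUnion_range] at hsu
  set D : ℕ → Set M := disjointed fun i => (extChartAt (𝓡 n) (f i)).source with hD
  have hDm : ∀ i, MeasurableSet (D i) := fun i => MeasurableSet.disjointed (fun i => hs (f i)) i
  have hDu : ⋃ i, D i = Set.univ := by rw [hD, iUnion_disjointed, hsu]
  have hDs : ∀ i, D i ⊆ (extChartAt (𝓡 n) (f i)).source := fun i => disjointed_subset _ i
  have hDd : Pairwise (Function.onFun Disjoint D) := disjoint_disjointed _
  have hsum : ∀ (μ : Measure M) (A : Set M), MeasurableSet A → μ A = ∑' i, μ (A ∩ D i) := by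
    intro μ A hA
    rw [← measure_iUnion (fun i j hij => (hDd hij).mono Set.inter_subset_right
      Set.inter_subset_right) fun i => hA.inter (hDm i), ← Set.inter_iUnion, hDu, Set.inter_univ]
  -- a measure assembled from countably many charts dominates all the measures `chartVolume`
  have hle : riemannianVolume (fun x v w => β x v w) ≤
      Measure.sum fun i => (chartVolume (fun x v w => β x v w) (f i)).restrict (D i) := by
    refine iSup_le fun x => Measure.le_iff.2 fun A hA => ?_
    rw [Measure.sum_apply _ hA, hsum _ A hA]
    refine ENNReal.tsum_le_tsum fun i => ?_
    rw [Measure.restrict_apply hA]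
    exact chartVolume_le β (hA.inter (hDm i)) (Set.inter_subset_right.trans (hDs i))
  refine le_antisymm (Measure.le_iff.2 fun A hA => ?_) ?_
  · rw [Measure.restrict_apply hA]
    refine (hle _).trans ?_
    rw [Measure.sum_apply _ (hA.inter (hs x₀))]
    refine le_trans ?_ (measure_mono (Set.inter_subset_left (s := A) (t := (extChartAt (𝓡 n) x₀).source)))
    rw [hsum (chartVolume _ x₀) _ (hA.inter (hs x₀))]
    refine ENNReal.tsum_le_tsum fun i => ?_
    rw [Measure.restrict_apply (hA.inter (hs x₀))]
    exact chartVolume_le β ((hA.inter (hs x₀)).inter (hDm i))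
      (Set.inter_subset_left.trans Set.inter_subset_right)
  · refine Measure.le_iff.2 fun A hA => ?_
    rw [Measure.restrict_apply hA]
    refine le_trans (le_of_eq ?_) (le_iSup (fun x => chartVolume (fun x v w => β x v w) x) x₀ _)
    rw [chartVolume_apply _ hA, chartVolume_apply _ (hA.inter (hs x₀)), ← Set.inter_assoc,
      Set.inter_right_comm, Set.inter_self]

/-- The Riemannian measure of a metric with continuous components is locally finite. -/
lemma isLocallyFiniteMeasure_riemannianVolume [LindelofSpace M]
    (hβ : ∀ x : M, ContinuousAt (fun z =>
      (chartMatrix (fun x v w => β x v w) x ((extChartAt (𝓡 n) x).symm z)).det) (extChartAt (𝓡 n) x x)) :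
    IsLocallyFiniteMeasure (riemannianVolume fun x v w => β x v w) := by
  refine ⟨fun x => ?_⟩
  set δ : EuclideanSpace ℝ (Fin n) → ℝ := fun z =>
    √(chartMatrix (fun x v w => β x v w) x ((extChartAt (𝓡 n) x).symm z)).det with hδ
  have h1 : ∀ᶠ z in 𝓝 (extChartAt (𝓡 n) x x), δ z < δ (extChartAt (𝓡 n) x x) + 1 :=
    (Real.continuous_sqrt.continuousAt.comp (hβ x)).eventually_lt continuousAt_const (lt_add_one _)
  obtain ⟨r, hr, hr1⟩ := Metric.eventually_nhds_iff_ball.1 h1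
  set U : Set M := (extChartAt (𝓡 n) x).source ∩
    extChartAt (𝓡 n) x ⁻¹' Metric.ball (extChartAt (𝓡 n) x x) r with hU
  have hUo : IsOpen U := (continuousOn_extChartAt x).isOpen_inter_preimage
    (isOpen_extChartAt_source x) Metric.isOpen_ball
  refine ⟨U, hUo.mem_nhds ⟨mem_extChartAt_source x, Metric.mem_ball_self hr⟩, ?_⟩
  have h2 : riemannianVolume (fun x v w => β x v w) U = chartVolume (fun x v w => β x v w) x U := by
    rw [← riemannianVolume_restrict β x, Measure.restrict_apply hUo.measurableSet,
      Set.inter_eq_self_of_subset_left Set.inter_subset_left]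
  rw [h2, chartVolume_apply _ hUo.measurableSet]
  have h3 : extChartAt (𝓡 n) x '' ((extChartAt (𝓡 n) x).source ∩ U) ⊆
      Metric.ball (extChartAt (𝓡 n) x x) r := by
    rintro _ ⟨q, hq, rfl⟩
    exact hq.2.2
  refine (lintegral_mono_set h3).trans_lt ?_
  refine (setLIntegral_mono (g := fun _ => ENNReal.ofReal (δ (extChartAt (𝓡 n) x x) + 1))
    measurable_const fun z hz => ENNReal.ofReal_le_ofReal (hr1 z hz).le).trans_lt ?_
  rw [setLIntegral_const]
  exact ENNReal.mul_lt_top ENNReal.ofReal_lt_top measure_ball_lt_top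

/-- The integral of a function supported in the domain of a chart. -/
lemma integral_riemannianVolume_eq [LindelofSpace M] {f : M → ℝ} (hf : Continuous f)
    (hf0 : ∀ q ∉ (extChartAt (𝓡 n) x₀).source, f q = 0)
    (hβ : ContinuousOn (fun z => (chartMatrix (fun x v w => β x v w) x₀
      ((extChartAt (𝓡 n) x₀).symm z)).det) (extChartAt (𝓡 n) x₀).target) :
    ∫ q, f q ∂(riemannianVolume fun x v w => β x v w) =
      ∫ z in (extChartAt (𝓡 n) x₀).target,
        √(chartMatrix (fun x v w => β x v w) x₀ ((extChartAt (𝓡 n) x₀).symm z)).det *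
          f ((extChartAt (𝓡 n) x₀).symm z) := by
  have ht := (isOpen_extChartAt_target (I := 𝓡 n) x₀).measurableSet
  rw [← setIntegral_eq_integral_of_forall_compl_eq_zero hf0, riemannianVolume_restrict, chartVolume,
    integral_map (aemeasurable_chart_symm.mono_ac (withDensity_absolutelyContinuous _ _))
      hf.aestronglyMeasurable,
    integral_withDensity_eq_integral_toReal_smul₀]
  · refine integral_congr_ae (Eventually.of_forall fun z => ?_)
    beta_reduce
    rw [ENNReal.toReal_ofReal (Real.sqrt_nonneg _), smul_eq_mul]
  · exact ((Real.continuous_sqrt.comp_continuousOn hβ).aemeasurable ht).ennreal_ofReal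
  · exact Eventually.of_forall fun z => ENNReal.ofReal_lt_top

end RiemannianMeasure

/-! ### The divergence theorem -/

section DivergenceTheorem

variable {V : Type*} [TopologicalSpace V] [ChartedSpace (EuclideanSpace ℝ (Fin 4)) V]
  [IsManifold (𝓡 4) ∞ V] (g : LorentzMetric V)
  {S : Type*} [TopologicalSpace S] [ChartedSpace (EuclideanSpace ℝ (Fin 2)) S]
  [IsManifold (𝓡 2) 2 S] {ι : S → V} {x₀ p : S}
  {c : ∀ q : S, TangentSpace (𝓡 2) q →ₗ[ℝ] ℝ}

/-- The field of linear forms `c` is of class `C¹` at `p`: its components in all charts are. -/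
def ContMDiffCovectorAt (c : ∀ q : S, TangentSpace (𝓡 2) q →ₗ[ℝ] ℝ) (p : S) : Prop :=
  ∀ x₀ : S, p ∈ (extChartAt (𝓡 2) x₀).source → ∀ B,
    ContMDiffAt (𝓡 2) 𝓘(ℝ, ℝ) 1 (fun q => c q (coordField x₀ B q)) p

lemma ContMDiffCovectorAt.smul (hc : ContMDiffCovectorAt c p) {χ : S → ℝ}
    (hχ : ContMDiffAt (𝓡 2) 𝓘(ℝ, ℝ) 1 χ p) : ContMDiffCovectorAt (fun q => χ q • c q) p :=
  fun x₀ hp B => hχ.mul (hc x₀ hp B)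

lemma surfaceDiv_congr {c' : ∀ q : S, TangentSpace (𝓡 2) q →ₗ[ℝ] ℝ} (h : ∀ᶠ q in 𝓝 p, c q = c' q) :
    surfaceDiv g ι c p = surfaceDiv g ι c' p := by
  have h1 : ∀ B, vderiv (n := 2) (fun q => c q (coordField p B q)) p =
      vderiv (fun q => c' q (coordField p B q)) p := fun B =>
    Filter.EventuallyEq.vderiv_eq (h.mono fun q hq => congrArg (fun f => f (coordField p B q)) hq)
  simp only [surfaceDiv, h1, h.self_of_nhds]

lemma surfaceDiv_eq_zero (h : ∀ᶠ q in 𝓝 p, c q = 0) : surfaceDiv g ι c p = 0 := by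
  rw [surfaceDiv_congr g h]
  simp [surfaceDiv, vderiv_const]

lemma surfaceDiv_sum {σ : Type*} {s : Finset σ} {c : σ → ∀ q : S, TangentSpace (𝓡 2) q →ₗ[ℝ] ℝ}
    (hc : ∀ i ∈ s, ContMDiffCovectorAt (c i) p) :
    surfaceDiv g ι (fun q => ∑ i ∈ s, c i q) p = ∑ i ∈ s, surfaceDiv g ι (c i) p := by
  have hp := mem_extChartAt_source (I := 𝓡 2) p
  have h1 : ∀ (B : Fin 2) (v : TangentSpace (𝓡 2) p),
      vderiv (fun q => (∑ i ∈ s, c i q) (coordField p B q)) p v =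
        ∑ i ∈ s, vderiv (fun q => c i q (coordField p B q)) p v := by
    intro B v
    have h2 := HasFDerivAt.fun_sum fun i hi =>
      ((hc i hi p hp B).mdifferentiableAt (by simp)).hasFDerivAt_chart hp
    have h3 : HasFDerivAt (fun z => (fun q => (∑ i ∈ s, c i q) (coordField p B q))
        ((extChartAt (𝓡 2) p).symm z)) _ (extChartAt (𝓡 2) p p) :=
      h2.congr_of_eventuallyEq (Eventually.of_forall fun z => LinearMap.sum_apply _ _ _)
    rw [h3.vderiv_apply, sum_apply]
    refine Finset.sum_congr rfl fun i _ => ?_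
    rw [ContinuousLinearMap.comp_apply, chartInv_chartMap hp]
  have h4 : ∀ A B : Fin 2, invInduced g ι p A B *
      (vderiv (fun q => (∑ i ∈ s, c i q) (coordField p B q)) p (tangentBasis p A) -
        (∑ i ∈ s, c i p) (∑ C, christoffel (inducedMetric g ι) p C A B • tangentBasis p C)) =
      ∑ i ∈ s, invInduced g ι p A B * (vderiv (fun q => c i q (coordField p B q)) p (tangentBasis p A) -
        c i p (∑ C, christoffel (inducedMetric g ι) p C A B • tangentBasis p C)) := fun A B => by
    rw [h1, LinearMap.sum_apply, ← Finset.sum_sub_distrib, Finset.mul_sum]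
  simp only [surfaceDiv, h4]
  exact (Finset.sum_congr rfl fun A _ => Finset.sum_comm).trans Finset.sum_comm

variable (hι : IsSpacelikeEmbedding g ι)
include hι

lemma contDiffAt_det_chartMatrix (hp : p ∈ (extChartAt (𝓡 2) x₀).source) :
    ContDiffAt ℝ 1 (fun z => (chartMatrix (inducedMetric g ι) x₀
      ((extChartAt (𝓡 2) x₀).symm z)).det) (extChartAt (𝓡 2) x₀ p) :=
  (contMDiffAt_iff_contDiffAt_chart hp).1
    (ContMDiffAt.matrix_det (contMDiffForm_inducedForm g hι.contMDiff x₀ p hp))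

/-- The divergence of a `C¹` field of linear forms is continuous. -/
lemma continuousAt_surfaceDiv (hp : p ∈ (extChartAt (𝓡 2) x₀).source)
    (hc : ∀ B, ContMDiffAt (𝓡 2) 𝓘(ℝ, ℝ) 1 (fun q => c q (coordField x₀ B q)) p) :
    ContinuousAt (surfaceDiv g ι c) p := by
  have h1 : ContinuousAt (fun q => (√(chartMatrix (inducedMetric g ι) x₀ q).det)⁻¹ *
      ∑ A, fderiv ℝ (chartFlux g c ι x₀ A) (extChartAt (𝓡 2) x₀ q)
        (EuclideanSpace.basisFun (Fin 2) ℝ A)) p := by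
    have hd := det_chartMatrix_inducedMetric_pos g hι hp
    have h2 : ContinuousAt (fun q => (chartMatrix (inducedMetric g ι) x₀ q).det) p :=
      (ContMDiffAt.matrix_det (contMDiffForm_inducedForm g hι.contMDiff x₀ p hp)).continuousAt
    refine ((Real.continuous_sqrt.continuousAt.comp h2).inv₀ (Real.sqrt_pos.2 hd).ne').mul ?_
    refine tendsto_finsetSum _ fun A _ => ?_
    have h3 := ((contDiffAt_chartFlux g hι hp hc A).fderiv_right (m := 0) (by simp)).continuousAt
    exact (h3.comp (continuousAt_extChartAt' hp)).clm_apply continuousAt_const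
  refine h1.congr ?_
  have h4 : ∀ᶠ q in 𝓝 p, ∀ B,
      ContMDiffAt (𝓡 2) 𝓘(ℝ, ℝ) 1 (fun q => c q (coordField x₀ B q)) q :=
    eventually_all.2 fun B => (contMDiffAt_iff_contMDiffAt_nhds (by simp)).1 (hc B)
  filter_upwards [h4, extChartAt_source_mem_nhds' hp] with q hq hq'
  have hd := det_chartMatrix_inducedMetric_pos g hι hq'
  rw [← surfaceDiv_eq_chartFlux g hι hq' hq, inv_mul_cancel_left₀ (Real.sqrt_pos.2 hd).ne']

omit hι [IsManifold (𝓡 2) 2 S] [TopologicalSpace S] [ChartedSpace (EuclideanSpace ℝ (Fin 2)) S]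
  [TopologicalSpace V] [ChartedSpace (EuclideanSpace ℝ (Fin 4)) V] [IsManifold (𝓡 4) ∞ V] in
lemma integral_fderiv_eq_zero {E : Type*} [NormedAddCommGroup E] [NormedSpace ℝ E]
    [FiniteDimensional ℝ E] [MeasurableSpace E] [BorelSpace E] (μ : Measure E) [μ.IsAddHaarMeasure]
    {F : E → ℝ} (hF : ContDiff ℝ 1 F) (hs : HasCompactSupport F) (v : E) :
    Integrable (fun z => fderiv ℝ F z v) μ ∧ ∫ z, fderiv ℝ F z v ∂μ = 0 := by
  have h1 : Integrable (fun z => fderiv ℝ F z v) μ :=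
    ((hF.continuous_fderiv (by simp)).clm_apply continuous_const).integrable_of_hasCompactSupport
      (hs.fderiv_apply (𝕜 := ℝ) v)
  refine ⟨h1, ?_⟩
  have h2 := integral_mul_fderiv_eq_neg_fderiv_mul_of_integrable (μ := μ) (f := fun _ : E => (1 : ℝ))
    (g := F) (v := v) (by simp) (by simpa using h1)
    (by simpa using hF.continuous.integrable_of_hasCompactSupport hs)
    (fun _ _ => differentiableAt_const _) (fun z _ => hF.differentiable (by simp) z)
  simpa using h2

variable [CompactSpace S] [MeasurableSpace S] [BorelSpace S]

/-- A continuous function on the surface is integrable. -/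
lemma integrable_of_continuous {f : S → ℝ} (hf : Continuous f) :
    Integrable f (riemannianVolume (inducedMetric g ι)) := by
  have : IsLocallyFiniteMeasure (riemannianVolume (inducedMetric g ι)) :=
    isLocallyFiniteMeasure_riemannianVolume (inducedForm g ι) fun x =>
      (contDiffAt_det_chartMatrix g hι (mem_extChartAt_source x)).continuousAt
  exact hf.integrable_of_hasCompactSupport (HasCompactSupport.of_compactSpace f)

/-- The divergence theorem for forms supported in the domain of a chart. -/
lemma integral_surfaceDiv_of_support {K : Set S} (hK : IsClosed K)
    (hKs : K ⊆ (extChartAt (𝓡 2) x₀).source) (hc0 : ∀ q ∉ K, c q = 0)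
    (hc : ∀ q, ContMDiffCovectorAt c q) :
    ∫ q, surfaceDiv g ι c q ∂(riemannianVolume (inducedMetric g ι)) = 0 := by
  have hKn : ∀ q ∉ K, ∀ᶠ q' in 𝓝 q, c q' = 0 := fun q hq =>
    (hK.isOpen_compl.eventually_mem hq).mono fun q' hq' => hc0 q' hq'
  have hcont : Continuous (surfaceDiv g ι c) := continuous_iff_continuousAt.2 fun q =>
    continuousAt_surfaceDiv g hι (mem_extChartAt_source q) (hc q q (mem_extChartAt_source q))
  have ht := isOpen_extChartAt_target (I := 𝓡 2) x₀
  set ε := EuclideanSpace.basisFun (Fin 2) ℝ with hε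
  -- the flux, extended by zero to the whole plane
  set F : Fin 2 → EuclideanSpace ℝ (Fin 2) → ℝ := fun A =>
    (extChartAt (𝓡 2) x₀).target.indicator (chartFlux g c ι x₀ A) with hF
  have hKc : IsCompact (extChartAt (𝓡 2) x₀ '' K) :=
    hK.isCompact.image_of_continuousOn ((continuousOn_extChartAt x₀).mono hKs)
  have hF0 : ∀ A z, z ∉ extChartAt (𝓡 2) x₀ '' K → F A z = 0 := by
    intro A z hz
    by_cases h : z ∈ (extChartAt (𝓡 2) x₀).target
    · rw [hF]; beta_reduce
      rw [Set.indicator_of_mem h, chartFlux, hc0 _ fun h' =>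
        hz ⟨_, h', (extChartAt (𝓡 2) x₀).right_inv h⟩]
      simp only [LinearMap.zero_apply, mul_zero, Finset.sum_const_zero]
    · exact Set.indicator_of_notMem h _
  have hFe : ∀ A, ∀ z ∈ (extChartAt (𝓡 2) x₀).target, F A =ᶠ[𝓝 z] chartFlux g c ι x₀ A :=
    fun A z hz => (ht.eventually_mem hz).mono fun z' hz' => Set.indicator_of_mem hz' _
  have hFs : ∀ A, ContDiff ℝ 1 (F A) := by
    intro A
    refine contDiff_iff_contDiffAt.2 fun z => ?_
    by_cases hz : z ∈ extChartAt (𝓡 2) x₀ '' K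
    · obtain ⟨q, hq, rfl⟩ := hz
      exact (contDiffAt_chartFlux g hι (hKs hq) (hc q x₀ (hKs hq)) A).congr_of_eventuallyEq
        (hFe A _ ((extChartAt (𝓡 2) x₀).map_source (hKs hq)))
    · refine (contDiffAt_const (c := (0 : ℝ))).congr_of_eventuallyEq ?_
      exact (hKc.isClosed.isOpen_compl.eventually_mem hz).mono fun z' hz' => hF0 A z' hz'
  have hFc : ∀ A, HasCompactSupport (F A) := fun A =>
    HasCompactSupport.intro hKc fun z hz => hF0 A z hz
  have h0 : ∀ q ∉ (extChartAt (𝓡 2) x₀).source, surfaceDiv g ι c q = 0 := fun q hq =>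
    surfaceDiv_eq_zero g (hKn q fun h => hq (hKs h))
  have hβ : ContinuousOn (fun z => (chartMatrix (inducedMetric g ι) x₀
      ((extChartAt (𝓡 2) x₀).symm z)).det) (extChartAt (𝓡 2) x₀).target := by
    intro z hz
    have := (contDiffAt_det_chartMatrix g hι ((extChartAt (𝓡 2) x₀).map_target hz)).continuousAt
    rw [(extChartAt (𝓡 2) x₀).right_inv hz] at this
    exact this.continuousWithinAt
  have h1 := integral_riemannianVolume_eq (β := inducedForm g ι) hcont h0 hβ
  refine h1.trans ?_
  have h2 : ∀ z ∈ (extChartAt (𝓡 2) x₀).target,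
      √(chartMatrix (inducedMetric g ι) x₀ ((extChartAt (𝓡 2) x₀).symm z)).det *
        surfaceDiv g ι c ((extChartAt (𝓡 2) x₀).symm z) = ∑ A, fderiv ℝ (F A) z (ε A) := by
    intro z hz
    have hq := (extChartAt (𝓡 2) x₀).map_target hz
    rw [surfaceDiv_eq_chartFlux g hι hq (hc _ x₀ hq), (extChartAt (𝓡 2) x₀).right_inv hz]
    exact Finset.sum_congr rfl fun A _ => by rw [(hFe A z hz).fderiv_eq]
  refine (setIntegral_congr_fun ht.measurableSet h2).trans ?_
  rw [setIntegral_eq_integral_of_forall_compl_eq_zero]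
  · rw [integral_finsetSum _ fun A _ => (integral_fderiv_eq_zero volume (hFs A) (hFc A) (ε A)).1]
    exact Finset.sum_eq_zero fun A _ => (integral_fderiv_eq_zero volume (hFs A) (hFc A) (ε A)).2
  · intro z hz
    refine Finset.sum_eq_zero fun A _ => ?_
    have hz' : z ∉ extChartAt (𝓡 2) x₀ '' K := by
      rintro ⟨q, hq, rfl⟩
      exact hz ((extChartAt (𝓡 2) x₀).map_source (hKs hq))
    have : F A =ᶠ[𝓝 z] fun _ => (0 : ℝ) :=
      (hKc.isClosed.isOpen_compl.eventually_mem hz').mono fun z' hz' => hF0 A z' hz'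
    rw [this.fderiv_eq]
    simp

variable [T2Space S]

omit hι [MeasurableSpace S] [BorelSpace S] [IsManifold (𝓡 4) ∞ V] [TopologicalSpace V]
  [ChartedSpace (EuclideanSpace ℝ (Fin 4)) V] in
variable (S) in
/-- A finite `C¹` partition of unity subordinate to the chart domains. -/
lemma exists_partition : ∃ (s : Finset S) (χ : S → S → ℝ),
    (∀ x, ContMDiff (𝓡 2) 𝓘(ℝ, ℝ) 1 (χ x)) ∧ (∀ x, tsupport (χ x) ⊆ (extChartAt (𝓡 2) x).source) ∧
      ∀ q, ∑ x ∈ s, χ x q = 1 := by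
  let ψ : ∀ x : S, SmoothBumpFunction (𝓡 2) x := fun x => Classical.arbitrary _
  have hψ : ∀ x, ContMDiff (𝓡 2) 𝓘(ℝ, ℝ) 1 (ψ x) := by
    intro x
    refine contMDiff_of_tsupport fun q hq => ?_
    have hq' := (ψ x).tsupport_subset_extChartAt_source hq
    rw [(contMDiffAt_iff_contDiffAt_chart hq')]
    refine ((ψ x).toContDiffBump.contDiffAt (n := 1)).congr_of_eventuallyEq ?_
    filter_upwards [extChartAt_target_mem_nhds' (I := 𝓡 2) ((extChartAt (𝓡 2) x).map_source hq')]
      with z hz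
    have h : (extChartAt (𝓡 2) x).symm z ∈ (chartAt (EuclideanSpace ℝ (Fin 2)) x).source := by
      simpa using (extChartAt (𝓡 2) x).map_target hz
    exact ((ψ x).eqOn_source h).trans
      (congrArg (ψ x).toContDiffBump ((extChartAt (𝓡 2) x).right_inv hz))
  obtain ⟨s, -, hs⟩ := isCompact_univ.elim_nhds_subcover (fun x : S => Function.support (ψ x))
    fun x _ => (ψ x).support_mem_nhds
  have hpos : ∀ q, 0 < ∑ x ∈ s, ψ x q := by
    intro q
    obtain ⟨x, hx, hq⟩ := Set.mem_iUnion₂.1 (hs (Set.mem_univ q))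
    exact Finset.sum_pos' (fun x _ => (ψ x).nonneg) ⟨x, hx, lt_of_le_of_ne (ψ x).nonneg (Ne.symm hq)⟩
  refine ⟨s, fun x q => ψ x q * (∑ y ∈ s, ψ y q)⁻¹, fun x => ?_, fun x => ?_, fun q => ?_⟩
  · refine (hψ x).mul fun q => ?_
    have h1 : ContMDiffAt (𝓡 2) 𝓘(ℝ, ℝ) 1 (fun q => ∑ y ∈ s, ψ y q) q :=
      ContMDiffAt.sum fun y _ => (hψ y).contMDiffAt
    exact (contDiffAt_inv ℝ (hpos q).ne').contMDiffAt.comp q h1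
  · exact (closure_mono (Function.support_mul_subset_left _ _)).trans
      (ψ x).tsupport_subset_extChartAt_source
  · rw [← Finset.sum_mul, mul_inv_cancel₀ (hpos q).ne']

/-- The divergence theorem on a closed surface. -/
theorem integral_surfaceDiv (hc : ∀ q, ContMDiffCovectorAt c q) :
    Continuous (surfaceDiv g ι c) ∧
      ∫ q, surfaceDiv g ι c q ∂(riemannianVolume (inducedMetric g ι)) = 0 := by
  have hcont : ∀ {c : ∀ q : S, TangentSpace (𝓡 2) q →ₗ[ℝ] ℝ}, (∀ q, ContMDiffCovectorAt c q) →
      Continuous (surfaceDiv g ι c) := fun hc => continuous_iff_continuousAt.2 fun q =>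
    continuousAt_surfaceDiv g hι (mem_extChartAt_source q) (hc q q (mem_extChartAt_source q))
  refine ⟨hcont hc, ?_⟩
  obtain ⟨s, χ, hχ, hχs, hχ1⟩ := exists_partition S
  have h1 : ∀ x q, ContMDiffCovectorAt (fun q => χ x q • c q) q :=
    fun x q => (hc q).smul (hχ x).contMDiffAt
  have h2 : surfaceDiv g ι c = fun q => ∑ x ∈ s, surfaceDiv g ι (fun q => χ x q • c q) q := by
    funext q
    rw [← surfaceDiv_sum g fun x _ => h1 x q]
    refine surfaceDiv_congr g (Eventually.of_forall fun q => ?_)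
    rw [← Finset.sum_smul, hχ1, one_smul]
  rw [h2, integral_finsetSum _ fun x _ => integrable_of_continuous g hι (hcont (h1 x))]
  refine Finset.sum_eq_zero fun x _ =>
    integral_surfaceDiv_of_support g hι (isClosed_tsupport (χ x)) (hχs x) (fun q hq => ?_) (h1 x)
  rw [image_eq_zero_of_notMem_tsupport hq, zero_smul]

end DivergenceTheorem

/-! ### Continuity of the integrand -/

section ContinuityOfTheIntegrand

variable {V : Type*} [TopologicalSpace V] [ChartedSpace (EuclideanSpace ℝ (Fin 4)) V]
  [IsManifold (𝓡 4) ∞ V] (g : LorentzMetric V) (oV : ManifoldOrientation 4 V)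
  {S : Type*} [TopologicalSpace S] [ChartedSpace (EuclideanSpace ℝ (Fin 2)) S]
  [IsManifold (𝓡 2) 2 S] (oS : ManifoldOrientation 2 S)
  {ι : S → V} (hι : IsSpacelikeEmbedding g ι) {p : S}
include hι

lemma isNormalVector_meanCurvature : IsNormalVector g ι p (meanCurvature g ι p) :=
  IsNormalVector.sum g _ fun _ _ => IsNormalVector.sum g _ fun _ _ =>
    ((isNormalVector_normalPart g hι _).neg g).smul g _

lemma isNormalVector_normalLaplacian (X : ∀ q : S, TangentSpace (𝓡 4) (ι q)) :
    IsNormalVector g ι p (normalLaplacian g ι X p) :=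
  IsNormalVector.sum g _ fun _ _ => IsNormalVector.sum g _ fun _ _ =>
    ((isNormalVector_normalDeriv g hι _ _).sub g (isNormalVector_normalDeriv g hι _ _)).smul g _

omit [IsManifold (𝓡 2) 2 S] in
lemma ContMDiffAlong.form {k : WithTop ℕ∞} (hk : k ≤ 1)
    [ContMDiffVectorBundle k (EuclideanSpace ℝ (Fin 4)) (TangentSpace (𝓡 4) : V → Type _) (𝓡 4)]
    {X Y : ∀ q : S, TangentSpace (𝓡 4) (ι q)} (hX : ContMDiffAlong 2 ι k X p)
    (hY : ContMDiffAlong 2 ι k Y p) :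
    ContMDiffAt (𝓡 2) 𝓘(ℝ, ℝ) k (fun q => g.form (ι q) (X q) (Y q)) p :=
  (g.contMDiffForm k (hk.trans (by simp))).apply ((hι.contMDiffAt_one g p).of_le hk) hX hY

omit hι in
lemma ContMDiffAlong.eventually {X : ∀ q : S, TangentSpace (𝓡 4) (ι q)}
    (hX : ContMDiffAlong 2 ι 1 X p) : ∀ᶠ q in 𝓝 p, ContMDiffAlong 2 ι 1 X q :=
  (contMDiffAt_iff_contMDiffAt_nhds (by simp)).1 hX

lemma contMDiffCovectorAt_normalDerivForm {T X : ∀ q : S, TangentSpace (𝓡 4) (ι q)}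
    (hT : ContMDiffAlong 2 ι 1 T p) (hX : ContMDiffAlong 2 ι 2 X p) :
    ContMDiffCovectorAt (normalDerivForm g ι T X) p := fun x₀ hp B =>
  hT.form g hι le_rfl
    (contMDiffAlong_normalDeriv g hι (k := 1) (j := 2) (by norm_num) le_rfl le_rfl hp hX B)

lemma continuousAt_form_normalLaplacian {T X : ∀ q : S, TangentSpace (𝓡 4) (ι q)}
    (hT : ContMDiffAlong 2 ι 1 T p) (hTn : ∀ q, IsNormalVector g ι q (T q))
    (hX : ∀ q, ContMDiffAlong 2 ι 2 X q) :
    ContinuousAt (fun q => g.form (ι q) (T q) (normalLaplacian g ι X q)) p := by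
  have hp := mem_extChartAt_source (I := 𝓡 2) p
  have hX1 : ContMDiffAlong 2 ι 1 X p := (hX p).of_le (by norm_num)
  have h1 := contMDiffAt_surfaceTrace g hι (k := 0) (by simp) hp
    (fun q => (g.bilin (ι q)).compl₁₂ (normalDerivLin g ι T q) (normalDerivLin g ι X q))
    (fun A B => ContMDiffAlong.form g hι (by simp)
      (contMDiffAlong_normalDeriv g hι (k := 0) (j := 1) (by simp) (by norm_num) (by simp) hp hT A)
      (contMDiffAlong_normalDeriv g hι (k := 0) (j := 1) (by simp) (by norm_num) (by simp) hp hX1 B))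
  refine ((continuousAt_surfaceDiv g hι hp
    (contMDiffCovectorAt_normalDerivForm g hι hT (hX p) p hp)).sub h1.continuousAt).congr ?_
  filter_upwards [ContMDiffAlong.eventually hT] with q hq
  exact (form_normalLaplacian g hι hq (hTn q) (hX q)).symm

lemma continuousAt_form_meanCurvature {T : ∀ q : S, TangentSpace (𝓡 4) (ι q)}
    (hT : ContMDiffAlong 2 ι 1 T p) (hTn : ∀ q, IsNormalVector g ι q (T q)) :
    ContinuousAt (fun q => g.form (ι q) (T q) (meanCurvature g ι q)) p := by
  have hp := mem_extChartAt_source (I := 𝓡 2) p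
  have h1 := contMDiffAt_surfaceTrace g hι (k := 0) (by simp) hp
    (fun q => (g.bilin (ι q)).compl₁₂ (covDerivLin g ι T q) (differential ι q))
    (fun A B => ContMDiffAlong.form g hι (by simp)
      (ContMDiffAlong.covDeriv g (k := 0) (j := 1) (by simp) (by simp) (by simp)
        (hι.contMDiffAt_one g p) hT (contMDiffAt_coordField hp A))
      ((contMDiffAlong_mfderiv_coordField hι.contMDiff hp B).of_le (by simp)))
  refine h1.continuousAt.congr ?_
  filter_upwards [ContMDiffAlong.eventually hT] with q hq
  exact (form_meanCurvature g hι hq (Eventually.of_forall hTn)).symm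

lemma exists_timelike_field (p : S) : ∃ T : ∀ q : S, TangentSpace (𝓡 4) (ι q),
    ContMDiffAlong 2 ι 1 T p ∧ (∀ q, IsNormalVector g ι q (T q)) ∧
      ∀ᶠ q in 𝓝 p, g.form (ι q) (T q) (T q) < 0 := by
  obtain ⟨w, hwn, hw⟩ := exists_timelike_normal g hι p
  obtain ⟨T, hT, hTn, rfl⟩ := exists_normal_extension g hι hwn
  exact ⟨T, hT, hTn, (hT.form g hι le_rfl hT).continuousAt.eventually_lt continuousAt_const hw⟩

include oV oS in
/-- The integrand is continuous: the normal Laplacian and the mean curvature vector pair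
continuously with a local timelike normal field and with its Hodge dual. -/
lemma continuous_traceIntegrand {X : ∀ q : S, TangentSpace (𝓡 4) (ι q)}
    (hX : ∀ q, ContMDiffAlong 2 ι 2 X q) : Continuous (traceIntegrand g ι X) := by
  refine continuous_iff_continuousAt.2 fun p => ?_
  obtain ⟨T, hT, hTn, hT0⟩ := exists_timelike_field g hι p
  have hJ := hT.normalDual g oV oS hι le_rfl
  have hJn : ∀ q, IsNormalVector g ι q (normalDual g oV ι oS q (T q)) := fun q => isNormalVector_normalDual g oV oS _
  have h1 := (((continuousAt_form_meanCurvature g hι hT hTn).mul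
    (continuousAt_form_normalLaplacian g hι hT hTn hX)).sub
    ((continuousAt_form_meanCurvature g hι hJ hJn).mul
      (continuousAt_form_normalLaplacian g hι hJ hJn hX))).div
    (hT.form g hι le_rfl hT).continuousAt hT0.self_of_nhds.ne
  refine h1.congr ?_
  filter_upwards [hT0] with q hq
  have h2 := form_normalDual_mul g oV oS hι (hTn q) (isNormalVector_meanCurvature g hι)
    (isNormalVector_normalLaplacian g hι X)
  simp only [Pi.div_apply, Pi.sub_apply, Pi.mul_apply]
  rw [div_eq_iff hq.ne, traceIntegrand]
  linarith

end ContinuityOfTheIntegrand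

/-! ### The null lines of the normal plane -/

section NullLines

variable {V : Type*} [TopologicalSpace V] [ChartedSpace (EuclideanSpace ℝ (Fin 4)) V]
  [IsManifold (𝓡 4) ∞ V] (g : LorentzMetric V) (oV : ManifoldOrientation 4 V)
  {S : Type*} [TopologicalSpace S] [ChartedSpace (EuclideanSpace ℝ (Fin 2)) S]
  [IsManifold (𝓡 2) 2 S] (oS : ManifoldOrientation 2 S)
  {ι : S → V} (hι : IsSpacelikeEmbedding g ι) {p : S} {ε : ℝ}

/-- The combination `W - ε W^⋆`; for `ε = ±1` it is twice the projection of a normal vector `W` to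
one of the two null lines of the normal plane, along the other one. -/
def nullPart (ε : ℝ) (p : S) (W : TangentSpace (𝓡 4) (ι p)) : TangentSpace (𝓡 4) (ι p) :=
  W - ε • normalDual g oV ι oS p W

lemma isNormalVector_nullPart {W : TangentSpace (𝓡 4) (ι p)} (hW : IsNormalVector g ι p W) :
    IsNormalVector g ι p (nullPart g oV oS ε p W) :=
  hW.sub g ((isNormalVector_normalDual g oV oS W).smul g _)

lemma form_nullPart (W Z : TangentSpace (𝓡 4) (ι p)) :
    g.form (ι p) (nullPart g oV oS ε p W) Z =
      g.form (ι p) W Z - ε * g.form (ι p) (normalDual g oV ι oS p W) Z := by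
  rw [nullPart, g.form_sub_left, g.form_smul_left]

include hι

lemma normalDual_nullPart (hε : ε ^ 2 = 1) {W : TangentSpace (𝓡 4) (ι p)}
    (hW : IsNormalVector g ι p W) :
    normalDual g oV ι oS p (nullPart g oV oS ε p W) = (-ε) • nullPart g oV oS ε p W := by
  rw [nullPart, normalDual_sub, normalDual_smul, normalDual_normalDual g oV oS hι hW, smul_sub,
    smul_smul, show -ε * ε = -1 by linear_combination -hε]
  module

/-- The two null lines of the normal plane are the eigenspaces of the Hodge dual. -/
lemma smul_eq_nullPart {T Z : TangentSpace (𝓡 4) (ι p)} (hT : IsNormalVector g ι p T)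
    (hZ : IsNormalVector g ι p Z) (hJZ : normalDual g oV ι oS p Z = (-ε) • Z) :
    g.form (ι p) T T • Z = g.form (ι p) T Z • nullPart g oV oS ε p T := by
  rw [normal_decomp g oV oS hι hT hZ, form_normalDual_antisymm, hJZ, g.form_smul_right, nullPart]
  module

/-- Eigenvectors of the Hodge dual for the same eigenvalue are proportional. -/
lemma form_mul_form_of_eigen {Y Z : TangentSpace (𝓡 4) (ι p)} (hY : IsNormalVector g ι p Y)
    (hZ : IsNormalVector g ι p Z) (hJY : normalDual g oV ι oS p Y = (-ε) • Y) (hJZ : normalDual g oV ι oS p Z = (-ε) • Z)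
    (A B : TangentSpace (𝓡 4) (ι p)) :
    g.form (ι p) Y A * g.form (ι p) Z B = g.form (ι p) Z A * g.form (ι p) Y B := by
  obtain ⟨T, hTn, hT⟩ := exists_timelike_normal g hι p
  have h1 := smul_eq_nullPart g oV oS hι hTn hY hJY
  have h2 := smul_eq_nullPart g oV oS hι hTn hZ hJZ
  have e : ∀ C, g.form (ι p) T T * g.form (ι p) Y C =
      g.form (ι p) T Y * g.form (ι p) (nullPart g oV oS ε p T) C := fun C => by
    rw [← g.form_smul_left, h1, g.form_smul_left]
  have e' : ∀ C, g.form (ι p) T T * g.form (ι p) Z C =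
      g.form (ι p) T Z * g.form (ι p) (nullPart g oV oS ε p T) C := fun C => by
    rw [← g.form_smul_left, h2, g.form_smul_left]
  refine mul_left_cancel₀ (pow_ne_zero 2 hT.ne) ?_
  linear_combination g.form (ι p) T T * g.form (ι p) Z B * e A +
    g.form (ι p) T Y * g.form (ι p) (nullPart g oV oS ε p T) A * e' B -
    g.form (ι p) T T * g.form (ι p) Y B * e' A -
    g.form (ι p) T Z * g.form (ι p) (nullPart g oV oS ε p T) A * e B

/-- The null lines are parallel for the normal connection. -/
lemma normalDual_normalDeriv_of_eigen {W : ∀ q : S, TangentSpace (𝓡 4) (ι q)}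
    (hW : ContMDiffAlong 2 ι 1 W p) (hWn : ∀ q, IsNormalVector g ι q (W q))
    (hJW : ∀ q, normalDual g oV ι oS q (W q) = (-ε) • W q) (v : TangentSpace (𝓡 2) p) :
    normalDual g oV ι oS p (normalDeriv g ι W p v) = (-ε) • normalDeriv g ι W p v := by
  rw [← normalDeriv_normalDual g oV oS hι hW (Eventually.of_forall hWn)]
  refine IsNormalVector.ext g hι (isNormalVector_normalDeriv g hι _ _)
    ((isNormalVector_normalDeriv g hι _ _).smul g _) fun Z hZ => ?_
  obtain ⟨Y, hY, hYn, rfl⟩ := exists_normal_extension g hι hZ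
  have h1 := vderiv_form_normal g hι (hW.normalDual g oV oS hι le_rfl) hY
    (isNormalVector_normalDual g oV oS _) (hYn p) v
  have h2 := vderiv_form_normal g hι hW hY (hWn p) (hYn p) v
  have h3 : vderiv (fun q => g.form (ι q) (normalDual g oV ι oS q (W q)) (Y q)) p v =
      -ε * vderiv (fun q => g.form (ι q) (W q) (Y q)) p v := by
    have hp := mem_extChartAt_source (I := 𝓡 2) p
    have h4 := (((hW.form g hι le_rfl hY).mdifferentiableAt (by simp)).hasFDerivAt_chart hp).const_mul
      (-ε)
    have h5 : (fun q => g.form (ι q) (normalDual g oV ι oS q (W q)) (Y q)) =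
        fun q => -ε * g.form (ι q) (W q) (Y q) := by
      funext q; rw [hJW, g.form_smul_left]
    rw [h5, HasFDerivAt.vderiv_apply (f := fun q => -ε * g.form (ι q) (W q) (Y q)) h4, smul_apply,
      ContinuousLinearMap.comp_apply, chartInv_chartMap hp, smul_eq_mul]
  rw [hJW, g.form_smul_left] at h1
  rw [g.form_smul_left]
  linear_combination h3 - h1 - ε * h2

end NullLines

/-! ### The contributions of the null parts of the mean curvature -/

section NullContributions

variable {V : Type*} [TopologicalSpace V] [ChartedSpace (EuclideanSpace ℝ (Fin 4)) V]
  [IsManifold (𝓡 4) ∞ V] (g : LorentzMetric V) (oV : ManifoldOrientation 4 V)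
  {S : Type*} [TopologicalSpace S] [ChartedSpace (EuclideanSpace ℝ (Fin 2)) S]
  [IsManifold (𝓡 2) 2 S] (oS : ManifoldOrientation 2 S)
  {ι : S → V} (hι : IsSpacelikeEmbedding g ι) {p : S} {ε α : ℝ}
include hι

omit [IsManifold (𝓡 2) 2 S] in
lemma ContMDiffAlong.smul {X : ∀ q : S, TangentSpace (𝓡 4) (ι q)} (hX : ContMDiffAlong 2 ι 1 X p)
    {f : S → ℝ} (hf : ContMDiffAt (𝓡 2) 𝓘(ℝ, ℝ) 1 f p) :
    ContMDiffAlong 2 ι 1 (fun q => f q • X q) p := by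
  have h4 := mem_extChartAt_source (I := 𝓡 4) (ι p)
  have h1 := hι.contMDiffAt_one g p
  rw [contMDiffAlong_iff h1 h4] at hX ⊢
  simp only [map_smul]
  exact hf.smul hX

lemma ContMDiffAlong.nullPart {X : ∀ q : S, TangentSpace (𝓡 4) (ι q)}
    (hX : ContMDiffAlong 2 ι 1 X p) :
    ContMDiffAlong 2 ι 1 (fun q => nullPart g oV oS ε q (X q)) p := by
  have h4 := mem_extChartAt_source (I := 𝓡 4) (ι p)
  have h1 := hι.contMDiffAt_one g p
  have hJ := hX.normalDual g oV oS hι le_rfl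
  rw [contMDiffAlong_iff h1 h4] at hX hJ ⊢
  simp only [_root_.nullPart, map_sub, map_smul]
  have hc : ContMDiffAt (𝓡 2) 𝓘(ℝ, ℝ) 1 (fun _ : S => ε) p := contMDiffAt_const
  exact hX.sub (hc.smul hJ)

omit hι in
lemma form_nullPart_self {T : TangentSpace (𝓡 4) (ι p)} :
    g.form (ι p) (nullPart g oV oS ε p T) T = g.form (ι p) T T := by
  have h := form_normalDual_antisymm g oV oS T T
  rw [g.form_symm _ T (normalDual g oV ι oS p T)] at h
  rw [form_nullPart, show g.form (ι p) (normalDual g oV ι oS p T) T = 0 by linarith]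
  ring

variable {ξ K : ∀ q : S, TangentSpace (𝓡 4) (ι q)} (hξ : ∀ q, ContMDiffAlong 2 ι 2 ξ q)
  (hξn : ∀ q, IsNormalVector g ι q (ξ q))
include hξ hξn

omit hξn in
/-- A null normal field is determined, and hence as regular as `ξ`, by its non-zero scalar product
with `ξ`. -/
lemma contMDiffAlong_of_eigen (hα : α ≠ 0) (hK : ∀ q, IsNormalVector g ι q (K q))
    (hJK : ∀ q, normalDual g oV ι oS q (K q) = (-ε) • K q) (hKξ : ∀ q, g.form (ι q) (K q) (ξ q) = α) (p : S) :
    ContMDiffAlong 2 ι 1 K p := by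
  obtain ⟨T, hT, hTn, hT0⟩ := exists_timelike_field g hι p
  have hY := hT.nullPart g oV oS hι (ε := ε)
  have hξ1 : ContMDiffAlong 2 ι 1 ξ p := (hξ p).of_le (by norm_num)
  have hf := hY.form g hι le_rfl hξ1
  have key : ∀ q, g.form (ι q) (T q) (T q) < 0 →
      g.form (ι q) (nullPart g oV oS ε q (T q)) (ξ q) ≠ 0 ∧
      K q = (α / g.form (ι q) (nullPart g oV oS ε q (T q)) (ξ q)) •
        nullPart g oV oS ε q (T q) := by
    intro q hq
    have h1 := smul_eq_nullPart g oV oS hι (hTn q) (hK q) (hJK q)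
    have h2 : g.form (ι q) (T q) (T q) * α = g.form (ι q) (T q) (K q) *
        g.form (ι q) (nullPart g oV oS ε q (T q)) (ξ q) := by
      rw [← hKξ q, ← g.form_smul_left, h1, g.form_smul_left]
    have h3 : g.form (ι q) (nullPart g oV oS ε q (T q)) (ξ q) ≠ 0 := by
      intro h
      rw [h, mul_zero] at h2
      exact mul_ne_zero hq.ne hα h2
    refine ⟨h3, ?_⟩
    rw [← inv_smul_smul₀ hq.ne (K q), h1, smul_smul]
    congr 1
    rw [inv_mul_eq_div, div_eq_div_iff hq.ne h3]
    linarith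
  have hdiv : ContMDiffAt (𝓡 2) 𝓘(ℝ, ℝ) 1
      (fun q => α / g.form (ι q) (nullPart g oV oS ε q (T q)) (ξ q)) p :=
    contMDiffAt_const.div₀ hf (key p hT0.self_of_nhds).1
  refine (hY.smul g hι hdiv).congr_of_eventuallyEq (hT0.mono fun q hq => ?_)
  exact congrArg (fun X => (⟨ι q, X⟩ : TangentBundle (𝓡 4) V)) (key q hq).2

/-- For a null normal field `K` with `K · ξ` a non-zero
constant `α`, the function `K · Δξ` is the sum of the divergence of the form `w = K · ∇^⊥ ξ` and of
`α⁻¹ |w|²`. -/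
lemma form_normalLaplacian_of_eigen (hα : α ≠ 0)
    (hK : ∀ q, IsNormalVector g ι q (K q)) (hJK : ∀ q, normalDual g oV ι oS q (K q) = (-ε) • K q)
    (hKξ : ∀ q, g.form (ι q) (K q) (ξ q) = α) (p : S) :
    g.form (ι p) (K p) (normalLaplacian g ι ξ p) = surfaceDiv g ι (normalDerivForm g ι K ξ) p +
      α⁻¹ * surfaceTrace g ι p fun v w =>
        normalDerivForm g ι K ξ p v * normalDerivForm g ι K ξ p w := by
  have hK1 := contMDiffAlong_of_eigen g oV oS hι hξ hα hK hJK hKξ p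
  have hξ1 : ContMDiffAlong 2 ι 1 ξ p := (hξ p).of_le (by norm_num)
  rw [form_normalLaplacian g hι hK1 (hK p) (hξ p), sub_eq_add_neg]
  congr 1
  rw [surfaceTrace, surfaceTrace, ← Finset.sum_neg_distrib, Finset.mul_sum]
  refine Finset.sum_congr rfl fun A _ => ?_
  rw [← Finset.sum_neg_distrib, Finset.mul_sum]
  refine Finset.sum_congr rfl fun B _ => ?_
  rw [normalDerivForm_apply, normalDerivForm_apply]
  set v := tangentBasis (n := 2) p A
  have h1 := vderiv_form_normal g hι hK1 hξ1 (hK p) (hξn p) v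
  rw [show (fun q => g.form (ι q) (K q) (ξ q)) = fun _ => α from funext hKξ, vderiv_const] at h1
  have h2 := form_mul_form_of_eigen g oV oS hι (hK p) (isNormalVector_normalDeriv g hι K v) (hJK p)
    (normalDual_normalDeriv_of_eigen g oV oS hι hK1 hK hJK v) (ξ p)
    (normalDeriv g ι ξ p (tangentBasis p B))
  rw [hKξ] at h2
  field_simp
  linear_combination (-invInduced g ι p A B) * h2 + invInduced g ι p A B *
    g.form (ι p) (K p) (normalDeriv g ι ξ p (tangentBasis p B)) * h1

include oV oS in
/-- If `K` is a null part of the mean curvature vector with `K · ξ = 0`, then `K · Δξ = 0`: where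
`K ≠ 0`, the field `ξ` lies in the null line of `K`, which is parallel. -/
lemma form_normalLaplacian_eq_zero (hε : ε ^ 2 = 1)
    (hKξ : ∀ q, g.form (ι q) (nullPart g oV oS ε q (meanCurvature g ι q)) (ξ q) = 0) (p : S) :
    g.form (ι p) (nullPart g oV oS ε p (meanCurvature g ι p)) (normalLaplacian g ι ξ p) = 0 := by
  obtain ⟨T, hT, hTn, hT0⟩ := exists_timelike_field g hι p
  have hHn : ∀ q, IsNormalVector g ι q (meanCurvature g ι q) :=
    fun q => isNormalVector_meanCurvature g hι
  set K : ∀ q, TangentSpace (𝓡 4) (ι q) := fun q => nullPart g oV oS ε q (meanCurvature g ι q) with hKd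
  set Y : ∀ q, TangentSpace (𝓡 4) (ι q) := fun q => nullPart g oV oS ε q (T q) with hYd
  have hK : ∀ q, IsNormalVector g ι q (K q) := fun q => isNormalVector_nullPart g oV oS (hHn q)
  have hYn : ∀ q, IsNormalVector g ι q (Y q) := fun q => isNormalVector_nullPart g oV oS (hTn q)
  have hJK : ∀ q, normalDual g oV ι oS q (K q) = (-ε) • K q := fun q => normalDual_nullPart g oV oS hι hε (hHn q)
  have hJY : ∀ q, normalDual g oV ι oS q (Y q) = (-ε) • Y q := fun q => normalDual_nullPart g oV oS hι hε (hTn q)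
  have hY : ContMDiffAlong 2 ι 1 Y p := hT.nullPart g oV oS hι
  have hξ1 : ∀ q, ContMDiffAlong 2 ι 1 ξ q := fun q => (hξ q).of_le (by norm_num)
  have h1 : ∀ q Z, g.form (ι q) (T q) (T q) * g.form (ι q) (K q) Z =
      g.form (ι q) (T q) (K q) * g.form (ι q) (Y q) Z := fun q Z => by
    rw [← g.form_smul_left, smul_eq_nullPart g oV oS hι (hTn q) (hK q) (hJK q), g.form_smul_left]
  change g.form (ι p) (K p) _ = 0
  have h2 := h1 p (normalLaplacian g ι ξ p)
  by_cases h0 : g.form (ι p) (T p) (K p) = 0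
  · rw [h0, zero_mul] at h2
    exact (mul_eq_zero.1 h2).resolve_left hT0.self_of_nhds.ne
  have hTK : ∀ q, g.form (ι q) (T q) (K q) = g.form (ι q) (T q) (meanCurvature g ι q) +
      ε * g.form (ι q) (normalDual g oV ι oS q (T q)) (meanCurvature g ι q) := fun q => by
    rw [hKd]; beta_reduce
    rw [nullPart, g.form_sub_right, g.form_smul_right, form_normalDual_antisymm]
    ring
  have hc : ContinuousAt (fun q => g.form (ι q) (T q) (K q)) p := by
    simp only [hTK]
    exact (continuousAt_form_meanCurvature g hι hT hTn).add (continuousAt_const.mul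
      (continuousAt_form_meanCurvature g hι (hT.normalDual g oV oS hι le_rfl)
        fun q => isNormalVector_normalDual g oV oS _))
  have hYξ : ∀ᶠ q in 𝓝 p, g.form (ι q) (Y q) (ξ q) = 0 := by
    filter_upwards [hc.eventually_ne h0] with q hq
    have := h1 q (ξ q)
    rw [hKξ q, mul_zero] at this
    exact (mul_eq_zero.1 this.symm).resolve_left hq
  -- near `p`, both `Y · ∇^⊥ ξ` and `∇^⊥ Y · ∇^⊥ ξ` vanish
  have h3 : ∀ᶠ q in 𝓝 p, ∀ v, g.form (ι q) (Y q) (normalDeriv g ι ξ q v) = 0 ∧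
      ∀ Z, g.form (ι q) (Y q) Z = 0 → g.form (ι q) (normalDeriv g ι Y q v) Z = 0 := by
    filter_upwards [hYξ.eventually_nhds, ContMDiffAlong.eventually hY, hT0] with q hq hYq hTq
    intro v
    have h4 : ∀ Z, g.form (ι q) (Y q) Z = 0 → g.form (ι q) (normalDeriv g ι Y q v) Z = 0 := by
      intro Z hZ
      have h5 := form_mul_form_of_eigen g oV oS hι (hYn q) (isNormalVector_normalDeriv g hι Y v)
        (hJY q) (normalDual_normalDeriv_of_eigen g oV oS hι hYq hYn hJY v) (T q) Z
      rw [hZ, mul_zero] at h5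
      refine (mul_eq_zero.1 h5).resolve_left ?_
      rw [hYd]; beta_reduce
      rw [form_nullPart_self g oV oS]
      exact hTq.ne
    refine ⟨?_, h4⟩
    have h5 := vderiv_form_normal g hι hYq (hξ1 q) (hYn q) (hξn q) v
    rw [Filter.EventuallyEq.vderiv_eq (f := fun _ => (0 : ℝ)) hq, vderiv_const,
      h4 _ hq.self_of_nhds, zero_add] at h5
    exact h5.symm
  have h6 : g.form (ι p) (Y p) (normalLaplacian g ι ξ p) = 0 := by
    rw [form_normalLaplacian g hι hY (hYn p) (hξ p), surfaceDiv_eq_zero g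
      (h3.mono fun q hq => LinearMap.ext fun v => (hq v).1)]
    simp [surfaceTrace, (h3.self_of_nhds _).2 _ (h3.self_of_nhds _).1]
  rw [h6, mul_zero] at h2
  exact (mul_eq_zero.1 h2).resolve_left hT0.self_of_nhds.ne

variable [T2Space S] [CompactSpace S] [MeasurableSpace S] [BorelSpace S]

lemma integral_nullPart_nonneg (hε : ε ^ 2 = 1) (hα : 0 ≤ α)
    (hKξ : ∀ q, g.form (ι q) (nullPart g oV oS ε q (meanCurvature g ι q)) (ξ q) = α) :
    Integrable (fun q => g.form (ι q) (nullPart g oV oS ε q (meanCurvature g ι q))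
      (normalLaplacian g ι ξ q)) (riemannianVolume (inducedMetric g ι)) ∧
    0 ≤ ∫ q, g.form (ι q) (nullPart g oV oS ε q (meanCurvature g ι q)) (normalLaplacian g ι ξ q)
      ∂(riemannianVolume (inducedMetric g ι)) := by
  rcases hα.eq_or_lt with rfl | hα
  · simp [form_normalLaplacian_eq_zero g oV oS hι hξ hξn hε hKξ]
  have hHn : ∀ q, IsNormalVector g ι q (meanCurvature g ι q) :=
    fun q => isNormalVector_meanCurvature g hι
  set K : ∀ q, TangentSpace (𝓡 4) (ι q) := fun q => nullPart g oV oS ε q (meanCurvature g ι q)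
  have hK : ∀ q, IsNormalVector g ι q (K q) := fun q => isNormalVector_nullPart g oV oS (hHn q)
  have hJK : ∀ q, normalDual g oV ι oS q (K q) = (-ε) • K q := fun q => normalDual_nullPart g oV oS hι hε (hHn q)
  have hc : ∀ q, ContMDiffCovectorAt (normalDerivForm g ι K ξ) q := fun q =>
    contMDiffCovectorAt_normalDerivForm g hι
      (contMDiffAlong_of_eigen g oV oS hι hξ hα.ne' hK hJK hKξ q) (hξ q)
  obtain ⟨h1, h2⟩ := integral_surfaceDiv g hι hc
  have h3 : Continuous fun p => surfaceTrace g ι p fun v w =>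
      normalDerivForm g ι K ξ p v * normalDerivForm g ι K ξ p w :=
    continuous_iff_continuousAt.2 fun p => (contMDiffAt_surfaceTrace g hι le_rfl
      (mem_extChartAt_source p) (fun q => (LinearMap.mul ℝ ℝ).compl₁₂ (normalDerivForm g ι K ξ q)
        (normalDerivForm g ι K ξ q)) fun A B => (hc p p (mem_extChartAt_source p) A).mul
          (hc p p (mem_extChartAt_source p) B)).continuousAt
  have i1 := integrable_of_continuous g hι h1
  have i3 := (integrable_of_continuous g hι h3).const_mul α⁻¹
  have h4 : (fun q => g.form (ι q) (K q) (normalLaplacian g ι ξ q)) = fun p =>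
      surfaceDiv g ι (normalDerivForm g ι K ξ) p + α⁻¹ * surfaceTrace g ι p fun v w =>
        normalDerivForm g ι K ξ p v * normalDerivForm g ι K ξ p w :=
    funext (form_normalLaplacian_of_eigen g oV oS hι hξ hξn hα.ne' hK hJK hKξ)
  rw [h4]
  refine ⟨i1.add i3, ?_⟩
  rw [integral_add i1 i3, h2, zero_add]
  exact integral_nonneg fun p => mul_nonneg (inv_nonneg.2 hα.le) (surfaceTrace_sq_nonneg g hι _)

end NullContributions

/-! ### Causal normal vectors -/

section CausalVectors

variable {V : Type*} [TopologicalSpace V] [ChartedSpace (EuclideanSpace ℝ (Fin 4)) V]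
  [IsManifold (𝓡 4) ∞ V] (g : LorentzMetric V) (oV : ManifoldOrientation 4 V) (τ : TimeOrientation g)
  {S : Type*} [TopologicalSpace S] [ChartedSpace (EuclideanSpace ℝ (Fin 2)) S]
  [IsManifold (𝓡 2) 2 S] (oS : ManifoldOrientation 2 S)
  {ι : S → V} (hι : IsSpacelikeEmbedding g ι) {p : S}
include hι

include oV oS in
/-- The reversed Cauchy-Schwarz inequality for causal normal vectors, in the form of a sign. -/
lemma form_mul_nonneg_of_causal {X Z : TangentSpace (𝓡 4) (ι p)} (hX : IsNormalVector g ι p X)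
    (hZ : IsNormalVector g ι p Z) (hXX : g.form (ι p) X X ≤ 0) (hZZ : g.form (ι p) Z Z ≤ 0) :
    (0 ≤ g.form (ι p) X (τ.field (ι p)) * g.form (ι p) Z (τ.field (ι p)) → g.form (ι p) X Z ≤ 0) ∧
    (g.form (ι p) X (τ.field (ι p)) * g.form (ι p) Z (τ.field (ι p)) ≤ 0 →
      0 ≤ g.form (ι p) X Z) := by
  set T := normalPart g ι p (τ.field (ι p)) with hT
  have hTn : IsNormalVector g ι p T := isNormalVector_normalPart g hι _
  have hTT : g.form (ι p) T T < 0 := (form_normalPart_self_le g hι _).trans_lt (τ.timelike _)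
  have hTX : g.form (ι p) X (τ.field (ι p)) = g.form (ι p) T X := by
    rw [hT, form_normalPart_of_normal g hX, g.form_symm]
  have hTZ : g.form (ι p) Z (τ.field (ι p)) = g.form (ι p) T Z := by
    rw [hT, form_normalPart_of_normal g hZ, g.form_symm]
  have h1 := form_normalDual_sq g oV oS hι hTn hX
  have h2 := form_normalDual_sq g oV oS hι hTn hZ
  have h3 := form_normalDual_mul g oV oS hι hTn hX hZ
  rw [hTX, hTZ]
  set x := g.form (ι p) T X
  set z := g.form (ι p) T Z
  set x' := g.form (ι p) (normalDual g oV ι oS p T) X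
  set z' := g.form (ι p) (normalDual g oV ι oS p T) Z
  have h4 : x' ^ 2 ≤ x ^ 2 := by nlinarith [mul_nonneg_of_nonpos_of_nonpos hTT.le hXX]
  have h5 : z' ^ 2 ≤ z ^ 2 := by nlinarith [mul_nonneg_of_nonpos_of_nonpos hTT.le hZZ]
  have h6 : |x' * z'| ≤ |x * z| := by
    rw [abs_mul, abs_mul]
    exact mul_le_mul (sq_le_sq.1 h4) (sq_le_sq.1 h5) (abs_nonneg _) (abs_nonneg _)
  constructor
  · intro h
    rw [abs_of_nonneg h] at h6
    have := le_abs_self (x' * z')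
    by_contra! hc
    nlinarith [mul_neg_of_neg_of_pos hTT hc]
  · intro h
    rw [abs_of_nonpos h] at h6
    have := neg_abs_le (x' * z')
    by_contra! hc
    nlinarith [mul_pos_of_neg_of_neg hTT hc]

end CausalVectors

/-! ### The two integral statements -/

section DualMeanCurvature

variable {V : Type*} [TopologicalSpace V] [ChartedSpace (EuclideanSpace ℝ (Fin 4)) V]
  [IsManifold (𝓡 4) ∞ V] (g : LorentzMetric V) (oV : ManifoldOrientation 4 V)
  {S : Type*} [TopologicalSpace S] [ChartedSpace (EuclideanSpace ℝ (Fin 2)) S]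
  [IsManifold (𝓡 2) 2 S] (oS : ManifoldOrientation 2 S)
  {ι : S → V} (hι : IsSpacelikeEmbedding g ι) {p : S}
  {ξ : ∀ q : S, TangentSpace (𝓡 4) (ι q)} (hξ : ∀ q, ContMDiffAlong 2 ι 2 ξ q)
  (hξn : ∀ q, IsNormalVector g ι q (ξ q))
include hι hξ hξn

/-- The scalar product `ξ^⋆ · Δξ` is a divergence, since `∇^⊥` commutes with the antisymmetric
Hodge dual. -/
lemma form_normalDual_normalLaplacian :
    g.form (ι p) (normalDual g oV ι oS p (ξ p)) (normalLaplacian g ι ξ p) =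
      surfaceDiv g ι (normalDerivForm g ι (fun q => normalDual g oV ι oS q (ξ q)) ξ) p := by
  have hξ1 : ContMDiffAlong 2 ι 1 ξ p := (hξ p).of_le (by norm_num)
  rw [form_normalLaplacian g hι (T := fun q => normalDual g oV ι oS q (ξ q)) (hξ1.normalDual g oV oS hι le_rfl)
    (isNormalVector_normalDual g oV oS _) (hξ p), surfaceTrace_antisymm, sub_zero]
  intro v w
  rw [normalDeriv_normalDual g oV oS hι hξ1 (Eventually.of_forall hξn),
    normalDeriv_normalDual g oV oS hι hξ1 (Eventually.of_forall hξn), form_normalDual_antisymm,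
    g.form_symm]

/-- For a null field `ξ` the linear form `ξ^⋆ · ∇^⊥ ξ` vanishes. -/
lemma normalDerivForm_eq_zero_of_null (h0 : ∀ q, g.form (ι q) (ξ q) (ξ q) = 0) (p : S) :
    normalDerivForm g ι (fun q => normalDual g oV ι oS q (ξ q)) ξ p = 0 := by
  have hξ1 : ContMDiffAlong 2 ι 1 ξ p := (hξ p).of_le (by norm_num)
  ext v
  rw [normalDerivForm_apply, LinearMap.zero_apply]
  have h1 := vderiv_form_normal g hι hξ1 hξ1 (hξn p) (hξn p) v
  rw [show (fun q => g.form (ι q) (ξ q) (ξ q)) = fun _ => 0 from funext h0, vderiv_const,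
    g.form_symm _ (normalDeriv g ι ξ p v)] at h1
  have h2 := form_normalDual_sq g oV oS hι (hξn p) (isNormalVector_normalDeriv g hι ξ v)
  rw [h0, zero_mul, show g.form (ι p) (ξ p) (normalDeriv g ι ξ p v) = 0 by linarith] at h2
  exact pow_eq_zero_iff two_ne_zero |>.1 (by linarith)

variable [T2Space S] [CompactSpace S] [MeasurableSpace S] [BorelSpace S]

lemma integral_traceIntegrand_eq_zero {B : S → ℝ}
    (hB : ∀ p, meanCurvature g ι p = B p • normalDual g oV ι oS p (ξ p))
    (h : (∀ p, g.form (ι p) (ξ p) (ξ p) = 0) ∨ ∃ b : ℝ, ∀ p, B p = b) :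
    ∫ p, traceIntegrand g ι ξ p ∂(riemannianVolume (inducedMetric g ι)) = 0 := by
  have h1 : ∀ p, traceIntegrand g ι ξ p =
      B p * surfaceDiv g ι (normalDerivForm g ι (fun q => normalDual g oV ι oS q (ξ q)) ξ) p := fun p => by
    rw [traceIntegrand, hB, g.form_smul_left, form_normalDual_normalLaplacian g oV oS hι hξ hξn]
  simp only [h1]
  rcases h with h0 | ⟨b, hb⟩
  · simp [surfaceDiv_eq_zero g
      (Eventually.of_forall (normalDerivForm_eq_zero_of_null g oV oS hι hξ hξn h0))]
  · have h2 := (integral_surfaceDiv g hι fun q => contMDiffCovectorAt_normalDerivForm g hι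
      (T := fun q => normalDual g oV ι oS q (ξ q))
      (ContMDiffAlong.normalDual g oV oS hι le_rfl ((hξ q).of_le (by norm_num))) (hξ q)).2
    simp only [hb, integral_const_mul, h2, mul_zero]

lemma integral_traceIntegrand_nonneg {a c : ℝ}
    (ha : ∀ p, g.form (ι p) (ξ p) (meanCurvature g ι p) = a)
    (hc : ∀ p, g.form (ι p) (ξ p) (normalDual g oV ι oS p (meanCurvature g ι p)) = c) (hac : |c| ≤ a) :
    0 ≤ ∫ p, traceIntegrand g ι ξ p ∂(riemannianVolume (inducedMetric g ι)) := by
  have h : ∀ ε : ℝ, ∀ q,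
      g.form (ι q) (nullPart g oV oS ε q (meanCurvature g ι q)) (ξ q) = a - ε * c := fun ε q => by
    rw [form_nullPart, ← ha q, ← hc q, g.form_symm, g.form_symm _ (normalDual g oV ι oS q _)]
  obtain ⟨h1, h2⟩ := abs_le.1 hac
  obtain ⟨i1, n1⟩ := integral_nullPart_nonneg g oV oS hι hξ hξn (ε := 1) (by norm_num)
    (by linarith) (h 1)
  obtain ⟨i2, n2⟩ := integral_nullPart_nonneg g oV oS hι hξ hξn (ε := -1) (by norm_num)
    (by linarith) (h (-1))
  have h3 : traceIntegrand g ι ξ = fun q => (1 / 2 : ℝ) *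
      (g.form (ι q) (nullPart g oV oS 1 q (meanCurvature g ι q)) (normalLaplacian g ι ξ q) +
        g.form (ι q) (nullPart g oV oS (-1) q (meanCurvature g ι q)) (normalLaplacian g ι ξ q)) := by
    funext q
    rw [traceIntegrand, form_nullPart, form_nullPart]
    ring
  rw [h3, integral_const_mul, integral_add i1 i2]
  linarith

end DualMeanCurvature

end

theorem lemma7
    {V : Type*} [TopologicalSpace V] [ChartedSpace (EuclideanSpace ℝ (Fin 4)) V]
    [IsManifold (𝓡 4) ∞ V]
    {S : Type*} [TopologicalSpace S] [ChartedSpace (EuclideanSpace ℝ (Fin 2)) S]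
    [IsManifold (𝓡 2) 2 S] [T2Space S] [CompactSpace S] [MeasurableSpace S] [BorelSpace S]
    (g : LorentzMetric V) (oV : ManifoldOrientation 4 V) (τ : TimeOrientation g)
    (oS : ManifoldOrientation 2 S)
    (ι : S → V) (hι : IsSpacelikeEmbedding g ι)
    (ξ : ∀ p : S, TangentSpace (𝓡 4) (ι p))
    (hξ : ContMDiff (𝓡 2) (𝓡 4).tangent 2 (fun p => (⟨ι p, ξ p⟩ : TangentBundle (𝓡 4) V)))
    (hξn : ∀ p, IsNormalVector g ι p (ξ p)) :
    -- the integrand of `I` is integrable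
    Integrable (traceIntegrand g ι ξ) (riemannianVolume (inducedMetric g ι)) ∧
    -- part (a)
    (∀ B : S → ℝ,
      (∀ p, meanCurvature g ι p = B p • normalDual g oV ι oS p (ξ p)) →
      ((∀ p, g.form (ι p) (ξ p) (ξ p) = 0) ∨ (∃ b : ℝ, ∀ p, B p = b)) →
      ∫ p, traceIntegrand g ι ξ p ∂(riemannianVolume (inducedMetric g ι)) = 0) ∧
    -- part (b)
    (∀ a c : ℝ,
      (∀ p, g.form (ι p) (ξ p) (meanCurvature g ι p) = a) →
      (∀ p, g.form (ι p) (ξ p) (normalDual g oV ι oS p (meanCurvature g ι p)) = c) →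
      ((∀ p, IsFutureCausal τ (ι p) (ξ p) ∧ IsPastCausal τ (ι p) (meanCurvature g ι p)) ∨
        (∀ p, IsPastCausal τ (ι p) (ξ p) ∧ IsFutureCausal τ (ι p) (meanCurvature g ι p)) ∨
        (∀ p, IsFutureCausal τ (ι p) (normalDual g oV ι oS p (ξ p)) ∧
          IsFutureCausal τ (ι p) (normalDual g oV ι oS p (meanCurvature g ι p))) ∨
        (∀ p, IsPastCausal τ (ι p) (normalDual g oV ι oS p (ξ p)) ∧
          IsPastCausal τ (ι p) (normalDual g oV ι oS p (meanCurvature g ι p)))) →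
      0 ≤ ∫ p, traceIntegrand g ι ξ p ∂(riemannianVolume (inducedMetric g ι))) := by
  have hξ' : ∀ q, ContMDiffAlong 2 ι 2 ξ q := fun q => hξ q
  refine ⟨integrable_of_continuous g hι (continuous_traceIntegrand g oV oS hι hξ'),
    fun B hB h => integral_traceIntegrand_eq_zero g oV oS hι hξ' hξn hB h, fun a c ha hc h => ?_⟩
  rcases isEmpty_or_nonempty S with hS | ⟨⟨p⟩⟩
  · rw [Measure.eq_zero_of_isEmpty (riemannianVolume (inducedMetric g ι)), integral_zero_measure]
  refine integral_traceIntegrand_nonneg g oV oS hι hξ' hξn ha hc ?_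
  have hH : IsNormalVector g ι p (meanCurvature g ι p) := isNormalVector_meanCurvature g hι
  have hsq := form_normalDual_sq g oV oS hι hH (hξn p)
  have hap := ha p
  have hcp := hc p
  rw [g.form_symm] at hap hcp
  rw [hap, hcp] at hsq
  -- in all cases `ξ · H ≥ 0` and `(ξ · ξ) (H · H) ≥ 0`
  suffices h' : 0 ≤ a ∧ 0 ≤ g.form (ι p) (meanCurvature g ι p) (meanCurvature g ι p) *
      g.form (ι p) (ξ p) (ξ p) by
    refine abs_le_of_sq_le_sq ?_ h'.1
    linarith [h'.2]
  have hJξ := isNormalVector_normalDual g oV oS (ξ p)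
  have hJH := isNormalVector_normalDual g oV oS (meanCurvature g ι p)
  have eξ := form_normalDual_self_self g oV oS hι (hξn p)
  have eH := form_normalDual_self_self g oV oS hι hH
  have eHξ := form_normalDual_normalDual g oV oS hι hH (hξn p)
  rw [hap] at eHξ
  have h1 := form_mul_nonneg_of_causal g oV τ oS hι hH (hξn p)
  have h2 := form_mul_nonneg_of_causal g oV τ oS hι hJH hJξ
  rw [hap] at h1
  rw [eHξ, eH, eξ] at h2
  rcases h with h | h | h | h
  · obtain ⟨⟨k1, k2⟩, k3, k4⟩ := h p
    exact ⟨(h1 k3 k1).2 (mul_nonpos_of_nonneg_of_nonpos k4 k2), mul_nonneg_of_nonpos_of_nonpos k3 k1⟩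
  · obtain ⟨⟨k1, k2⟩, k3, k4⟩ := h p
    exact ⟨(h1 k3 k1).2 (mul_nonpos_of_nonpos_of_nonneg k4 k2), mul_nonneg_of_nonpos_of_nonpos k3 k1⟩
  · obtain ⟨⟨k1, k2⟩, k3, k4⟩ := h p
    rw [eξ] at k1
    rw [eH] at k3
    have := (h2 k3 k1).1 (mul_nonneg_of_nonpos_of_nonpos k4 k2)
    exact ⟨by linarith, mul_nonneg (by linarith) (by linarith)⟩
  · obtain ⟨⟨k1, k2⟩, k3, k4⟩ := h p
    rw [eξ] at k1
    rw [eH] at k3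
    have := (h2 k3 k1).1 (mul_nonneg k4 k2)
    exact ⟨by linarith, mul_nonneg (by linarith) (by linarith)⟩
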